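/- Setting. Let $\langle\cdot,\cdot\rangle$ be the scalar product of the real space $L^2(0,\pi)$, and let $\varphi_0 = 1/\sqrt{\pi}$, $\varphi_k(x)=\sqrt{2/\pi}\,\cos(kx)$ for $k\ge 1$, be the orthonormal basis of eigenfunctions of the Neumann Laplacian. Let $H^1_N(0,\pi)$ be the space of those $f\in L^2(0,\pi)$ with $\|f\|_{H^1_N}^2=\sum_{k\ge 0}|(1+k)\langle f,\varphi_k\rangle|^2<\infty$, and let $H^{-1}_N(0,\pi)$ be its dual, whose bracket with $H^1_N(0,\pi)$ is also written $\langle\cdot,\cdot\rangle$. Let $\Gamma\in C^2(H^1_N(0,\pi);H^{-1}_N(0,\pi))$ be such that, for some $C_\Gamma>0$ and all $z\in H^1_N(0,\pi)$, $\|\Gamma'[z]\|+\|\Gamma''[z]\|\le C_\Gamma$ (operator norms). Consider the control system $$\partial_t z-\partial_{xx}z=u(t)\,\Gamma[z(t)]\ \text{ on } (0,T)\times(0,\pi),\qquad \partial_x z(t,0)=\partial_x z(t,\pi)=0,\qquad z(0)=z_0,\tag{$*$}$$ with state $z\in C^0([0,T];L^2(0,\pi))\cap L^2((0,T);H^1_N(0,\pi))$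 (weak solutions) and scalar control $u$. For $m\ge1$, the system is called $H^m$-STLNC (small-time locally null controllable) if for all $T,\eta>0$ there is $\delta>0$ such that, for every $z_0\in L^2(0,\pi)$ with $\|z_0\|_{L^2}\le\delta$, there is $u\in H^m(0,T)$ with $\|u\|_{H^m(0,T)}\le\eta$ for which the solution of $(*)$ satisfies $z(T)=0$; here $\|u\|_{H^m(0,T)}^2=\sum_{k=0}^m\int_0^T|u^{(k)}|^2$. For a control $u$ put $u_0=u$ and $u_{k+1}(t)=\int_0^t u_k(\tau)\,d\tau$. Finally put $\mu=\Gamma[0]$ and $c_j=\langle\mu,\varphi_j\rangle\,\langle\Gamma'[0]\varphi_j,\varphi_0\rangle$ for $j\ge1$. Theorem. Let $n\ge1$ be an integer. Assume that $\langle\mu,\varphi_0\rangle=0$, that there are $n$ different indices $j$ with $\langle\mu,\varphi_j\rangle\ne0$, and that $$\sum_{j=1}^\infty j^{4n}|c_j|<\infty,\qquad \sum_{j=1}^\infty j^{2(2\ell-1)}c_j=0\ \text{ for every } \ell\in\{1,\dots,n-1\},\qquad a:=\sum_{j=1}^\infty j^{2(2n-1)}c_j\ne0.$$ Then the system $(*)$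 is not $H^{2n+2}$-STLNC. More precisely, for every $\varepsilon>0$ there exists $T^*>0$ such that, for every $T\in(0,T^*)$, there exists $\eta>0$ such that, for every $\delta\in[-1,1]$ and every $u\in H^{2n+2}(0,T)$ with $\|u\|_{H^{2n+2}(0,T)}\le\eta$: if the solution of $(*)$ with initial data $z_0=\delta\varphi_0$ satisfies $\langle z(T),\varphi_j\rangle=0$ for every $j\ge1$, then $$\left|\langle z(T),\varphi_0\rangle-\delta+a(-1)^n\|u_n\|_{L^2(0,T)}^2\right|\le\varepsilon\left(|\delta|+\|u_n\|_{L^2(0,T)}^2\right).$$ -/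

import Mathlib

open MeasureTheory Set Filter Topology
open scoped ContDiff

noncomputable section

namespace NeumannHeat

/-- The real Lebesgue space `L²(0,π)`. -/
abbrev L2 : Type := Lp ℝ 2 ((volume : Measure ℝ).restrict (Ioo 0 Real.pi))

/-- The eigenfunctions of the Neumann Laplacian: `1/√π` for `k = 0`, and `√2 cos(kx)/√π` for
`k ≥ 1`. -/
def phiFun (k : ℕ) (x : ℝ) : ℝ :=
  (1 / Real.sqrt Real.pi) * (if k = 0 then 1 else Real.sqrt 2 * Real.cos (k * x))

theorem continuous_phiFun (k : ℕ) : Continuous (phiFun k) := by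
  unfold phiFun
  split_ifs <;> fun_prop

theorem memLp_of_continuous {g : ℝ → ℝ} (hg : Continuous g) :
    MemLp g 2 ((volume : Measure ℝ).restrict (Ioo 0 Real.pi)) := by
  obtain ⟨C, hC⟩ := (isCompact_Icc (a := (0 : ℝ)) (b := Real.pi)).exists_bound_of_continuousOn
    hg.continuousOn
  refine MemLp.of_bound hg.aestronglyMeasurable C ?_
  filter_upwards [ae_restrict_mem measurableSet_Ioo] with x hx
  exact hC x (Ioo_subset_Icc_self hx)

/-- `φ_k` as an element of `L²(0,π)`. -/
def phi (k : ℕ) : L2 := (memLp_of_continuous (continuous_phiFun k)).toLp (phiFun k)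

/-- The mode `⟨f, φ_k⟩` of `f ∈ L²(0,π)`. -/
def coef (f : L2) (k : ℕ) : ℝ := inner ℝ f (phi k)

theorem coef_eq_integral (f : L2) (k : ℕ) :
    coef f k = ∫ x in Ioo 0 Real.pi, f x * phiFun k x := by
  unfold coef
  rw [MeasureTheory.L2.inner_def]
  refine integral_congr_ae ?_
  filter_upwards [(memLp_of_continuous (continuous_phiFun k)).coeFn_toLp] with x hx
  simp only [phi, hx]
  simp [mul_comm]

theorem coef_add (f g : L2) (k : ℕ) : coef (f + g) k = coef f k + coef g k := by
  simp [coef, inner_add_left]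

theorem coef_smul (c : ℝ) (f : L2) (k : ℕ) : coef (c • f) k = c * coef f k := by
  simp [coef, inner_smul_left]

theorem coef_zero (k : ℕ) : coef 0 k = 0 := by
  simp [coef]

theorem integrable_mul {g : ℝ → ℝ} (f : L2) (hg : Continuous g) :
    IntegrableOn (fun x => f x * g x) (Ioo 0 Real.pi) :=
  (Lp.memLp f).integrable_mul (memLp_of_continuous hg)

/-- The family `(φ_k)` is total in `L²(0,π)`. -/
theorem eq_zero_of_coef (f : L2) (h : ∀ k, coef f k = 0) : f = 0 := by
  have hcos : ∀ k : ℕ, ∫ x in Ioo 0 Real.pi, f x * Real.cos (k * x) = 0 := by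
    intro k
    have h1 := h k
    rw [coef_eq_integral] at h1
    have hpi : Real.sqrt Real.pi ≠ 0 := by positivity
    by_cases hk : k = 0
    · subst hk
      have : ∀ x : ℝ, f x * phiFun 0 x = (1 / Real.sqrt Real.pi) * (f x * Real.cos ((0 : ℕ) * x)) := by
        intro x; simp [phiFun]; ring
      simp_rw [this] at h1
      rw [integral_const_mul] at h1
      exact (mul_eq_zero.mp h1).resolve_left (by positivity)
    · have : ∀ x : ℝ, f x * phiFun k x
          = (1 / Real.sqrt Real.pi * Real.sqrt 2) * (f x * Real.cos (k * x)) := by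
        intro x; simp [phiFun, hk]; ring
      simp_rw [this] at h1
      rw [integral_const_mul] at h1
      exact (mul_eq_zero.mp h1).resolve_left (by positivity)
  have hpow : ∀ n : ℕ, ∀ k : ℕ,
      ∫ x in Ioo 0 Real.pi, f x * (Real.cos x ^ n * Real.cos (k * x)) = 0 := by
    intro n
    induction n with
    | zero => intro k; simpa using hcos k
    | succ n ih =>
      intro k
      rcases k with _ | k
      · have := ih 1
        simpa [pow_succ] using this
      · have e : ∀ x : ℝ, f x * (Real.cos x ^ (n + 1) * Real.cos ((k + 1 : ℕ) * x))
            = (1 / 2) * (f x * (Real.cos x ^ n * Real.cos ((k + 2 : ℕ) * x)))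
              + (1 / 2) * (f x * (Real.cos x ^ n * Real.cos (k * x))) := by
          intro x
          have h1 : ((k + 2 : ℕ) : ℝ) * x = ((k + 1 : ℕ) : ℝ) * x + x := by push_cast; ring
          have h2 : (k : ℝ) * x = ((k + 1 : ℕ) : ℝ) * x - x := by push_cast; ring
          rw [h1, h2, Real.cos_add, Real.cos_sub]
          ring
        simp_rw [e]
        rw [integral_add, integral_const_mul, integral_const_mul, ih, ih]
        · simp
        · exact (integrable_mul f (by fun_prop)).const_mul _
        · exact (integrable_mul f (by fun_prop)).const_mul _
  have hpoly : ∀ p : Polynomial ℝ, ∫ x in Ioo 0 Real.pi, f x * p.eval (Real.cos x) = 0 := by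
    intro p
    induction p using Polynomial.induction_on' with
    | add p q hp hq =>
      simp_rw [Polynomial.eval_add, mul_add]
      rw [integral_add, hp, hq, add_zero]
      · exact integrable_mul f (p.continuous.comp Real.continuous_cos)
      · exact integrable_mul f (q.continuous.comp Real.continuous_cos)
    | monomial n c =>
      have e : ∀ x : ℝ, f x * (Polynomial.monomial n c).eval (Real.cos x)
          = c * (f x * (Real.cos x ^ n * Real.cos ((0 : ℕ) * x))) := by
        intro x; simp [Polynomial.eval_monomial]; ring
      simp_rw [e]
      rw [integral_const_mul, hpow, mul_zero]
  have hcont : ∀ g : ℝ → ℝ, Continuous g → ∫ x in Ioo 0 Real.pi, f x * g x = 0 := by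
    intro g hg
    have hfi : IntegrableOn (fun x => f x) (Ioo 0 Real.pi) := by
      simpa using integrable_mul f (continuous_const (y := (1 : ℝ)))
    set M : ℝ := ∫ x in Ioo 0 Real.pi, |f x| with hM
    have hM0 : 0 ≤ M := integral_nonneg fun x => abs_nonneg _
    by_contra hne
    set I : ℝ := ∫ x in Ioo 0 Real.pi, f x * g x with hI
    have hI0 : 0 < |I| := abs_pos.mpr hne
    set ε : ℝ := |I| / (2 * (M + 1)) with hε
    have hε0 : 0 < ε := by positivity
    obtain ⟨p, hp⟩ := exists_polynomial_near_of_continuousOn (-1) 1 (fun y => g (Real.arccos y))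
      (hg.comp Real.continuous_arccos).continuousOn ε hε0
    have hdiff : I = ∫ x in Ioo 0 Real.pi, f x * (g x - p.eval (Real.cos x)) := by
      have e : ∀ x : ℝ, f x * (g x - p.eval (Real.cos x))
          = f x * g x - f x * p.eval (Real.cos x) := fun x => by ring
      simp_rw [e]
      rw [integral_sub (integrable_mul f hg)
        (integrable_mul f (g := fun x => p.eval (Real.cos x))
          (p.continuous.comp Real.continuous_cos)), hpoly, sub_zero]
    have hle : |I| ≤ ε * M := by
      rw [hdiff, ← Real.norm_eq_abs, hM, ← integral_const_mul]
      refine norm_integral_le_of_norm_le (hfi.abs.const_mul ε) ?_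
      filter_upwards [ae_restrict_mem measurableSet_Ioo] with x hx
      have h1 := hp (Real.cos x) ⟨Real.neg_one_le_cos x, Real.cos_le_one x⟩
      simp only [Real.arccos_cos hx.1.le hx.2.le] at h1
      rw [Real.norm_eq_abs, abs_mul, mul_comm, abs_sub_comm]
      exact mul_le_mul_of_nonneg_right h1.le (abs_nonneg _)
    have : ε * M < |I| := by
      rw [hε, div_mul_eq_mul_div, div_lt_iff₀ (by positivity)]
      nlinarith
    linarith
  have hae : ∀ᵐ x ∂(volume : Measure ℝ), x ∈ Ioo 0 Real.pi → f x = 0 := by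
    refine isOpen_Ioo.ae_eq_zero_of_integral_contDiff_smul_eq_zero ?_ ?_
    · have hfi : IntegrableOn (fun x => f x) (Ioo 0 Real.pi) := by
        simpa using integrable_mul f (continuous_const (y := (1 : ℝ)))
      exact hfi.locallyIntegrableOn
    · intro g hg _ hgs
      have h1 := hcont g hg.continuous
      rw [setIntegral_eq_integral_of_forall_compl_eq_zero] at h1
      · simpa [mul_comm] using h1
      · intro x hx
        have : g x = 0 := image_eq_zero_of_notMem_tsupport fun hx' => hx (hgs hx')
        simp [this]
  rw [Lp.eq_zero_iff_ae_eq_zero]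
  exact (ae_restrict_iff' measurableSet_Ioo).mpr hae

theorem integral_cos_nat (m : ℤ) (hm : m ≠ 0) : ∫ x in (0 : ℝ)..Real.pi, Real.cos (m * x) = 0 := by
  have hm' : (m : ℝ) ≠ 0 := by exact_mod_cast hm
  rw [intervalIntegral.integral_comp_mul_left _ hm']
  simp [Real.sin_int_mul_pi]

theorem coef_phi_of_ne {k j : ℕ} (hkj : k ≠ j) : coef (phi k) j = 0 := by
  rw [coef_eq_integral]
  have h1 : ∫ x in Ioo 0 Real.pi, (phi k) x * phiFun j x
      = ∫ x in Ioo 0 Real.pi, phiFun k x * phiFun j x := by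
    refine integral_congr_ae ?_
    filter_upwards [(memLp_of_continuous (continuous_phiFun k)).coeFn_toLp] with x hx
    simp only [phi, hx]
  rw [h1, ← integral_Ioc_eq_integral_Ioo, ← intervalIntegral.integral_of_le Real.pi_pos.le]
  have hprod : ∃ c : ℝ, ∀ x : ℝ, phiFun k x * phiFun j x
      = c * (Real.cos (((k : ℤ) - (j : ℤ) : ℤ) * x) + Real.cos (((k : ℤ) + (j : ℤ) : ℤ) * x)) := by
    have hk : ∀ k : ℕ, ∃ c : ℝ, ∀ x : ℝ, phiFun k x = c * Real.cos (k * x) := by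
      intro k
      by_cases h : k = 0
      · exact ⟨1 / Real.sqrt Real.pi, fun x => by simp [phiFun, h]⟩
      · exact ⟨1 / Real.sqrt Real.pi * Real.sqrt 2, fun x => by simp [phiFun, h]; ring⟩
    obtain ⟨c, hc⟩ := hk k
    obtain ⟨d, hd⟩ := hk j
    refine ⟨c * d / 2, fun x => ?_⟩
    rw [hc, hd]
    push_cast
    rw [sub_mul, add_mul, Real.cos_add, Real.cos_sub]
    ring
  obtain ⟨c, hc⟩ := hprod
  simp_rw [hc]
  rw [intervalIntegral.integral_const_mul, intervalIntegral.integral_add,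
    integral_cos_nat _ (by omega), integral_cos_nat _ (by omega)]
  · simp
  · exact Continuous.intervalIntegrable (by fun_prop) _ _
  · exact Continuous.intervalIntegrable (by fun_prop) _ _

/-- The set of those `f ∈ L²(0,π)` with `∑_k |(1+k) ⟨f, φ_k⟩|² < ∞`. -/
def h1Submodule : Submodule ℝ L2 where
  carrier := {f | Summable fun k : ℕ => |(1 + (k : ℝ)) * coef f k| ^ 2}
  zero_mem' := by simp [coef_zero, summable_zero]
  add_mem' := by
    intro f g hf hg
    simp only [mem_ofPred_eq] at hf hg ⊢
    refine Summable.of_nonneg_of_le (fun k => by positivity) (fun k => ?_)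
      ((hf.mul_left 2).add (hg.mul_left 2))
    rw [coef_add]
    simp only [sq_abs]
    nlinarith [sq_nonneg ((1 + (k : ℝ)) * coef f k - (1 + (k : ℝ)) * coef g k)]
  smul_mem' := by
    intro c f hf
    simp only [mem_ofPred_eq] at hf ⊢
    refine (hf.mul_left (c ^ 2)).congr (fun k => ?_)
    rw [coef_smul]
    simp only [sq_abs]
    ring

/-- The weighted modes `((1+k) ⟨f, φ_k⟩)_k` as an element of `ℓ²`. -/
def weightedModes : h1Submodule →ₗ[ℝ] lp (fun _ : ℕ => ℝ) 2 where
  toFun f := ⟨fun k => (1 + (k : ℝ)) * coef (f : L2) k, by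
    refine (memℓp_gen_iff (by simp)).mpr ?_
    have hf : Summable fun k : ℕ => |(1 + (k : ℝ)) * coef (f : L2) k| ^ 2 := f.2
    simpa [Real.norm_eq_abs] using hf⟩
  map_add' f g := by
    ext k
    simp only [Submodule.coe_add, coef_add, mul_add]
    rfl
  map_smul' c f := by
    ext k
    simp [coef_smul, mul_left_comm]

theorem weightedModes_injective : Function.Injective weightedModes := by
  rw [← LinearMap.ker_eq_bot, LinearMap.ker_eq_bot']
  intro f hf
  have h0 : (f : L2) = 0 := by
    refine eq_zero_of_coef _ (fun k => ?_)
    have h1 : (1 + (k : ℝ)) * coef (f : L2) k = 0 := by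
      have := congrArg (fun s : lp (fun _ : ℕ => ℝ) 2 => s k) hf
      simpa [weightedModes] using this
    exact (mul_eq_zero.mp h1).resolve_left (by positivity)
  exact Subtype.ext h0

/-- The Sobolev space `H¹_N(0,π)`; it gets its own norm below, not that of `L²(0,π)`. -/
def H1N : Type := h1Submodule

/-- The norm of `H¹_N(0,π)`, that is `‖f‖² = ∑_k |(1+k) ⟨f, φ_k⟩|²`; the vector space operations
are those of `L²(0,π)`. -/
instance : NormedAddCommGroup H1N :=
  NormedAddCommGroup.induced h1Submodule (lp (fun _ : ℕ => ℝ) 2) weightedModes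
    weightedModes_injective

instance : NormedSpace ℝ H1N where
  toModule := inferInstanceAs (Module ℝ h1Submodule)
  norm_smul_le c f := by
    let g : h1Submodule := f
    change ‖weightedModes (c • g)‖ ≤ ‖c‖ * ‖weightedModes g‖
    rw [map_smul]
    exact norm_smul_le c (weightedModes g)

/-- The inclusion of `H¹_N(0,π)` in `L²(0,π)`. -/
def toL2 : H1N →ₗ[ℝ] L2 where
  toFun f := f.1
  map_add' _ _ := rfl
  map_smul' _ _ := rfl

theorem H1N_norm_sq (f : H1N) :
    ‖f‖ ^ 2 = ∑' k : ℕ, |(1 + (k : ℝ)) * coef (toL2 f) k| ^ 2 := by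
  have h1 : ‖f‖ = ‖weightedModes f‖ := rfl
  have h2 := lp.norm_rpow_eq_tsum (p := 2) (by simp) (weightedModes f)
  rw [h1]
  have h3 : ‖weightedModes f‖ ^ 2 = ∑' k : ℕ, |weightedModes f k| ^ 2 := by
    simpa [Real.norm_eq_abs] using h2
  exact h3

/-- `φ_k` as an element of `H¹_N(0,π)`. -/
def phiH (k : ℕ) : H1N := ⟨phi k, by
  change Summable fun j : ℕ => |(1 + (j : ℝ)) * coef (phi k) j| ^ 2
  refine summable_of_ne_finset_zero (s := {k}) (fun j hj => ?_)
  rw [coef_phi_of_ne (fun h => hj (by simp [h]))]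
  simp⟩

/-- The dual space `H⁻¹_N(0,π)` of `H¹_N(0,π)`, with the dual norm; the bracket `⟨F, v⟩` is
`F v`. -/
abbrev HNeg1N : Type := H1N →L[ℝ] ℝ

/-- The Dirichlet form `∫₀^π ∂ₓf ∂ₓg dx = ∑_k k² ⟨f, φ_k⟩ ⟨g, φ_k⟩`, i.e. the weak form of
`-∂ₓₓ` with homogeneous Neumann boundary conditions. The series converges absolutely on
`H¹_N(0,π)`. -/
def dirichletForm (f g : H1N) : ℝ := ∑' k : ℕ, (k : ℝ) ^ 2 * coef (toL2 f) k * coef (toL2 g) k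

/-- The standing assumption on the nonlinearity: `Γ ∈ C²(H¹_N; H⁻¹_N)` with `Γ'` and `Γ''`
bounded. -/
def IsAdmissible (Γ : H1N → HNeg1N) : Prop :=
  ContDiff ℝ 2 Γ ∧ ∃ C : ℝ, 0 < C ∧ ∀ z : H1N, ‖fderiv ℝ Γ z‖ + ‖iteratedFDeriv ℝ 2 Γ z‖ ≤ C

/-- `z ∈ C⁰([0,T]; L²) ∩ L²((0,T); H¹_N)` is a (weak) solution of
`∂ₜz - ∂ₓₓz = u(t) Γ[z(t)]`, `∂ₓz(t,0) = ∂ₓz(t,π) = 0`, `z(0) = z₀`. -/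
def IsSolution (Γ : H1N → HNeg1N) (T : ℝ) (u : ℝ → ℝ) (z₀ : L2) (z : ℝ → L2) : Prop :=
  ContinuousOn z (Icc 0 T) ∧ z 0 = z₀ ∧
  ∃ ζ : ℝ → H1N,
    MemLp ζ 2 ((volume : Measure ℝ).restrict (Ioo 0 T)) ∧
    (∀ᵐ t ∂((volume : Measure ℝ).restrict (Ioo 0 T)), toL2 (ζ t) = z t) ∧
    ∀ t ∈ Icc 0 T, ∀ v : H1N,
      inner ℝ (z t) (toL2 v) + ∫ s in (0 : ℝ)..t, dirichletForm (ζ s) v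
        = inner ℝ z₀ (toL2 v) + ∫ s in (0 : ℝ)..t, u s * Γ (ζ s) v

/-- `g` is the `k`-th derivative of `u` on `(0,T)` in the sense of distributions. -/
def IsWeakDeriv (T : ℝ) (k : ℕ) (u g : ℝ → ℝ) : Prop :=
  ∀ θ : ℝ → ℝ, ContDiff ℝ ∞ θ → HasCompactSupport θ → tsupport θ ⊆ Ioo 0 T →
    ∫ t in Ioo 0 T, u t * iteratedDeriv k θ t = (-1) ^ k * ∫ t in Ioo 0 T, g t * θ t

/-- `u ∈ H^m(0,T)`. -/
def MemSobolev (m : ℕ) (T : ℝ) (u : ℝ → ℝ) : Prop :=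
  MemLp u 2 ((volume : Measure ℝ).restrict (Ioo 0 T)) ∧
  ∀ k ≤ m, ∃ g : ℝ → ℝ, MemLp g 2 ((volume : Measure ℝ).restrict (Ioo 0 T)) ∧
    IsWeakDeriv T k u g

open Classical in
/-- The `k`-th distributional derivative of `u` on `(0,T)` when it belongs to `L²(0,T)` (it is
then unique almost everywhere). -/
def weakDeriv (T : ℝ) (k : ℕ) (u : ℝ → ℝ) : ℝ → ℝ :=
  if h : ∃ g : ℝ → ℝ, MemLp g 2 ((volume : Measure ℝ).restrict (Ioo 0 T)) ∧ IsWeakDeriv T k u g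
  then h.choose else 0

/-- The norm of `H^m(0,T)`. -/
def sobolevNorm (m : ℕ) (T : ℝ) (u : ℝ → ℝ) : ℝ :=
  Real.sqrt (∑ k ∈ Finset.range (m + 1), ∫ t in Ioo 0 T, |weakDeriv T k u t| ^ 2)

/-- The iterated primitives `u₀ = u`, `u_{n+1}(t) = ∫₀ᵗ u_n`. -/
def primitive (u : ℝ → ℝ) : ℕ → ℝ → ℝ
  | 0 => u
  | n + 1 => fun t => ∫ τ in (0 : ℝ)..t, primitive u n τ

/-- The squared norm `‖u_n‖²` in `L²(0,T)` of the `n`-th primitive of `u`. -/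
def primitiveNormSq (n : ℕ) (T : ℝ) (u : ℝ → ℝ) : ℝ := ∫ t in Ioo 0 T, |primitive u n t| ^ 2

/-- The `H^m` small-time local null controllability of the system. -/
def IsSTLNC (m : ℕ) (Γ : H1N → HNeg1N) : Prop :=
  ∀ T > 0, ∀ η > 0, ∃ δ > 0, ∀ z₀ : L2, ‖z₀‖ ≤ δ →
    ∃ u : ℝ → ℝ, MemSobolev m T u ∧ sobolevNorm m T u ≤ η ∧
      ∃ z : ℝ → L2, IsSolution Γ T u z₀ z ∧ z T = 0

/-- The coefficients `c_j = ⟨Γ[0], φ_j⟩ ⟨Γ'[0] φ_j, φ_0⟩`. -/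
def quadCoef (Γ : H1N → HNeg1N) (j : ℕ) : ℝ :=
  Γ 0 (phiH j) * (fderiv ℝ Γ 0 (phiH j)) (phiH 0)

end NeumannHeat

end

namespace NeumannHeat

/-! Since `⟨μ, φ_0⟩ = 0`, the linearised control does not act on the mode of `φ_0`, and `δ φ_0` is
stationary for the heat flow. To first order `z ≈ δ φ_0 + ∑ ⟨μ, φ_j⟩ y_j φ_j` with `y_j' = -j² y_j +
u`, `y_j(0) = 0`, where `y_j` is `linResp (j²) u`; inserting this in the first-order expansion of
`Γ` gives `⟨z(T), φ_0⟩ - δ ≈ ∑ c_j ∫ u y_j`. The errors are of size `‖u‖_∞ (|δ| + ‖u‖²)`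
(`solution_estimates`).

The quadratic form is computed by `n` integrations by parts: `∫ u y_j` equals `∑_{k<n} (-1)^k
j^{2(2k+1)} ‖u_{k+1}‖²`, plus terms containing `u_1(T), …, u_n(T)`, plus `(-1)^n j^{4n}` times the
same quadratic form evaluated at `u_n` (`quadForm_eq_sum`). After summation against `c_j` the moment
conditions cancel every norm except the last, which leaves the drift `-a (-1)^n ‖u_n‖²`
(`exists_quadForm_sum`).

Three kinds of error must be small compared with `|δ| + ‖u_n‖²`. The remaining integral is at most
`T ‖u_n‖² ∑ j^{4n} |c_j|`, which is small with `T`. The final values `u_k(T)` are handled by the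
hypothesis on the final state: as `z(T)` has no mode `j ≥ 1`, the linear modes `y_j(T)` are small
for `n` indices with `⟨μ, φ_j⟩ ≠ 0`, and a Vandermonde system recovers `u_1(T), …, u_n(T)` from them
up to `√T ‖u_n‖` (`exists_primitive_bound`). The cubic error `‖u‖_∞ ‖u‖²` is bounded by `C_T
‖u‖_{H^{2n+2}} ‖u_n‖²` through interpolation between `u_n` and the derivatives of `u`
(`exists_interpolation`); this is where a small Sobolev norm of the control is needed.

Such a drift has a sign. For `δ` of the sign opposite to `a (-1)^n`, the terms `-δ` and `a (-1)^n
‖u_n‖²` cannot compensate each other, so that the origin is not reached from `δ φ_0`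
(`not_isSTLNC_of_drift`). -/

/-! ### Modes in `H¹_N` and in its dual. -/

theorem coef_phi_self (k : ℕ) : coef (phi k) k = 1 := by
  rw [coef_eq_integral]
  have h1 : ∫ x in Ioo 0 Real.pi, (phi k) x * phiFun k x
      = ∫ x in Ioo 0 Real.pi, phiFun k x * phiFun k x := by
    refine integral_congr_ae ?_
    filter_upwards [(memLp_of_continuous (continuous_phiFun k)).coeFn_toLp] with x hx
    simp only [phi, hx]
  rw [h1, ← integral_Ioc_eq_integral_Ioo, ← intervalIntegral.integral_of_le Real.pi_pos.le]
  have hpi : Real.sqrt Real.pi * Real.sqrt Real.pi = Real.pi :=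
    Real.mul_self_sqrt Real.pi_pos.le
  have hpi0 := Real.pi_pos.ne'
  have hs0 : Real.sqrt Real.pi ≠ 0 := by positivity
  by_cases hk : k = 0
  · subst hk
    have : ∀ x : ℝ, phiFun 0 x * phiFun 0 x = 1 / Real.pi := by
      intro x
      simp only [phiFun, if_true, mul_one]
      rw [div_mul_div_comm, hpi, one_mul]
    simp_rw [this]
    simp [hpi0]
  · have h2 : Real.sqrt 2 * Real.sqrt 2 = 2 := Real.mul_self_sqrt (by norm_num)
    have : ∀ x : ℝ, phiFun k x * phiFun k x
        = 1 / Real.pi * (1 + Real.cos (((2 * k : ℤ) : ℝ) * x)) := by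
      intro x
      have h3 : ((2 * k : ℤ) : ℝ) * x = 2 * ((k : ℝ) * x) := by push_cast; ring
      rw [h3, Real.cos_two_mul]
      simp only [phiFun, hk, if_false]
      calc _ = 1 / (Real.sqrt Real.pi * Real.sqrt Real.pi) * (Real.sqrt 2 * Real.sqrt 2)
            * Real.cos (k * x) ^ 2 := by field_simp
        _ = _ := by rw [hpi, h2]; ring
    simp_rw [this]
    rw [intervalIntegral.integral_const_mul, intervalIntegral.integral_add,
      integral_cos_nat _ (by omega)]
    · simp [hpi0]
    · simp
    · exact Continuous.intervalIntegrable (by fun_prop) _ _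

theorem coef_phi (k j : ℕ) : coef (phi k) j = if k = j then 1 else 0 := by
  split_ifs with h
  · rw [h, coef_phi_self]
  · exact coef_phi_of_ne h

theorem coef_toL2_phiH (k j : ℕ) : coef (toL2 (phiH k)) j = if k = j then 1 else 0 :=
  coef_phi k j

theorem H1N_summable (f : H1N) : Summable fun k : ℕ => |(1 + (k : ℝ)) * coef (toL2 f) k| ^ 2 :=
  f.2

theorem sum_modes_le_norm_sq (f : H1N) (s : Finset ℕ) :
    ∑ k ∈ s, (1 + (k : ℝ)) ^ 2 * coef (toL2 f) k ^ 2 ≤ ‖f‖ ^ 2 := by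
  rw [H1N_norm_sq]
  refine le_trans (le_of_eq ?_) ((H1N_summable f).sum_le_tsum s fun k _ => by positivity)
  exact Finset.sum_congr rfl fun k _ => by rw [sq_abs, mul_pow]

theorem abs_coef_le_norm (f : H1N) (k : ℕ) : |coef (toL2 f) k| ≤ ‖f‖ := by
  have h := sum_modes_le_norm_sq f {k}
  rw [Finset.sum_singleton] at h
  refine abs_le_of_sq_le_sq (le_trans ?_ h) (norm_nonneg f)
  have hk : (0 : ℝ) ≤ k := k.cast_nonneg
  nlinarith [mul_nonneg hk (sq_nonneg (coef (toL2 f) k)),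
    mul_nonneg (mul_nonneg hk hk) (sq_nonneg (coef (toL2 f) k))]

/-- The mode `f ↦ ⟨f, φ_k⟩` as a continuous linear functional on `H¹_N(0,π)`. -/
noncomputable def coefH (k : ℕ) : H1N →L[ℝ] ℝ :=
  LinearMap.mkContinuous
    { toFun := fun f => coef (toL2 f) k
      map_add' := fun f g => by rw [map_add, coef_add]
      map_smul' := fun c f => by rw [map_smul, coef_smul]; rfl } 1
    (fun f => by simpa using abs_coef_le_norm f k)

@[simp] theorem coefH_apply (k : ℕ) (f : H1N) : coefH k f = coef (toL2 f) k := rfl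

/-- The partial sum `∑_{k<J} ⟨f, φ_k⟩ φ_k`. -/
noncomputable def partialSum (J : ℕ) (f : H1N) : H1N :=
  ∑ k ∈ Finset.range J, coef (toL2 f) k • phiH k

theorem coefH_sum (w : ℕ → ℝ) (s : Finset ℕ) (j : ℕ) :
    coef (toL2 (∑ k ∈ s, w k • phiH k)) j = if j ∈ s then w j else 0 := by
  rw [← coefH_apply, map_sum]
  simp only [map_smul, coefH_apply, coef_toL2_phiH, smul_eq_mul]
  simp

theorem norm_sq_sum (w : ℕ → ℝ) (s : Finset ℕ) :
    ‖∑ k ∈ s, w k • phiH k‖ ^ 2 = ∑ k ∈ s, (1 + (k : ℝ)) ^ 2 * w k ^ 2 := by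
  rw [H1N_norm_sq, tsum_eq_sum (s := s)]
  · refine Finset.sum_congr rfl fun k hk => ?_
    rw [coefH_sum, if_pos hk, sq_abs, mul_pow]
  · intro k hk
    rw [coefH_sum, if_neg hk]
    simp

theorem norm_partialSum_sq (J : ℕ) (f : H1N) :
    ‖partialSum J f‖ ^ 2 = ∑ k ∈ Finset.range J, (1 + (k : ℝ)) ^ 2 * coef (toL2 f) k ^ 2 :=
  norm_sq_sum _ _

theorem norm_partialSum_le (J : ℕ) (f : H1N) : ‖partialSum J f‖ ≤ ‖f‖ := by
  refine abs_le_of_sq_le_sq' ?_ (norm_nonneg f) |>.2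
  rw [norm_partialSum_sq]
  exact sum_modes_le_norm_sq f _

theorem tendsto_sum_modes (f : H1N) :
    Tendsto (fun J => ∑ k ∈ Finset.range J, (1 + (k : ℝ)) ^ 2 * coef (toL2 f) k ^ 2) atTop
      (𝓝 (‖f‖ ^ 2)) := by
  rw [H1N_norm_sq]
  refine (H1N_summable f).hasSum.tendsto_sum_nat.congr fun J => ?_
  exact Finset.sum_congr rfl fun k _ => by rw [sq_abs, mul_pow]

theorem norm_sub_partialSum_sq (J : ℕ) (f : H1N) :
    ‖f - partialSum J f‖ ^ 2
      = ‖f‖ ^ 2 - ∑ k ∈ Finset.range J, (1 + (k : ℝ)) ^ 2 * coef (toL2 f) k ^ 2 := by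
  rw [H1N_norm_sq, H1N_norm_sq, ← (H1N_summable f).sum_add_tsum_nat_add J,
    ← (H1N_summable (f - partialSum J f)).sum_add_tsum_nat_add J]
  have h : ∀ k, coef (toL2 (f - partialSum J f)) k
      = if k ∈ Finset.range J then 0 else coef (toL2 f) k := by
    intro k
    rw [← coefH_apply, map_sub, coefH_apply, coefH_apply, partialSum, coefH_sum]
    split_ifs <;> simp
  have h1 : ∑ k ∈ Finset.range J, |(1 + (k : ℝ)) * coef (toL2 (f - partialSum J f)) k| ^ 2 = 0 :=
    Finset.sum_eq_zero fun k hk => by rw [h, if_pos hk]; simp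
  have h2 : ∑ k ∈ Finset.range J, |(1 + (k : ℝ)) * coef (toL2 f) k| ^ 2
      = ∑ k ∈ Finset.range J, (1 + (k : ℝ)) ^ 2 * coef (toL2 f) k ^ 2 :=
    Finset.sum_congr rfl fun k _ => by rw [sq_abs, mul_pow]
  rw [h1, h2, zero_add, add_sub_cancel_left]
  refine tsum_congr fun k => ?_
  rw [h, if_neg (by simp)]

theorem tendsto_partialSum (f : H1N) : Tendsto (fun J => partialSum J f) atTop (𝓝 f) := by
  rw [tendsto_iff_norm_sub_tendsto_zero]
  have h1 : Tendsto (fun J => ‖f - partialSum J f‖ ^ 2) atTop (𝓝 0) := by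
    simp_rw [norm_sub_partialSum_sq]
    have h := (tendsto_const_nhds (x := ‖f‖ ^ 2)).sub (tendsto_sum_modes f)
    rwa [sub_self] at h
  have h2 := h1.sqrt
  simp only [Real.sqrt_sq (norm_nonneg _), Real.sqrt_zero] at h2
  exact h2.congr fun J => norm_sub_rev _ _

theorem apply_partialSum (F : HNeg1N) (J : ℕ) (f : H1N) :
    F (partialSum J f) = ∑ k ∈ Finset.range J, coef (toL2 f) k * F (phiH k) := by
  simp [partialSum, map_sum]

/-- Duality: `F` is tested on the vector with modes `F(φ_k) / (1+k)²`, whose squared norm and whose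
image under `F` are both the sum to be bounded. -/
theorem sum_dual_modes_le (F : HNeg1N) (s : Finset ℕ) :
    ∑ k ∈ s, F (phiH k) ^ 2 / (1 + (k : ℝ)) ^ 2 ≤ ‖F‖ ^ 2 := by
  set S := ∑ k ∈ s, F (phiH k) ^ 2 / (1 + (k : ℝ)) ^ 2 with hS
  have hS0 : 0 ≤ S := Finset.sum_nonneg fun k _ => by positivity
  set v : H1N := ∑ k ∈ s, (F (phiH k) / (1 + (k : ℝ)) ^ 2) • phiH k with hv
  have h1 : F v = S := by
    rw [hv, map_sum]
    refine Finset.sum_congr rfl fun k _ => ?_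
    rw [map_smul, smul_eq_mul]; ring
  have h2 : ‖v‖ ^ 2 = S := by
    rw [hv, norm_sq_sum]
    refine Finset.sum_congr rfl fun k _ => ?_
    have : (1 + (k : ℝ)) ≠ 0 := by positivity
    field_simp
  have h3 : S ≤ ‖F‖ * ‖v‖ := by
    rw [← h1]; exact (le_abs_self _).trans (F.le_opNorm v)
  have h4 : S * S ≤ ‖F‖ ^ 2 * S := by
    calc S * S ≤ (‖F‖ * ‖v‖) * (‖F‖ * ‖v‖) := by gcongr
      _ = ‖F‖ ^ 2 * ‖v‖ ^ 2 := by ring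
      _ = _ := by rw [h2]
  rcases hS0.eq_or_lt with h | h
  · rw [← h]; positivity
  · exact le_of_mul_le_mul_right h4 h

theorem dirichletForm_phiH (f : H1N) (j : ℕ) :
    dirichletForm f (phiH j) = (j : ℝ) ^ 2 * coef (toL2 f) j := by
  unfold dirichletForm
  rw [tsum_eq_single j]
  · rw [coef_toL2_phiH, if_pos rfl, mul_one]
  · intro k hk
    rw [coef_toL2_phiH, if_neg hk.symm, mul_zero]

/-! ### Taylor bounds for the nonlinearity, and integral inequalities. -/

/-- Lipschitz and second-order Taylor estimates for a `C²` map with bounded derivatives. -/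
theorem exists_taylor_bounds {E F : Type*} [NormedAddCommGroup E] [NormedSpace ℝ E]
    [NormedAddCommGroup F] [NormedSpace ℝ F] {Γ : E → F} (hC2 : ContDiff ℝ 2 Γ) {C : ℝ}
    (hC : 0 < C) (hb : ∀ z, ‖fderiv ℝ Γ z‖ + ‖iteratedFDeriv ℝ 2 Γ z‖ ≤ C) :
    ∃ C : ℝ, 0 < C ∧ Continuous Γ ∧ (∀ z, ‖Γ z - Γ 0‖ ≤ C * ‖z‖) ∧
      (∀ z, ‖Γ z - Γ 0 - fderiv ℝ Γ 0 z‖ ≤ C * ‖z‖ ^ 2) ∧ ‖Γ 0‖ ≤ C ∧ ‖fderiv ℝ Γ 0‖ ≤ C := by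
  have hdiff : Differentiable ℝ Γ := hC2.differentiable (by norm_num)
  have hdiff' : Differentiable ℝ (fderiv ℝ Γ) :=
    (hC2.fderiv_right (m := 1) (by norm_num)).differentiable (by norm_num)
  have h1 : ∀ z, ‖fderiv ℝ Γ z‖ ≤ C := fun z =>
    (le_add_of_nonneg_right (norm_nonneg _)).trans (hb z)
  have h2 : ∀ z, ‖fderiv ℝ (fderiv ℝ Γ) z‖ ≤ C := by
    intro z
    have : ‖fderiv ℝ (fderiv ℝ Γ) z‖ = ‖iteratedFDeriv ℝ 2 Γ z‖ := by
      rw [← norm_iteratedFDeriv_fderiv (n := 1), ← norm_iteratedFDeriv_fderiv (n := 0),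
        norm_iteratedFDeriv_zero]
    rw [this]
    exact (le_add_of_nonneg_left (norm_nonneg _)).trans (hb z)
  have hlip : ∀ z, ‖Γ z - Γ 0‖ ≤ C * ‖z‖ := by
    intro z
    simpa using convex_univ.norm_image_sub_le_of_norm_fderiv_le (f := Γ) (C := C)
      (fun x _ => hdiff x) (fun x _ => h1 x) (mem_univ 0) (mem_univ z)
  have hlip' : ∀ z, ‖fderiv ℝ Γ z - fderiv ℝ Γ 0‖ ≤ C * ‖z‖ := by
    intro z
    simpa using convex_univ.norm_image_sub_le_of_norm_fderiv_le (f := fderiv ℝ Γ) (C := C)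
      (fun x _ => hdiff' x) (fun x _ => h2 x) (mem_univ 0) (mem_univ z)
  have htay : ∀ z, ‖Γ z - Γ 0 - fderiv ℝ Γ 0 z‖ ≤ C * ‖z‖ ^ 2 := by
    intro z
    -- Mean value inequality for `Γ - Γ'[0]` on the ball of radius `‖z‖`, where the derivative of
    -- this map is at most `C ‖z‖`.
    have h3 := (convex_closedBall (0 : E) ‖z‖).norm_image_sub_le_of_norm_hasFDerivWithin_le'
      (f := Γ) (f' := fderiv ℝ Γ) (C := C * ‖z‖) (φ := fderiv ℝ Γ 0) (x := 0) (y := z)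
      (fun x _ => (hdiff x).hasFDerivAt.hasFDerivWithinAt)
      (fun x hx => (hlip' x).trans (by
        have : ‖x‖ ≤ ‖z‖ := by simpa using hx
        gcongr)) (by simp) (by simp)
    rw [sub_zero] at h3
    calc _ ≤ C * ‖z‖ * ‖z‖ := h3
      _ = _ := by ring
  -- The constant is enlarged so that it bounds `Γ[0]` as well.
  refine ⟨C + ‖Γ 0‖, by positivity, hC2.continuous, fun z => (hlip z).trans ?_,
    fun z => (htay z).trans ?_, by linarith [norm_nonneg (Γ 0)], (h1 0).trans (by simp)⟩
  · gcongr; simp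
  · gcongr; simp

theorem IsAdmissible.exists_bounds {Γ : H1N → HNeg1N} (hΓ : IsAdmissible Γ) :
    ∃ C : ℝ, 0 < C ∧ Continuous Γ ∧ (∀ z, ‖Γ z - Γ 0‖ ≤ C * ‖z‖) ∧
      (∀ z, ‖Γ z - Γ 0 - fderiv ℝ Γ 0 z‖ ≤ C * ‖z‖ ^ 2) ∧ ‖Γ 0‖ ≤ C ∧ ‖fderiv ℝ Γ 0‖ ≤ C := by
  obtain ⟨hC2, C, hC, hb⟩ := hΓ
  exact exists_taylor_bounds hC2 hC hb

theorem intervalIntegral_eq_Ioo {T : ℝ} (hT : 0 ≤ T) (f : ℝ → ℝ) :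
    ∫ t in (0 : ℝ)..T, f t = ∫ t in Ioo 0 T, f t := by
  rw [intervalIntegral.integral_of_le hT, integral_Ioc_eq_integral_Ioo]

theorem intervalIntegrable_iff_Ioo {T : ℝ} (hT : 0 ≤ T) {f : ℝ → ℝ} :
    IntervalIntegrable f volume 0 T ↔ IntegrableOn f (Ioo 0 T) := by
  rw [intervalIntegrable_iff_integrableOn_Ioo_of_le hT]

/-- The Cauchy–Schwarz inequality for integrals. -/
theorem sq_integral_mul_le {α : Type*} [MeasurableSpace α] {μ : Measure α} {f g : α → ℝ}
    (hf : MemLp f 2 μ) (hg : MemLp g 2 μ) :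
    (∫ x, f x * g x ∂μ) ^ 2 ≤ (∫ x, f x ^ 2 ∂μ) * ∫ x, g x ^ 2 ∂μ := by
  have hff := hf.integrable_sq
  have hgg := hg.integrable_sq
  have hfg : Integrable (fun x => f x * g x) μ := hf.integrable_mul hg
  have key : ∀ s : ℝ, 0 ≤ (∫ x, g x ^ 2 ∂μ) * (s * s) + (2 * ∫ x, f x * g x ∂μ) * s
      + ∫ x, f x ^ 2 ∂μ := by
    intro s
    have h1 : 0 ≤ ∫ x, (f x + s * g x) ^ 2 ∂μ := integral_nonneg fun x => sq_nonneg _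
    have e : ∀ x, (f x + s * g x) ^ 2 = g x ^ 2 * (s * s) + (f x * g x) * (2 * s) + f x ^ 2 :=
      fun x => by ring
    simp_rw [e] at h1
    have hi : Integrable (fun x => g x ^ 2 * (s * s) + f x * g x * (2 * s)) μ :=
      (hgg.mul_const _).add (hfg.mul_const _)
    rw [integral_add hi hff, integral_add (hgg.mul_const _) (hfg.mul_const _), integral_mul_const,
      integral_mul_const] at h1
    linarith
  have h2 := discrim_le_zero key
  unfold discrim at h2
  nlinarith

theorem abs_integral_mul_le_sqrt {α : Type*} [MeasurableSpace α] {μ : Measure α} {f g : α → ℝ}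
    (hf : MemLp f 2 μ) (hg : MemLp g 2 μ) :
    |∫ x, f x * g x ∂μ| ≤ Real.sqrt (∫ x, f x ^ 2 ∂μ) * Real.sqrt (∫ x, g x ^ 2 ∂μ) := by
  rw [← Real.sqrt_mul (integral_nonneg fun x => sq_nonneg _)]
  exact Real.abs_le_sqrt (sq_integral_mul_le hf hg)

theorem sq_integral_le {T : ℝ} (hT : 0 ≤ T) {f : ℝ → ℝ}
    (hf : MemLp f 2 (volume.restrict (Ioo 0 T))) :
    (∫ t in Ioo 0 T, f t) ^ 2 ≤ T * ∫ t in Ioo 0 T, f t ^ 2 := by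
  have h := sq_integral_mul_le hf (memLp_const (μ := volume.restrict (Ioo 0 T)) (1 : ℝ))
  simp only [mul_one, one_pow] at h
  rw [integral_const] at h
  simp only [measureReal_restrict_apply_univ, Real.volume_real_Ioo_of_le hT, sub_zero, smul_eq_mul,
    mul_one] at h
  linarith

theorem memLp_two_of_continuousOn {T : ℝ} {f : ℝ → ℝ} (hf : ContinuousOn f (Icc 0 T)) :
    MemLp f 2 (volume.restrict (Ioo 0 T)) := by
  obtain ⟨C, hC⟩ := isCompact_Icc.exists_bound_of_continuousOn hf
  refine MemLp.of_bound ((hf.mono Ioo_subset_Icc_self).aestronglyMeasurable measurableSet_Ioo) C ?_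
  filter_upwards [ae_restrict_mem measurableSet_Ioo] with x hx
  exact hC x (Ioo_subset_Icc_self hx)

/-! ### Energy estimates for the modes of the heat equation. -/

/-- Integration by parts for absolutely continuous functions. Sources such as `u(t) Γ[ζ(t)]` are
only integrable in time, so the classical product rule does not apply to the modes of a weak
solution. -/
theorem integral_primitive_mul {T : ℝ} {p q : ℝ → ℝ} (hp : IntervalIntegrable p volume 0 T)
    (hq : IntervalIntegrable q volume 0 T) :
    (∫ t in (0 : ℝ)..T, p t * (∫ s in (0 : ℝ)..t, q s) + (∫ s in (0 : ℝ)..t, p s) * q t)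
      = (∫ s in (0 : ℝ)..T, p s) * ∫ s in (0 : ℝ)..T, q s := by
  have hP := hp.absolutelyContinuousOnInterval_intervalIntegral (c := 0) (by simp)
  have hQ := hq.absolutelyContinuousOnInterval_intervalIntegral (c := 0) (by simp)
  have h := hP.integral_deriv_mul_eq_sub hQ
  simp only [intervalIntegral.integral_same, mul_zero, sub_zero] at h
  rw [← h]
  refine intervalIntegral.integral_congr_ae ?_
  filter_upwards [hp.ae_hasDerivAt_integral, hq.ae_hasDerivAt_integral] with t h1 h2 ht
  have ht' := uIoc_subset_uIcc ht
  rw [(h1 ht' 0 (by simp)).deriv, (h2 ht' 0 (by simp)).deriv]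

/-- The energy identity for a primitive of an integrable function. -/
theorem energy_identity {T y₀ : ℝ} (hT : 0 ≤ T) {y p : ℝ → ℝ}
    (hp : IntegrableOn p (Ioo 0 T)) (hy : ∀ t ∈ Icc 0 T, y t = y₀ + ∫ s in (0 : ℝ)..t, p s) :
    y T ^ 2 = y₀ ^ 2 + 2 * ∫ t in Ioo 0 T, y t * p t := by
  have hp' := (intervalIntegrable_iff_Ioo hT).mpr hp
  have h1 := integral_primitive_mul hp' hp'
  have hP := hp'.absolutelyContinuousOnInterval_intervalIntegral (c := 0) (by simp)
  have hi : IntervalIntegrable (fun t => (∫ s in (0 : ℝ)..t, p s) * p t) volume 0 T :=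
    hp'.continuousOn_mul hP.continuousOn
  have h2 : ∫ t in Ioo 0 T, y t * p t
      = y₀ * (∫ s in (0 : ℝ)..T, p s) + ∫ t in (0 : ℝ)..T, (∫ s in (0 : ℝ)..t, p s) * p t := by
    rw [← intervalIntegral_eq_Ioo hT, ← intervalIntegral.integral_const_mul,
      ← intervalIntegral.integral_add (hp'.const_mul _) hi]
    refine intervalIntegral.integral_congr fun t ht => ?_
    rw [uIcc_of_le hT] at ht
    simp only [hy t ht]
    ring
  have h3 : (∫ t in (0 : ℝ)..T, p t * (∫ s in (0 : ℝ)..t, p s) + (∫ s in (0 : ℝ)..t, p s) * p t)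
      = 2 * ∫ t in (0 : ℝ)..T, (∫ s in (0 : ℝ)..t, p s) * p t := by
    rw [← intervalIntegral.integral_const_mul]
    refine intervalIntegral.integral_congr fun t _ => ?_
    ring
  rw [h2, hy T ⟨hT, le_rfl⟩]
  rw [h3] at h1
  linear_combination -h1

/-- The energy estimate for a mode of the heat equation. -/
theorem energy_estimate {T y₀ lam : ℝ} (hT : 0 ≤ T) (hlam : 0 < lam) {y F : ℝ → ℝ}
    (hyc : ContinuousOn y (Icc 0 T)) (hF : MemLp F 2 (volume.restrict (Ioo 0 T)))
    (hy : ∀ t ∈ Icc 0 T, y t = y₀ + ∫ s in (0 : ℝ)..t, (-lam * y s + F s)) :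
    y T ^ 2 + lam * ∫ t in Ioo 0 T, y t ^ 2 ≤ y₀ ^ 2 + lam⁻¹ * ∫ t in Ioo 0 T, F t ^ 2 := by
  have hy2 := memLp_two_of_continuousOn hyc
  have hp : MemLp (fun s => -lam * y s + F s) 2 (volume.restrict (Ioo 0 T)) :=
    (hy2.const_mul (-lam)).add hF
  rw [energy_identity hT (hp.integrable (by norm_num)) hy]
  have hyF : Integrable (fun t => y t * (-lam * y t + F t)) (volume.restrict (Ioo 0 T)) :=
    hy2.integrable_mul hp
  -- Young's inequality `2 y F ≤ λ y² + λ⁻¹ F²`, which spends half of the dissipation `2 λ y²`.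
  have h1 : ∫ t in Ioo 0 T, 2 * (y t * (-lam * y t + F t)) + lam * y t ^ 2
      ≤ ∫ t in Ioo 0 T, lam⁻¹ * F t ^ 2 := by
    refine integral_mono ((hyF.const_mul 2).add (hy2.integrable_sq.const_mul lam))
      (hF.integrable_sq.const_mul _) fun t => ?_
    have e : lam⁻¹ * F t ^ 2 - (2 * (y t * (-lam * y t + F t)) + lam * y t ^ 2)
        = lam⁻¹ * (F t - lam * y t) ^ 2 := by
      field_simp
      ring
    have : 0 ≤ lam⁻¹ * (F t - lam * y t) ^ 2 := by positivity
    simp only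
    linarith
  rw [integral_add (hyF.const_mul 2) (hy2.integrable_sq.const_mul lam), integral_const_mul,
    integral_const_mul, integral_const_mul] at h1
  linarith

theorem sq_integral_Icc_le {T t : ℝ} (ht : t ∈ Icc 0 T) {F : ℝ → ℝ}
    (hF : MemLp F 2 (volume.restrict (Ioo 0 T))) :
    (∫ s in (0 : ℝ)..t, F s) ^ 2 ≤ T * ∫ s in Ioo 0 T, F s ^ 2 := by
  have hsub : Ioo 0 t ⊆ Ioo 0 T := Ioo_subset_Ioo_right ht.2
  rw [intervalIntegral_eq_Ioo ht.1]
  refine (sq_integral_le ht.1 (hF.mono_measure (Measure.restrict_mono hsub le_rfl))).trans ?_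
  refine mul_le_mul ht.2 ?_ (integral_nonneg fun x => sq_nonneg _) (ht.1.trans ht.2)
  exact setIntegral_mono_set hF.integrable_sq (ae_of_all _ fun x => sq_nonneg _)
    hsub.eventuallyLE

/-- The estimate for the zero mode of the heat equation. -/
theorem zero_mode_estimate {T y₀ : ℝ} (hT : 0 ≤ T) {y F : ℝ → ℝ}
    (hyc : ContinuousOn y (Icc 0 T)) (hF : MemLp F 2 (volume.restrict (Ioo 0 T)))
    (hy : ∀ t ∈ Icc 0 T, y t = y₀ + ∫ s in (0 : ℝ)..t, F s) :
    ∫ t in Ioo 0 T, y t ^ 2 ≤ T * (2 * y₀ ^ 2 + 2 * (T * ∫ t in Ioo 0 T, F t ^ 2)) := by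
  have h1 : ∫ t in Ioo 0 T, y t ^ 2
      ≤ ∫ _ in Ioo 0 T, (2 * y₀ ^ 2 + 2 * (T * ∫ t in Ioo 0 T, F t ^ 2)) := by
    refine setIntegral_mono_on (memLp_two_of_continuousOn hyc).integrable_sq
      (integrable_const _) measurableSet_Ioo fun t ht => ?_
    have ht' := Ioo_subset_Icc_self ht
    rw [hy t ht']
    have h2 := sq_integral_Icc_le ht' hF
    nlinarith [sq_nonneg (y₀ - ∫ s in (0 : ℝ)..t, F s)]
  rw [integral_const] at h1
  simpa only [measureReal_restrict_apply_univ, Real.volume_real_Ioo_of_le hT, sub_zero,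
    smul_eq_mul] using h1

/-- The solution `t ↦ ∫₀ᵗ e^{-λ(t-s)} f(s) ds` of `y' = -λ y + f`, `y(0) = 0`. -/
noncomputable def linResp (lam : ℝ) (f : ℝ → ℝ) (t : ℝ) : ℝ :=
  Real.exp (-lam * t) * ∫ s in (0 : ℝ)..t, Real.exp (lam * s) * f s

theorem hasDerivAt_linResp (lam : ℝ) {f : ℝ → ℝ} (hf : Continuous f) (t : ℝ) :
    HasDerivAt (linResp lam f) (-lam * linResp lam f t + f t) t := by
  have hc : Continuous fun s => Real.exp (lam * s) * f s := by fun_prop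
  have h1 : HasDerivAt (fun t => ∫ s in (0 : ℝ)..t, Real.exp (lam * s) * f s)
      (Real.exp (lam * t) * f t) t := hc.integral_hasStrictDerivAt 0 t |>.hasDerivAt
  have h2 : HasDerivAt (fun t : ℝ => Real.exp (-lam * t)) (Real.exp (-lam * t) * (-lam * 1)) t :=
    ((hasDerivAt_id t).const_mul (-lam)).exp
  refine (h2.mul h1).congr_deriv ?_
  have e : Real.exp (-lam * t) * Real.exp (lam * t) = 1 := by
    rw [← Real.exp_add]; simp
  unfold linResp
  linear_combination f t * e

theorem linResp_zero (lam : ℝ) (f : ℝ → ℝ) : linResp lam f 0 = 0 := by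
  simp [linResp]

theorem continuous_linResp (lam : ℝ) {f : ℝ → ℝ} (hf : Continuous f) :
    Continuous (linResp lam f) :=
  continuous_iff_continuousAt.mpr fun t => (hasDerivAt_linResp lam hf t).continuousAt

theorem linResp_eq_integral (lam : ℝ) {f : ℝ → ℝ} (hf : Continuous f) (t : ℝ) :
    linResp lam f t = ∫ s in (0 : ℝ)..t, (-lam * linResp lam f s + f s) := by
  have hc := continuous_linResp lam hf
  have := intervalIntegral.integral_eq_sub_of_hasDerivAt (a := 0) (b := t)
    (fun s _ => hasDerivAt_linResp lam hf s)
    (Continuous.intervalIntegrable (by fun_prop) _ _)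
  rw [this, linResp_zero, sub_zero]

theorem norm_phiH_zero : ‖phiH 0‖ = 1 := by
  have h := norm_sq_sum (fun _ => 1) {0}
  simp only [Finset.sum_singleton, one_smul, Nat.cast_zero, add_zero, one_pow, mul_one] at h
  exact (pow_eq_one_iff_of_nonneg (norm_nonneg _) (by norm_num)).mp h

theorem memLp_apply {T : ℝ} {H : ℝ → HNeg1N} (hH : MemLp H 2 (volume.restrict (Ioo 0 T)))
    (v : H1N) : MemLp (fun s => H s v) 2 (volume.restrict (Ioo 0 T)) := by
  refine (hH.norm.const_mul ‖v‖).mono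
    ((ContinuousLinearMap.apply ℝ ℝ v).continuous.comp_aestronglyMeasurable hH.1) ?_
  refine ae_of_all _ fun s => ?_
  rw [norm_mul, norm_norm, norm_norm, mul_comm]
  exact (H s).le_opNorm v

theorem sq_apply_phiH_le (F : HNeg1N) (j : ℕ) :
    F (phiH j) ^ 2 ≤ (1 + (j : ℝ)) ^ 2 * ‖F‖ ^ 2 := by
  have h := sum_dual_modes_le F {j}
  rw [Finset.sum_singleton, div_le_iff₀ (by positivity)] at h
  linarith

/-- The energy estimate for finitely many modes of a solution of the heat equation with a source
term in `L²((0,T); H⁻¹_N)`. -/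
theorem modes_estimate {T d : ℝ} (hT : 0 ≤ T) (hT1 : T ≤ 1) {H : ℝ → HNeg1N}
    (hH : MemLp H 2 (volume.restrict (Ioo 0 T))) {y : ℕ → ℝ → ℝ}
    (hyc : ∀ j, ContinuousOn (y j) (Icc 0 T))
    (hy : ∀ j, ∀ t ∈ Icc 0 T, y j t = (if j = 0 then d else 0)
      + ∫ s in (0 : ℝ)..t, (-(j : ℝ) ^ 2 * y j s + H s (phiH j))) :
    (∀ J, ∑ j ∈ Finset.range J, (1 + (j : ℝ)) ^ 2 * ∫ t in Ioo 0 T, y j t ^ 2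
      ≤ 2 * d ^ 2 + 16 * ∫ t in Ioo 0 T, ‖H t‖ ^ 2) ∧
    ∀ j, 1 ≤ j → y j T ^ 2 ≤ 4 * ∫ t in Ioo 0 T, ‖H t‖ ^ 2 := by
  have hF : ∀ j, MemLp (fun s => H s (phiH j)) 2 (volume.restrict (Ioo 0 T)) :=
    fun j => memLp_apply hH _
  set I : ℕ → ℝ := fun j => ∫ t in Ioo 0 T, H t (phiH j) ^ 2 with hI
  have hI0 : ∀ j, 0 ≤ I j := fun j => integral_nonneg fun t => sq_nonneg _
  have hpos : ∀ j : ℕ, 1 ≤ j → y j T ^ 2 + (j : ℝ) ^ 2 * ∫ t in Ioo 0 T, y j t ^ 2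
      ≤ ((j : ℝ) ^ 2)⁻¹ * I j := by
    intro j hj
    have hj' : (0 : ℝ) < j := by exact_mod_cast hj
    have h := energy_estimate (y₀ := 0) hT (by positivity : (0 : ℝ) < (j : ℝ) ^ 2) (hyc j) (hF j)
      (fun t ht => by rw [hy j t ht, if_neg (by omega)])
    simpa using h
  -- The inequality `1 + j ≤ 2 j` is used once for the weight of `H¹_N` and once for that of its
  -- dual, which produces the constant `16 = 4 · 4`.
  have hinv : ∀ j : ℕ, 1 ≤ j → ((j : ℝ) ^ 2)⁻¹ ≤ 4 / (1 + (j : ℝ)) ^ 2 := by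
    intro j hj
    have hj' : (1 : ℝ) ≤ j := by exact_mod_cast hj
    rw [inv_eq_one_div, div_le_div_iff₀ (by positivity) (by positivity)]
    nlinarith
  constructor
  · intro J
    have hmode : ∀ j : ℕ, (1 + (j : ℝ)) ^ 2 * ∫ t in Ioo 0 T, y j t ^ 2
        ≤ (if j = 0 then 2 * d ^ 2 else 0) + 16 * (I j / (1 + (j : ℝ)) ^ 2) := by
      intro j
      have hY0 : 0 ≤ ∫ t in Ioo 0 T, y j t ^ 2 := integral_nonneg fun t => sq_nonneg _
      rcases Nat.eq_zero_or_pos j with rfl | hj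
      -- The mode zero is not damped; the bound `T ≤ 1` takes the place of the dissipation.
      · have h := zero_mode_estimate (y₀ := d) hT (hyc 0) (hF 0)
          (fun t ht => by rw [hy 0 t ht]; simp)
        change _ ≤ T * (2 * d ^ 2 + 2 * (T * I 0)) at h
        have h1 : T * I 0 ≤ I 0 := mul_le_of_le_one_left (hI0 0) hT1
        have h2 : T * (2 * d ^ 2 + 2 * (T * I 0)) ≤ 2 * d ^ 2 + 2 * (T * I 0) :=
          mul_le_of_le_one_left (by have := hI0 0; positivity) hT1
        simp only [Nat.cast_zero, add_zero, one_pow, one_mul, div_one, if_true]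
        linarith [hI0 0]
      · have h := hpos j hj
        have hj' : (1 : ℝ) ≤ j := by exact_mod_cast hj
        rw [if_neg (by omega), zero_add]
        have h1 : (1 + (j : ℝ)) ^ 2 ≤ 4 * (j : ℝ) ^ 2 := by nlinarith
        calc (1 + (j : ℝ)) ^ 2 * ∫ t in Ioo 0 T, y j t ^ 2
            ≤ 4 * (j : ℝ) ^ 2 * ∫ t in Ioo 0 T, y j t ^ 2 := by gcongr
          _ ≤ 4 * (((j : ℝ) ^ 2)⁻¹ * I j) := by nlinarith [sq_nonneg (y j T)]
          _ ≤ 4 * (4 / (1 + (j : ℝ)) ^ 2 * I j) := by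
            gcongr
            · exact hinv j hj
          _ = _ := by ring
    refine (Finset.sum_le_sum fun j _ => hmode j).trans ?_
    rw [Finset.sum_add_distrib, ← Finset.mul_sum]
    refine add_le_add ?_ ?_
    · rw [Finset.sum_ite_eq']
      split_ifs
      · exact le_rfl
      · positivity
    · gcongr
      have h1 : ∑ j ∈ Finset.range J, I j / (1 + (j : ℝ)) ^ 2
          = ∫ t in Ioo 0 T, ∑ j ∈ Finset.range J, H t (phiH j) ^ 2 / (1 + (j : ℝ)) ^ 2 := by
        rw [integral_finsetSum _ fun j _ => (hF j).integrable_sq.div_const _]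
        exact Finset.sum_congr rfl fun j _ => (integral_div _ _).symm
      rw [h1]
      exact integral_mono (integrable_finsetSum _ fun j _ => (hF j).integrable_sq.div_const _)
        hH.norm.integrable_sq fun t => sum_dual_modes_le (H t) _
  · intro j hj
    have h := hpos j hj
    have hY0 : 0 ≤ ∫ t in Ioo 0 T, y j t ^ 2 := integral_nonneg fun t => sq_nonneg _
    have h1 : I j ≤ (1 + (j : ℝ)) ^ 2 * ∫ t in Ioo 0 T, ‖H t‖ ^ 2 := by
      rw [← integral_const_mul]
      exact integral_mono (hF j).integrable_sq (hH.norm.integrable_sq.const_mul _)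
        fun t => sq_apply_phiH_le (H t) j
    calc y j T ^ 2 ≤ ((j : ℝ) ^ 2)⁻¹ * I j := by nlinarith [sq_nonneg (j : ℝ)]
      _ ≤ 4 / (1 + (j : ℝ)) ^ 2 * ((1 + (j : ℝ)) ^ 2 * ∫ t in Ioo 0 T, ‖H t‖ ^ 2) := by
        exact mul_le_mul (hinv j hj) h1 (hI0 j) (by positivity)
      _ = _ := by
        have : (1 + (j : ℝ)) ≠ 0 := by positivity
        field_simp

/-! ### From the modes back to the solution. -/

/-- Transfers bounds that are uniform in the number of modes to the norm of `L²((0,T); H¹_N)`. -/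
theorem tendsto_integral_sum_modes {T : ℝ} {ζ : ℝ → H1N}
    (hζ : MemLp ζ 2 (volume.restrict (Ioo 0 T))) :
    Tendsto (fun J => ∑ j ∈ Finset.range J,
      (1 + (j : ℝ)) ^ 2 * ∫ t in Ioo 0 T, coef (toL2 (ζ t)) j ^ 2) atTop
      (𝓝 (∫ t in Ioo 0 T, ‖ζ t‖ ^ 2)) := by
  have hm : ∀ j, MemLp (fun t => coef (toL2 (ζ t)) j) 2 (volume.restrict (Ioo 0 T)) := by
    intro j
    refine hζ.norm.mono ((coefH j).continuous.comp_aestronglyMeasurable hζ.1)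
      (ae_of_all _ fun t => ?_)
    rw [norm_norm]
    exact abs_coef_le_norm (ζ t) j
  have h : Tendsto (fun J => ∫ t in Ioo 0 T, ∑ j ∈ Finset.range J,
      (1 + (j : ℝ)) ^ 2 * coef (toL2 (ζ t)) j ^ 2) atTop (𝓝 (∫ t in Ioo 0 T, ‖ζ t‖ ^ 2)) := by
    refine tendsto_integral_of_dominated_convergence (fun t => ‖ζ t‖ ^ 2) (fun J => ?_)
      hζ.norm.integrable_sq (fun J => ae_of_all _ fun t => ?_)
      (ae_of_all _ fun t => tendsto_sum_modes (ζ t))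
    · exact (integrable_finsetSum _ fun j _ => (hm j).integrable_sq.const_mul _).1
    · rw [Real.norm_of_nonneg (Finset.sum_nonneg fun j _ => by positivity)]
      exact sum_modes_le_norm_sq (ζ t) _
  refine h.congr fun J => ?_
  rw [integral_finsetSum _ fun j _ => (hm j).integrable_sq.const_mul _]
  exact Finset.sum_congr rfl fun j _ => integral_const_mul _ _

/-- Allows a functional such as `⟨Γ'[0] ·, φ_0⟩` to be expanded in modes under the time integral.
Truncation does not increase the norm of `H¹_N`, so `|u| ‖L‖ ‖ζ‖` dominates. -/
theorem tendsto_integral_partialSum {T : ℝ} {ζ : ℝ → H1N}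
    (hζ : MemLp ζ 2 (volume.restrict (Ioo 0 T))) {u : ℝ → ℝ} (hu : Continuous u) (L : HNeg1N) :
    Tendsto (fun J => ∑ j ∈ Finset.range J,
      L (phiH j) * ∫ t in Ioo 0 T, u t * coef (toL2 (ζ t)) j) atTop
      (𝓝 (∫ t in Ioo 0 T, u t * L (ζ t))) := by
  have hu2 : MemLp u 2 (volume.restrict (Ioo 0 T)) := memLp_two_of_continuousOn hu.continuousOn
  have hm : ∀ j, MemLp (fun t => coef (toL2 (ζ t)) j) 2 (volume.restrict (Ioo 0 T)) := by
    intro j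
    refine hζ.norm.mono ((coefH j).continuous.comp_aestronglyMeasurable hζ.1)
      (ae_of_all _ fun t => ?_)
    rw [norm_norm]
    exact abs_coef_le_norm (ζ t) j
  have hi : ∀ j, Integrable (fun t => u t * coef (toL2 (ζ t)) j) (volume.restrict (Ioo 0 T)) :=
    fun j => hu2.integrable_mul (hm j)
  have h : Tendsto (fun J => ∫ t in Ioo 0 T, ∑ j ∈ Finset.range J,
      L (phiH j) * (u t * coef (toL2 (ζ t)) j)) atTop (𝓝 (∫ t in Ioo 0 T, u t * L (ζ t))) := by
    refine tendsto_integral_of_dominated_convergence (fun t => |u t| * (‖L‖ * ‖ζ t‖))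
      (fun J => ?_) (hu2.abs.integrable_mul (hζ.norm.const_mul _))
      (fun J => ae_of_all _ fun t => ?_) (ae_of_all _ fun t => ?_)
    · exact (integrable_finsetSum _ fun j _ => (hi j).const_mul _).1
    · have e : ∑ j ∈ Finset.range J, L (phiH j) * (u t * coef (toL2 (ζ t)) j)
          = u t * L (partialSum J (ζ t)) := by
        rw [apply_partialSum, Finset.mul_sum]
        exact Finset.sum_congr rfl fun j _ => by ring
      rw [e, norm_mul]
      refine mul_le_mul_of_nonneg_left ((L.le_opNorm _).trans ?_) (norm_nonneg _)
      gcongr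
      exact norm_partialSum_le J _
    · refine (((L.continuous.tendsto _).comp (tendsto_partialSum (ζ t))).const_mul (u t)).congr
        fun J => ?_
      rw [Function.comp_apply, apply_partialSum, Finset.mul_sum]
      exact Finset.sum_congr rfl fun j _ => by ring
  refine h.congr fun J => ?_
  rw [integral_finsetSum _ fun j _ => (hi j).const_mul _]
  exact Finset.sum_congr rfl fun j _ => integral_const_mul _ _

theorem continuous_coef (j : ℕ) : Continuous fun f : L2 => coef f j := by
  unfold coef
  fun_prop

/-- The weak formulation tested with `φ_j`, on which the Dirichlet form reduces to `j²` times the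
mode. Under the integral, `ζ` is replaced by the continuous `z` in the linear term. -/
theorem mode_equation {Γ : H1N → HNeg1N} {T : ℝ} {u : ℝ → ℝ} (hu : Continuous u) {z₀ : L2}
    {z : ℝ → L2} {ζ : ℝ → H1N} (hzc : ContinuousOn z (Icc 0 T))
    (hG : MemLp (fun s => Γ (ζ s)) 2 (volume.restrict (Ioo 0 T)))
    (hae : ∀ᵐ t ∂((volume : Measure ℝ).restrict (Ioo 0 T)), toL2 (ζ t) = z t)
    (hsol : ∀ t ∈ Icc 0 T, ∀ v : H1N,
      inner ℝ (z t) (toL2 v) + ∫ s in (0 : ℝ)..t, dirichletForm (ζ s) v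
        = inner ℝ z₀ (toL2 v) + ∫ s in (0 : ℝ)..t, u s * Γ (ζ s) v) (j : ℕ) {t : ℝ}
    (ht : t ∈ Icc 0 T) :
    coef (z t) j = coef z₀ j
      + ∫ s in (0 : ℝ)..t, (-(j : ℝ) ^ 2 * coef (z s) j + u s * Γ (ζ s) (phiH j)) := by
  have hT : 0 ≤ T := ht.1.trans ht.2
  have hsub : Ioo 0 t ⊆ Ioo 0 T := Ioo_subset_Ioo_right ht.2
  have h := hsol t ht (phiH j)
  change coef (z t) j + _ = coef z₀ j + _ at h
  have h1 : ∫ s in (0 : ℝ)..t, dirichletForm (ζ s) (phiH j)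
      = ∫ s in (0 : ℝ)..t, (j : ℝ) ^ 2 * coef (z s) j := by
    rw [intervalIntegral_eq_Ioo ht.1, intervalIntegral_eq_Ioo ht.1]
    refine integral_congr_ae ?_
    filter_upwards [ae_restrict_of_ae_restrict_of_subset hsub hae] with s hs
    rw [dirichletForm_phiH, hs]
  have hc : ContinuousOn (fun s => coef (z s) j) (Icc 0 T) :=
    (continuous_coef j).comp_continuousOn hzc
  have hi1 : IntervalIntegrable (fun s => -(j : ℝ) ^ 2 * coef (z s) j) volume 0 t := by
    rw [intervalIntegrable_iff_Ioo ht.1]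
    exact IntegrableOn.mono_set
      (((memLp_two_of_continuousOn hc).integrable (by norm_num)).const_mul _) hsub
  have hi2 : IntervalIntegrable (fun s => u s * Γ (ζ s) (phiH j)) volume 0 t := by
    rw [intervalIntegrable_iff_Ioo ht.1]
    exact IntegrableOn.mono_set ((memLp_two_of_continuousOn hu.continuousOn).integrable_mul
      (memLp_apply hG (phiH j))) hsub
  rw [intervalIntegral.integral_add hi1 hi2, intervalIntegral.integral_const_mul]
  rw [h1, intervalIntegral.integral_const_mul] at h
  linarith

theorem memLp_smul_of_bound {T M : ℝ}
    {u : ℝ → ℝ} (hu : Continuous u) (hM : ∀ t ∈ Icc 0 T, |u t| ≤ M) {G : ℝ → HNeg1N}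
    (hG : MemLp G 2 (volume.restrict (Ioo 0 T))) :
    MemLp (fun t => u t • G t) 2 (volume.restrict (Ioo 0 T)) := by
  refine (hG.norm.const_mul M).mono (hu.aestronglyMeasurable.smul hG.1) ?_
  filter_upwards [ae_restrict_mem measurableSet_Ioo] with t ht
  rw [norm_smul, norm_mul, norm_norm]
  gcongr
  exact (hM t (Ioo_subset_Icc_self ht)).trans (le_abs_self M)

theorem memLp_comp_of_norm_sub_le {E F : Type*} [NormedAddCommGroup E] [NormedAddCommGroup F]
    {Γ : E → F} {C T : ℝ} (hΓ : Continuous Γ) (hC : 0 ≤ C) (hlip : ∀ z, ‖Γ z - Γ 0‖ ≤ C * ‖z‖)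
    {ζ : ℝ → E} (hζ : MemLp ζ 2 (volume.restrict (Ioo 0 T))) :
    MemLp (fun s => Γ (ζ s) - Γ 0) 2 (volume.restrict (Ioo 0 T)) ∧
    MemLp (fun s => Γ (ζ s)) 2 (volume.restrict (Ioo 0 T)) := by
  have hdiff : MemLp (fun s => Γ (ζ s) - Γ 0) 2 (volume.restrict (Ioo 0 T)) := by
    refine (hζ.norm.const_mul C).mono
      ((hΓ.comp_aestronglyMeasurable hζ.1).sub aestronglyMeasurable_const)
      (ae_of_all _ fun t => ?_)
    rw [norm_mul, norm_norm, Real.norm_of_nonneg hC]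
    exact hlip (ζ t)
  refine ⟨hdiff, (hdiff.add (memLp_const (Γ 0))).ae_eq (ae_of_all _ fun t => ?_)⟩
  exact sub_add_cancel (Γ (ζ t)) (Γ 0)

/-! ### Comparison of a solution with the linearised system. -/

set_option maxHeartbeats 800000 in
/-- Size of a solution, and of its difference to the solution of the linearised system, for
controls that are small in the sup norm. -/
theorem solution_estimates {Γ : H1N → HNeg1N} (hΓ : IsAdmissible Γ) (hlost : Γ 0 (phiH 0) = 0) :
    ∃ K : ℝ, 0 < K ∧ ∀ T M : ℝ, 0 ≤ T → T ≤ 1 → 0 ≤ M → K * M ≤ 1 → ∀ u : ℝ → ℝ, Continuous u →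
      (∀ t ∈ Icc 0 T, |u t| ≤ M) → ∀ δ ∈ Icc (-1 : ℝ) 1, ∀ z : ℝ → L2,
      IsSolution Γ T u (δ • phi 0) z →
      (∀ j : ℕ, 1 ≤ j → |coef (z T) j - Γ 0 (phiH j) * linResp ((j : ℝ) ^ 2) u T|
        ≤ K * M * (|δ| + Real.sqrt (∫ t in Ioo 0 T, u t ^ 2))) ∧
      ∀ S : ℝ, Tendsto (fun J => ∑ j ∈ Finset.range J,
          quadCoef Γ j * ∫ t in Ioo 0 T, u t * linResp ((j : ℝ) ^ 2) u t) atTop (𝓝 S) →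
        |coef (z T) 0 - δ - S| ≤ K * M * (|δ| + ∫ t in Ioo 0 T, u t ^ 2) := by
  obtain ⟨C, hC, hΓc, hlip, htay, hC0, hC1⟩ := hΓ.exists_bounds
  -- The part `8 C` turns `K M ≤ 1` into `C M ≤ 1/8`, which closes the a priori estimate; the other
  -- part dominates the polynomials in `C` that collect at the end.
  refine ⟨8 * C + 300 * (C + C ^ 2 + C ^ 3 + C ^ 4), by positivity, ?_⟩
  intro T M hT hT1 hM hKM u hu huM δ hδ z hz
  have hCM : C * M ≤ 1 / 8 := by
    have : 0 ≤ 300 * (C + C ^ 2 + C ^ 3 + C ^ 4) * M := by positivity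
    nlinarith
  obtain ⟨hzc, hz0, ζ, hζ, hae, hsol⟩ := hz
  have hu2 : MemLp u 2 (volume.restrict (Ioo 0 T)) := memLp_two_of_continuousOn hu.continuousOn
  set N : ℝ := ∫ t in Ioo 0 T, u t ^ 2 with hN
  have hN0 : 0 ≤ N := integral_nonneg fun t => sq_nonneg _
  set X : ℝ := ∫ t in Ioo 0 T, ‖ζ t‖ ^ 2 with hX
  have hX0 : 0 ≤ X := integral_nonneg fun t => sq_nonneg _
  obtain ⟨hdiff, hG⟩ := memLp_comp_of_norm_sub_le (E := H1N) (F := HNeg1N) hΓc hC.le hlip hζ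
  have huG := memLp_smul_of_bound hu huM hG
  have huD := memLp_smul_of_bound hu huM hdiff
  have hmode := fun j t (ht : t ∈ Icc 0 T) => mode_equation hu hzc hG hae hsol j ht
  have hcoef0 : ∀ j, coef (δ • phi 0) j = if j = 0 then δ else 0 := by
    intro j
    rw [coef_smul, coef_phi]
    by_cases h : j = 0
    · simp [h]
    · simp [h, Ne.symm h]
  have hzc' : ∀ j, ContinuousOn (fun s => coef (z s) j) (Icc 0 T) := fun j =>
    (continuous_coef j).comp_continuousOn hzc
  have hzζ : ∀ j (w : ℝ → ℝ → ℝ), ∫ t in Ioo 0 T, w t (coef (z t) j)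
      = ∫ t in Ioo 0 T, w t (coef (toL2 (ζ t)) j) := by
    intro j w
    refine integral_congr_ae ?_
    filter_upwards [hae] with t ht
    rw [ht]
  -- the a priori bound
  have hXbound : X ≤ 4 * δ ^ 2 + 64 * C ^ 2 * N := by
    have h1 := (modes_estimate (d := δ) hT hT1 huG hzc' (fun j t ht => by
      rw [hmode j t ht, hcoef0]; rfl)).1
    have h2 : X ≤ 2 * δ ^ 2 + 16 * ∫ t in Ioo 0 T, ‖u t • Γ (ζ t)‖ ^ 2 := by
      refine le_of_tendsto' (tendsto_integral_sum_modes hζ) fun J => ?_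
      refine le_trans (le_of_eq ?_) (h1 J)
      exact Finset.sum_congr rfl fun j _ => by rw [← hzζ j fun _ x => x ^ 2]
    have h3 : ∫ t in Ioo 0 T, ‖u t • Γ (ζ t)‖ ^ 2
        ≤ ∫ t in Ioo 0 T, (2 * C ^ 2 * u t ^ 2 + 2 * (C * M) ^ 2 * ‖ζ t‖ ^ 2) := by
      refine setIntegral_mono_on huG.norm.integrable_sq
        ((hu2.integrable_sq.const_mul _).add (hζ.norm.integrable_sq.const_mul _))
        measurableSet_Ioo fun t ht => ?_
      have hut := huM t (Ioo_subset_Icc_self ht)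
      have h4 : ‖Γ (ζ t)‖ ≤ C + C * ‖ζ t‖ := by
        have := norm_add_le (Γ (ζ t) - Γ 0) (Γ 0)
        rw [sub_add_cancel] at this
        linarith [hlip (ζ t)]
      rw [norm_smul, Real.norm_eq_abs]
      calc (|u t| * ‖Γ (ζ t)‖) ^ 2 ≤ (|u t| * (C + C * ‖ζ t‖)) ^ 2 := by gcongr
        _ = (C * |u t| + C * |u t| * ‖ζ t‖) ^ 2 := by ring
        _ ≤ 2 * (C * |u t|) ^ 2 + 2 * (C * |u t| * ‖ζ t‖) ^ 2 := by
          nlinarith [sq_nonneg (C * |u t| - C * |u t| * ‖ζ t‖)]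
        _ ≤ 2 * (C * |u t|) ^ 2 + 2 * (C * M * ‖ζ t‖) ^ 2 := by gcongr
        _ = _ := by rw [mul_pow C, sq_abs]; ring
    rw [integral_add (hu2.integrable_sq.const_mul _) (hζ.norm.integrable_sq.const_mul _),
      integral_const_mul, integral_const_mul] at h3
    -- The estimate is circular, as `X` also occurs on the right, with coefficient `32 (C M)² ≤
    -- 1/2`; this half is absorbed on the left.
    have h5 : (C * M) ^ 2 * X ≤ (1 / 8) ^ 2 * X := by gcongr
    rw [← hN, ← hX] at h3
    nlinarith
  -- The modes of `z` minus the linearised solution. They start from zero and solve the heat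
  -- equation with source `u (Γ[ζ] - Γ[0])`, of norm at most `C M ‖ζ‖`; the constant `δ` in the mode
  -- zero does not enter the equation, since its eigenvalue is `0`.
  set r : ℕ → ℝ → ℝ := fun j t => coef (z t) j - (if j = 0 then δ else 0)
    - Γ 0 (phiH j) * linResp ((j : ℝ) ^ 2) u t with hr
  have hrc : ∀ j, ContinuousOn (r j) (Icc 0 T) := fun j =>
    ((hzc' j).sub continuousOn_const).sub
      (continuousOn_const.mul (continuous_linResp _ hu).continuousOn)
  have hYbound : ∫ t in Ioo 0 T, ‖u t • (Γ (ζ t) - Γ 0)‖ ^ 2 ≤ (C * M) ^ 2 * X := by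
    rw [hX, ← integral_const_mul]
    refine setIntegral_mono_on huD.norm.integrable_sq (hζ.norm.integrable_sq.const_mul _)
      measurableSet_Ioo fun t ht => ?_
    have hut := huM t (Ioo_subset_Icc_self ht)
    rw [norm_smul, Real.norm_eq_abs]
    calc (|u t| * ‖Γ (ζ t) - Γ 0‖) ^ 2 ≤ (M * (C * ‖ζ t‖)) ^ 2 := by
          gcongr
          exact hlip _
      _ = _ := by ring
  obtain ⟨hr1, hr2⟩ := modes_estimate (d := 0) (y := r) hT hT1 huD hrc (by
    intro j t ht
    have hsub : Ioo 0 t ⊆ Ioo 0 T := Ioo_subset_Ioo_right ht.2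
    have hi : ∀ f : ℝ → ℝ, MemLp f 2 (volume.restrict (Ioo 0 T)) →
        IntervalIntegrable f volume 0 t := fun f hf => by
      rw [intervalIntegrable_iff_Ioo ht.1]
      exact IntegrableOn.mono_set (hf.integrable (by norm_num)) hsub
    have hi1 : IntervalIntegrable
        (fun s => -(j : ℝ) ^ 2 * coef (z s) j + (u s • Γ (ζ s)) (phiH j)) volume 0 t :=
      hi _ (((memLp_two_of_continuousOn (hzc' j)).const_mul (-(j : ℝ) ^ 2)).add
      (memLp_apply huG (phiH j)))
    have hlc := continuous_linResp ((j : ℝ) ^ 2) hu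
    have hi2 : IntervalIntegrable (fun s => Γ 0 (phiH j)
        * (-(j : ℝ) ^ 2 * linResp ((j : ℝ) ^ 2) u s + u s)) volume 0 t :=
      Continuous.intervalIntegrable (by fun_prop) _ _
    have h1 := hmode j t ht
    have h2 := linResp_eq_integral ((j : ℝ) ^ 2) hu t
    have h3 : ∫ s in (0 : ℝ)..t, (-(j : ℝ) ^ 2 * r j s + (u s • (Γ (ζ s) - Γ 0)) (phiH j))
        = (∫ s in (0 : ℝ)..t, (-(j : ℝ) ^ 2 * coef (z s) j + (u s • Γ (ζ s)) (phiH j)))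
          - ∫ s in (0 : ℝ)..t, Γ 0 (phiH j)
            * (-(j : ℝ) ^ 2 * linResp ((j : ℝ) ^ 2) u s + u s) := by
      rw [← intervalIntegral.integral_sub hi1 hi2]
      refine intervalIntegral.integral_congr fun s _ => ?_
      have h4 : (j : ℝ) ^ 2 * (if j = 0 then δ else 0) = 0 := by
        by_cases h : j = 0 <;> simp [h]
      have h5 : ∀ F : HNeg1N, (u s • F) (phiH j) = u s * F (phiH j) := fun F => rfl
      have h6 : (Γ (ζ s) - Γ 0) (phiH j) = Γ (ζ s) (phiH j) - Γ 0 (phiH j) := rfl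
      simp only [hr, h5, h6]
      linear_combination h4
    rw [h3, intervalIntegral.integral_const_mul, ← h2]
    simp only [hr]
    rw [h1, hcoef0]
    simp only [smul_apply, smul_eq_mul, ite_self]
    ring)
  have hδ1 : |δ| ≤ 1 := abs_le.mpr hδ
  have hδ2 : δ ^ 2 ≤ |δ| := by
    rw [← sq_abs]
    nlinarith [abs_nonneg δ]
  have hsqX : Real.sqrt X ≤ 2 * |δ| + 8 * C * Real.sqrt N := by
    refine Real.sqrt_le_iff.mpr ⟨by positivity, hXbound.trans ?_⟩
    have h1 : 0 ≤ |δ| * (C * Real.sqrt N) := by positivity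
    have h2 := Real.sq_sqrt hN0
    have h3 := sq_abs δ
    calc 4 * δ ^ 2 + 64 * C ^ 2 * N = 4 * |δ| ^ 2 + 64 * C ^ 2 * Real.sqrt N ^ 2 := by rw [h2, h3]
      _ ≤ _ := by nlinarith
  constructor
  · intro j hj
    have h1 : r j T ^ 2 ≤ (2 * (C * M) * Real.sqrt X) ^ 2 := by
      calc r j T ^ 2 ≤ 4 * ((C * M) ^ 2 * X) := by linarith [hr2 j hj]
        _ = 4 * ((C * M) ^ 2 * Real.sqrt X ^ 2) := by rw [Real.sq_sqrt hX0]
        _ = _ := by ring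
    have h2 := abs_le_of_sq_le_sq h1 (by positivity)
    have h3 : r j T = coef (z T) j - Γ 0 (phiH j) * linResp ((j : ℝ) ^ 2) u T := by
      simp only [hr]
      rw [if_neg (by omega), sub_zero]
    rw [← h3]
    calc |r j T| ≤ 2 * (C * M) * Real.sqrt X := h2
      _ ≤ 2 * (C * M) * (2 * |δ| + 8 * C * Real.sqrt N) := by gcongr
      _ = M * (4 * C * |δ| + 16 * C ^ 2 * Real.sqrt N) := by ring
      _ ≤ M * ((8 * C + 300 * (C + C ^ 2 + C ^ 3 + C ^ 4)) * |δ|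
          + (8 * C + 300 * (C + C ^ 2 + C ^ 3 + C ^ 4)) * Real.sqrt N) := by
        have := pow_pos hC 2
        have := pow_pos hC 3
        have := pow_pos hC 4
        gcongr <;> linarith
      _ = _ := by ring
  · intro S hS
    set L : HNeg1N := (fderiv ℝ Γ 0).flip (phiH 0) with hL
    have hLn : ‖L‖ ≤ C := by
      refine L.opNorm_le_bound hC.le fun v => ?_
      have h1 : L v = fderiv ℝ Γ 0 v (phiH 0) := rfl
      rw [h1]
      calc _ ≤ ‖fderiv ℝ Γ 0 v‖ * ‖phiH 0‖ := (fderiv ℝ Γ 0 v).le_opNorm _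
        _ = ‖fderiv ℝ Γ 0 v‖ := by rw [norm_phiH_zero, mul_one]
        _ ≤ ‖fderiv ℝ Γ 0‖ * ‖v‖ := (fderiv ℝ Γ 0).le_opNorm v
        _ ≤ _ := by gcongr
    have hLζ : MemLp (fun t => L (ζ t)) 2 (volume.restrict (Ioo 0 T)) := by
      refine (hζ.norm.const_mul ‖L‖).mono (L.continuous.comp_aestronglyMeasurable hζ.1)
        (ae_of_all _ fun t => ?_)
      rw [norm_mul, norm_norm, norm_norm]
      exact L.le_opNorm _
    -- the second-order Taylor remainder
    have hE1 : |coef (z T) 0 - δ - ∫ t in Ioo 0 T, u t * L (ζ t)| ≤ C * M * X := by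
      have h1 := hmode 0 T ⟨hT, le_rfl⟩
      rw [hcoef0, if_pos rfl, intervalIntegral_eq_Ioo hT] at h1
      have h2 : coef (z T) 0 - δ - ∫ t in Ioo 0 T, u t * L (ζ t)
          = ∫ t in Ioo 0 T, u t * (Γ (ζ t) - Γ 0 - fderiv ℝ Γ 0 (ζ t)) (phiH 0) := by
        have h3 : ∀ t, u t * (Γ (ζ t) - Γ 0 - fderiv ℝ Γ 0 (ζ t)) (phiH 0)
            = (-((0 : ℕ) : ℝ) ^ 2 * coef (z t) 0 + u t * Γ (ζ t) (phiH 0)) - u t * L (ζ t) := by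
          intro t
          have h4 : (Γ (ζ t) - Γ 0 - fderiv ℝ Γ 0 (ζ t)) (phiH 0)
              = Γ (ζ t) (phiH 0) - Γ 0 (phiH 0) - L (ζ t) := rfl
          rw [h4, hlost]
          push_cast
          ring
        simp_rw [h3]
        have hi1 : Integrable (fun t => u t * L (ζ t)) (volume.restrict (Ioo 0 T)) :=
          hu2.integrable_mul hLζ
        have hi2 : Integrable (fun t => -((0 : ℕ) : ℝ) ^ 2 * coef (z t) 0
            + u t * Γ (ζ t) (phiH 0)) (volume.restrict (Ioo 0 T)) :=
          Integrable.add
            (((memLp_two_of_continuousOn (hzc' 0)).integrable (by norm_num)).const_mul _)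
            (hu2.integrable_mul (memLp_apply hG _))
        rw [integral_sub hi2 hi1, h1]
        ring
      rw [h2, ← Real.norm_eq_abs, hX, ← integral_const_mul]
      refine norm_integral_le_of_norm_le (hζ.norm.integrable_sq.const_mul _) ?_
      filter_upwards [ae_restrict_mem measurableSet_Ioo] with t ht
      have hut := huM t (Ioo_subset_Icc_self ht)
      rw [norm_mul, Real.norm_eq_abs]
      calc _ ≤ M * (‖Γ (ζ t) - Γ 0 - fderiv ℝ Γ 0 (ζ t)‖ * ‖phiH 0‖) := by
            gcongr
            exact ContinuousLinearMap.le_opNorm _ _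
        _ ≤ M * (C * ‖ζ t‖ ^ 2) := by
            rw [norm_phiH_zero, mul_one]
            gcongr
            exact htay _
        _ = _ := by ring
    -- the difference to the linearised system
    have hE2 : |(∫ t in Ioo 0 T, u t * L (ζ t)) - S|
        ≤ C * M * |δ| + C * Real.sqrt N * (4 * (C * M) * Real.sqrt X) := by
      -- The comparison is made on truncated sums, because `S` is known only as a limit of partial
      -- sums. In each of them the modes are split as `δ`, linear response and `r`; the linear
      -- response cancels the partial sum of `S`, and `J ≥ 1` places the mode carrying `δ` in the
      -- range.
      refine le_of_tendsto ((tendsto_integral_partialSum hζ hu L).sub hS).abs ?_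
      filter_upwards [eventually_ge_atTop 1] with J hJ
      have hr2m : ∀ j, MemLp (r j) 2 (volume.restrict (Ioo 0 T)) := fun j =>
        memLp_two_of_continuousOn (hrc j)
      have hterm : ∀ j ∈ Finset.range J, L (phiH j) * (∫ t in Ioo 0 T, u t * coef (toL2 (ζ t)) j)
          - quadCoef Γ j * (∫ t in Ioo 0 T, u t * linResp ((j : ℝ) ^ 2) u t)
          = (if j = 0 then L (phiH 0) * δ * ∫ t in Ioo 0 T, u t else 0)
            + L (phiH j) * ∫ t in Ioo 0 T, u t * r j t := by
        intro j _
        have hlin : MemLp (linResp ((j : ℝ) ^ 2) u) 2 (volume.restrict (Ioo 0 T)) :=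
          memLp_two_of_continuousOn (continuous_linResp _ hu).continuousOn
        have e : ∀ t, u t * coef (z t) j = (u t * (if j = 0 then δ else 0)
            + Γ 0 (phiH j) * (u t * linResp ((j : ℝ) ^ 2) u t)) + u t * r j t := by
          intro t
          simp only [hr]
          ring
        have hi1 : Integrable (fun t => u t * (if j = 0 then δ else 0))
            (volume.restrict (Ioo 0 T)) := (hu2.integrable (by norm_num)).mul_const _
        have hi2 : Integrable (fun t => Γ 0 (phiH j) * (u t * linResp ((j : ℝ) ^ 2) u t))
            (volume.restrict (Ioo 0 T)) := (hu2.integrable_mul hlin).const_mul _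
        have hi3 : Integrable (fun t => u t * r j t) (volume.restrict (Ioo 0 T)) :=
          hu2.integrable_mul (hr2m j)
        have hi12 : Integrable (fun t => u t * (if j = 0 then δ else 0)
            + Γ 0 (phiH j) * (u t * linResp ((j : ℝ) ^ 2) u t))
            (volume.restrict (Ioo 0 T)) := hi1.add hi2
        rw [← hzζ j fun t x => u t * x]
        simp_rw [e]
        rw [integral_add hi12 hi3, integral_add hi1 hi2, integral_const_mul, integral_mul_const]
        have hq : quadCoef Γ j = Γ 0 (phiH j) * L (phiH j) := rfl
        rw [hq]
        by_cases h : j = 0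
        · subst h
          simp only [if_true]
          ring
        · simp only [h, if_false]
          ring
      rw [← Finset.sum_sub_distrib, Finset.sum_congr rfl hterm, Finset.sum_add_distrib,
        Finset.sum_ite_eq', if_pos (Finset.mem_range.mpr hJ)]
      refine (abs_add_le _ _).trans (add_le_add ?_ ?_)
      · have h1 : |∫ t in Ioo 0 T, u t| ≤ M := by
          have h2 := norm_setIntegral_le_of_norm_le_const (μ := volume) (s := Ioo 0 T) (f := u)
            (C := M) (by simp) (fun t ht => huM t (Ioo_subset_Icc_self ht))
          rw [Real.volume_real_Ioo_of_le hT, sub_zero] at h2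
          exact h2.trans (mul_le_of_le_one_right hM hT1)
        have h2 : |L (phiH 0)| ≤ C := by
          have := L.le_opNorm (phiH 0)
          rw [norm_phiH_zero, mul_one] at this
          exact this.trans hLn
        rw [abs_mul, abs_mul]
        calc |L (phiH 0)| * |δ| * |∫ t in Ioo 0 T, u t| ≤ C * |δ| * M := by gcongr
          _ = _ := by ring
      · have hR0 : ∀ j, 0 ≤ ∫ t in Ioo 0 T, r j t ^ 2 := fun j =>
          integral_nonneg fun t => sq_nonneg _
        calc |∑ j ∈ Finset.range J, L (phiH j) * ∫ t in Ioo 0 T, u t * r j t|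
            ≤ ∑ j ∈ Finset.range J, |L (phiH j) * ∫ t in Ioo 0 T, u t * r j t| :=
              Finset.abs_sum_le_sum_abs _ _
          _ ≤ ∑ j ∈ Finset.range J, Real.sqrt N * ((|L (phiH j)| / (1 + (j : ℝ)))
              * ((1 + (j : ℝ)) * Real.sqrt (∫ t in Ioo 0 T, r j t ^ 2))) := by
            refine Finset.sum_le_sum fun j _ => ?_
            have hj : (1 + (j : ℝ)) ≠ 0 := by positivity
            rw [abs_mul]
            calc _ ≤ |L (phiH j)| * (Real.sqrt N * Real.sqrt (∫ t in Ioo 0 T, r j t ^ 2)) := by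
                  gcongr
                  exact abs_integral_mul_le_sqrt hu2 (hr2m j)
              _ = _ := by field_simp
          _ = Real.sqrt N * ∑ j ∈ Finset.range J, (|L (phiH j)| / (1 + (j : ℝ)))
              * ((1 + (j : ℝ)) * Real.sqrt (∫ t in Ioo 0 T, r j t ^ 2)) := by
            rw [Finset.mul_sum]
          _ ≤ Real.sqrt N * (C * (4 * (C * M) * Real.sqrt X)) := by
            gcongr
            -- The weights `1 + j` pair the norm of `L` in `H⁻¹_N` with that of `r` in `L²((0,T);
            -- H¹_N)`.
            refine (Real.sum_mul_le_sqrt_mul_sqrt _ _ _).trans ?_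
            refine mul_le_mul ?_ ?_ (Real.sqrt_nonneg _) hC.le
            · refine Real.sqrt_le_iff.mpr ⟨hC.le, ?_⟩
              have h1 := sum_dual_modes_le L (Finset.range J)
              have h2 : ‖L‖ ^ 2 ≤ C ^ 2 := by gcongr
              refine le_trans (le_of_eq ?_) (h1.trans h2)
              exact Finset.sum_congr rfl fun j _ => by rw [div_pow, sq_abs]
            · refine Real.sqrt_le_iff.mpr ⟨by positivity, ?_⟩
              have h1 := hr1 J
              calc _ = ∑ j ∈ Finset.range J, (1 + (j : ℝ)) ^ 2 * ∫ t in Ioo 0 T, r j t ^ 2 :=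
                    Finset.sum_congr rfl fun j _ => by rw [mul_pow, Real.sq_sqrt (hR0 j)]
                _ ≤ 16 * ((C * M) ^ 2 * X) := by linarith
                _ = 16 * ((C * M) ^ 2 * Real.sqrt X ^ 2) := by rw [Real.sq_sqrt hX0]
                _ = _ := by ring
          _ = _ := by ring
    have htri : |coef (z T) 0 - δ - S| ≤ |coef (z T) 0 - δ - ∫ t in Ioo 0 T, u t * L (ζ t)|
        + |(∫ t in Ioo 0 T, u t * L (ζ t)) - S| := abs_sub_le _ _ _
    have hNX : Real.sqrt N * Real.sqrt X ≤ N + X := by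
      nlinarith [Real.sq_sqrt hN0, Real.sq_sqrt hX0, sq_nonneg (Real.sqrt N - Real.sqrt X)]
    have hX' : X ≤ 4 * |δ| + 64 * C ^ 2 * N := by linarith
    calc |coef (z T) 0 - δ - S|
        ≤ C * M * X + (C * M * |δ| + C * Real.sqrt N * (4 * (C * M) * Real.sqrt X)) := by linarith
      _ = M * (C * X + C * |δ| + 4 * C ^ 2 * (Real.sqrt N * Real.sqrt X)) := by ring
      _ ≤ M * (C * X + C * |δ| + 4 * C ^ 2 * (N + X)) := by gcongr
      _ = M * (C * |δ| + 4 * C ^ 2 * N + (C + 4 * C ^ 2) * X) := by ring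
      _ ≤ M * (C * |δ| + 4 * C ^ 2 * N + (C + 4 * C ^ 2) * (4 * |δ| + 64 * C ^ 2 * N)) := by
        gcongr
      _ = M * ((5 * C + 16 * C ^ 2) * |δ|
          + (4 * C ^ 2 + 64 * C ^ 3 + 256 * C ^ 4) * N) := by ring
      _ ≤ M * ((8 * C + 300 * (C + C ^ 2 + C ^ 3 + C ^ 4)) * |δ|
          + (8 * C + 300 * (C + C ^ 2 + C ^ 3 + C ^ 4)) * N) := by
        have := pow_pos hC 2
        have := pow_pos hC 3
        have := pow_pos hC 4
        refine mul_le_mul_of_nonneg_left (add_le_add (mul_le_mul_of_nonneg_right ?_ (abs_nonneg _))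
          (mul_le_mul_of_nonneg_right ?_ hN0)) hM <;> linarith
      _ = _ := by ring

/-! ### Iterated primitives and integration by parts in the quadratic form. -/

theorem primitive_succ (u : ℝ → ℝ) (k : ℕ) (t : ℝ) :
    primitive u (k + 1) t = ∫ s in (0 : ℝ)..t, primitive u k s := rfl

theorem primitive_succ_zero (u : ℝ → ℝ) (k : ℕ) : primitive u (k + 1) 0 = 0 := by
  simp [primitive_succ]

theorem hasDerivAt_primitive_of_continuous {u : ℝ → ℝ} {k : ℕ} (h : Continuous (primitive u k))
    (t : ℝ) : HasDerivAt (primitive u (k + 1)) (primitive u k t) t :=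
  (h.integral_hasStrictDerivAt 0 t).hasDerivAt

theorem continuous_primitive {u : ℝ → ℝ} (hu : Continuous u) (k : ℕ) :
    Continuous (primitive u k) := by
  induction k with
  | zero => exact hu
  | succ k ih =>
    exact continuous_iff_continuousAt.mpr fun t =>
      (hasDerivAt_primitive_of_continuous ih t).continuousAt

theorem hasDerivAt_primitive {u : ℝ → ℝ} (hu : Continuous u) (k : ℕ) (t : ℝ) :
    HasDerivAt (primitive u (k + 1)) (primitive u k t) t :=
  hasDerivAt_primitive_of_continuous (continuous_primitive hu k) t

/-- Integration by parts in Duhamel's formula. -/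
theorem linResp_of_hasDerivAt (lam : ℝ) {f F : ℝ → ℝ} (hf : Continuous f)
    (hF : ∀ t, HasDerivAt F (f t) t) (hF0 : F 0 = 0) (t : ℝ) :
    linResp lam f t = F t - lam * linResp lam F t := by
  have hFc : Continuous F := continuous_iff_continuousAt.mpr fun t => (hF t).continuousAt
  -- Uniqueness for the linear equation: the discrepancy times the integrating factor is constant.
  set d : ℝ → ℝ := fun t => Real.exp (lam * t) * (linResp lam f t - F t + lam * linResp lam F t)
    with hd
  have hd' : ∀ t, HasDerivAt d 0 t := by
    intro t
    have h1 : HasDerivAt (fun t : ℝ => Real.exp (lam * t)) (Real.exp (lam * t) * (lam * 1)) t :=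
      ((hasDerivAt_id t).const_mul lam).exp
    have h2 := ((hasDerivAt_linResp lam hf t).sub (hF t)).add
      ((hasDerivAt_linResp lam hFc t).const_mul lam)
    refine (h1.mul h2).congr_deriv ?_
    simp only [Pi.add_apply, Pi.sub_apply]
    ring
  have h0 : d t = d 0 := is_const_of_deriv_eq_zero (fun t => (hd' t).differentiableAt)
    (fun t => (hd' t).deriv) t 0
  have h1 : d 0 = 0 := by simp [hd, linResp_zero, hF0]
  rw [h1] at h0
  have h2 := (mul_eq_zero.mp h0).resolve_left (Real.exp_pos _).ne'
  linarith

/-- One integration by parts in the quadratic form `∫₀ᵀ f y`, where `y' = -λ y + f`. -/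
theorem quadForm_step (lam T : ℝ) {f F : ℝ → ℝ} (hf : Continuous f)
    (hF : ∀ t, HasDerivAt F (f t) t) (hF0 : F 0 = 0) :
    ∫ t in (0 : ℝ)..T, f t * linResp lam f t
      = F T ^ 2 / 2 - lam * F T * linResp lam F T + lam * (∫ t in (0 : ℝ)..T, F t ^ 2)
        - lam ^ 2 * ∫ t in (0 : ℝ)..T, F t * linResp lam F t := by
  have hFc : Continuous F := continuous_iff_continuousAt.mpr fun t => (hF t).continuousAt
  have hwc := continuous_linResp lam hFc
  have hyc := continuous_linResp lam hf
  -- With `y = F - λ w` and `w' = -λ w + F`, the derivative of `F²/2 - λ F w` is `f y + λ² F w - λ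
  -- F²`.
  have h1 : ∀ t, HasDerivAt (fun t => F t ^ 2 / 2 - lam * F t * linResp lam F t)
      (f t * linResp lam f t + lam ^ 2 * (F t * linResp lam F t) - lam * F t ^ 2) t := by
    intro t
    have h2 := (((hF t).pow 2).div_const 2).sub
      (((hF t).const_mul lam).mul (hasDerivAt_linResp lam hFc t))
    refine h2.congr_deriv ?_
    rw [linResp_of_hasDerivAt lam hf hF hF0 t]
    simp only [Nat.cast_ofNat, Nat.add_one_sub_one, pow_one]
    ring
  have h2 := intervalIntegral.integral_eq_sub_of_hasDerivAt (a := 0) (b := T)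
    (fun t _ => h1 t) (Continuous.intervalIntegrable (by fun_prop) _ _)
  rw [intervalIntegral.integral_sub (Continuous.intervalIntegrable (by fun_prop) _ _)
      (Continuous.intervalIntegrable (by fun_prop) _ _),
    intervalIntegral.integral_add (Continuous.intervalIntegrable (by fun_prop) _ _)
      (Continuous.intervalIntegrable (by fun_prop) _ _),
    intervalIntegral.integral_const_mul, intervalIntegral.integral_const_mul, hF0] at h2
  linarith

/-- The kernel `e^{-λ(t-s)}` is at most `1`, so the bound is uniform over the modes, as the
summation over `j` requires. -/
theorem abs_linResp_le {lam T t : ℝ} (hlam : 0 ≤ lam) (ht : t ∈ Icc 0 T) {f : ℝ → ℝ}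
    (hf : Continuous f) :
    |linResp lam f t| ≤ Real.sqrt T * Real.sqrt (∫ s in Ioo 0 T, f s ^ 2) := by
  have h1 : |linResp lam f t| ≤ |∫ s in (0 : ℝ)..t, abs (f s)| := by
    unfold linResp
    rw [← intervalIntegral.integral_const_mul]
    have h2 : ∀ s ∈ Icc 0 t, ‖Real.exp (-lam * t) * (Real.exp (lam * s) * f s)‖ ≤ |f s| := by
      intro s hs
      rw [← mul_assoc, ← Real.exp_add, norm_mul, Real.norm_eq_abs, Real.abs_exp, Real.norm_eq_abs]
      refine mul_le_of_le_one_left (abs_nonneg _) (Real.exp_le_one_iff.mpr ?_)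
      nlinarith [hs.2]
    have h3 := intervalIntegral.norm_integral_le_of_norm_le (μ := volume) (a := 0) (b := t)
      (f := fun s => Real.exp (-lam * t) * (Real.exp (lam * s) * f s)) (g := fun s => |f s|)
      ht.1 (ae_of_all _ fun s hs => h2 s (Ioc_subset_Icc_self hs))
      (Continuous.intervalIntegrable (by fun_prop) _ _)
    exact h3.trans (le_abs_self _)
  refine h1.trans ?_
  have hT : 0 ≤ T := ht.1.trans ht.2
  rw [← Real.sqrt_mul hT]
  refine Real.abs_le_sqrt ?_
  have h2 := sq_integral_Icc_le ht (memLp_two_of_continuousOn (T := T) hf.abs.continuousOn)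
  simpa only [sq_abs] using h2

/-- The state of the linear system at time `T` in terms of the iterated primitives of the
control. -/
theorem linResp_eq_sum_primitive (lam : ℝ) {u : ℝ → ℝ} (hu : Continuous u) (n : ℕ) (t : ℝ) :
    linResp lam u t = ∑ i ∈ Finset.range n, (-lam) ^ i * primitive u (i + 1) t
      + (-lam) ^ n * linResp lam (primitive u n) t := by
  induction n with
  | zero => simp [primitive]
  | succ n ih =>
    rw [ih, Finset.sum_range_succ, linResp_of_hasDerivAt lam (continuous_primitive hu n)
      (hasDerivAt_primitive hu n) (primitive_succ_zero u n)]
    ring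

/-- Backward induction from `u_n`: passing from `u_{k+1}` to `u_k` adds the final value `u_{k+1}(T)`
and multiplies the response by `λ`. -/
theorem abs_linResp_primitive_le {lam T V Y : ℝ} (hlam : 1 ≤ lam) {u : ℝ → ℝ} (hu : Continuous u)
    {n : ℕ} (hV : ∀ k, 1 ≤ k → k ≤ n → |primitive u k T| ≤ V)
    (hY : |linResp lam (primitive u n) T| ≤ Y) (m : ℕ) (hm : m ≤ n) :
    |linResp lam (primitive u (n - m)) T| ≤ lam ^ m * (m * V + Y) := by
  induction m with
  | zero => simpa using hY
  | succ m ih =>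
    obtain ⟨k, hk⟩ : ∃ k, n - m = k + 1 := ⟨n - m - 1, by omega⟩
    have hk' : n - (m + 1) = k := by omega
    have ih' := ih (by omega)
    rw [hk] at ih'
    have hVk := hV (k + 1) (by omega) (by omega)
    have hV0 : 0 ≤ V := (abs_nonneg _).trans hVk
    rw [hk', linResp_of_hasDerivAt lam (continuous_primitive hu k)
      (hasDerivAt_primitive hu k) (primitive_succ_zero u k)]
    have h1 : (1 : ℝ) ≤ lam ^ (m + 1) := one_le_pow₀ hlam
    calc _ ≤ |primitive u (k + 1) T| + |lam * linResp lam (primitive u (k + 1)) T| :=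
          abs_sub _ _
      _ ≤ V + lam * (lam ^ m * (m * V + Y)) := by
          rw [abs_mul, abs_of_nonneg (by linarith : (0 : ℝ) ≤ lam)]
          gcongr
      _ ≤ lam ^ (m + 1) * V + lam * (lam ^ m * (m * V + Y)) := by nlinarith
      _ = _ := by push_cast; ring

/-- `quadForm_step` iterated: the first sum produces the drift, the second collects the values at
time `T`, and the last term is the quadratic form of `u_n`. -/
theorem quadForm_eq_sum (lam T : ℝ) {u : ℝ → ℝ} (hu : Continuous u) (n : ℕ) :
    ∫ t in (0 : ℝ)..T, u t * linResp lam u t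
      = ∑ k ∈ Finset.range n, (-1) ^ k * lam ^ (2 * k + 1)
          * (∫ t in (0 : ℝ)..T, primitive u (k + 1) t ^ 2)
        + ∑ k ∈ Finset.range n, (-1) ^ k * lam ^ (2 * k) * (primitive u (k + 1) T ^ 2 / 2
            - lam * primitive u (k + 1) T * linResp lam (primitive u (k + 1)) T)
        + (-1) ^ n * lam ^ (2 * n)
          * ∫ t in (0 : ℝ)..T, primitive u n t * linResp lam (primitive u n) t := by
  induction n with
  | zero => simp [primitive]
  | succ n ih =>
    rw [ih, Finset.sum_range_succ, Finset.sum_range_succ,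
      quadForm_step lam T (continuous_primitive hu n)
      (hasDerivAt_primitive hu n) (primitive_succ_zero u n)]
    ring

/-- Every term other than the squared norms grows at most like `λ^{2n}`. For `λ = j²` this is the
weight `j^{4n}` for which the coefficients are summable. -/
theorem abs_quadForm_sub_le {lam T V : ℝ} (hlam : 1 ≤ lam) (hT : 0 ≤ T) {u : ℝ → ℝ}
    (hu : Continuous u) {n : ℕ} (hV0 : 0 ≤ V)
    (hV : ∀ k, 1 ≤ k → k ≤ n → |primitive u k T| ≤ V) :
    |(∫ t in Ioo 0 T, u t * linResp lam u t)
        - ∑ k ∈ Finset.range n, (-1) ^ k * lam ^ (2 * k + 1)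
          * (∫ t in Ioo 0 T, primitive u (k + 1) t ^ 2)|
      ≤ lam ^ (2 * n) * (T * (∫ t in Ioo 0 T, primitive u n t ^ 2)
        + n * ((n + 1) * V ^ 2 + V * (Real.sqrt T
            * Real.sqrt (∫ t in Ioo 0 T, primitive u n t ^ 2)))) := by
  set U : ℝ := ∫ t in Ioo 0 T, primitive u n t ^ 2 with hU
  have hU0 : 0 ≤ U := integral_nonneg fun t => sq_nonneg _
  set Y : ℝ := Real.sqrt T * Real.sqrt U with hY
  have hY0 : 0 ≤ Y := by positivity
  have hYT : ∀ t ∈ Icc 0 T, |linResp lam (primitive u n) t| ≤ Y := fun t ht =>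
    abs_linResp_le (by linarith) ht (continuous_primitive hu n)
  have hlam0 : 0 ≤ lam := by linarith
  have h1 := quadForm_eq_sum lam T hu n
  simp_rw [intervalIntegral_eq_Ioo hT] at h1
  rw [h1, add_assoc, add_sub_cancel_left]
  have hY2 : Y * Y = T * U := by
    rw [hY, mul_mul_mul_comm, Real.mul_self_sqrt hT, Real.mul_self_sqrt hU0]
  have hrem : |∫ t in Ioo 0 T, primitive u n t * linResp lam (primitive u n) t| ≤ T * U := by
    have hc := continuous_primitive hu n
    have hcl := continuous_linResp lam hc
    have h2 := sq_integral_mul_le (memLp_two_of_continuousOn (T := T) hc.continuousOn)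
      (memLp_two_of_continuousOn (T := T) hcl.continuousOn)
    have h3 : ∫ t in Ioo 0 T, linResp lam (primitive u n) t ^ 2 ≤ T * (T * U) := by
      have h4 : ∫ t in Ioo 0 T, linResp lam (primitive u n) t ^ 2 ≤ ∫ _ in Ioo 0 T, T * U := by
        refine setIntegral_mono_on
          (memLp_two_of_continuousOn (T := T) hcl.continuousOn).integrable_sq
          (integrable_const _) measurableSet_Ioo fun t ht => ?_
        have := hYT t (Ioo_subset_Icc_self ht)
        rw [← hY2, ← sq_abs, ← sq]
        gcongr
      rw [integral_const] at h4
      simpa only [measureReal_restrict_apply_univ, Real.volume_real_Ioo_of_le hT, sub_zero,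
        smul_eq_mul] using h4
    refine abs_le_of_sq_le_sq (h2.trans ?_) (by positivity)
    calc U * ∫ t in Ioo 0 T, linResp lam (primitive u n) t ^ 2 ≤ U * (T * (T * U)) := by gcongr
      _ = _ := by ring
  have hbdry : ∀ k ∈ Finset.range n, |(-1) ^ k * lam ^ (2 * k) * (primitive u (k + 1) T ^ 2 / 2
      - lam * primitive u (k + 1) T * linResp lam (primitive u (k + 1)) T)|
      ≤ lam ^ (2 * n) * ((n + 1) * V ^ 2 + V * Y) := by
    intro k hk
    have hk' : k + 1 ≤ n := Finset.mem_range.mp hk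
    have h2 := hV (k + 1) (by omega) hk'
    have h3 := abs_linResp_primitive_le hlam hu hV (hYT T ⟨hT, le_rfl⟩) (n - (k + 1)) (by omega)
    rw [show n - (n - (k + 1)) = k + 1 by omega] at h3
    have h4 : ((n - (k + 1) : ℕ) : ℝ) ≤ n := by exact_mod_cast Nat.sub_le _ _
    rw [abs_mul, abs_mul, abs_pow, abs_neg, abs_one, one_pow, one_mul,
      abs_of_nonneg (by positivity : 0 ≤ lam ^ (2 * k))]
    have h5 : |primitive u (k + 1) T ^ 2 / 2
        - lam * primitive u (k + 1) T * linResp lam (primitive u (k + 1)) T|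
        ≤ V ^ 2 + lam * V * (lam ^ (n - (k + 1)) * (n * V + Y)) := by
      refine (abs_sub _ _).trans (add_le_add ?_ ?_)
      · rw [abs_of_nonneg (by positivity), ← sq_abs]
        have : |primitive u (k + 1) T| ^ 2 ≤ V ^ 2 := by gcongr
        linarith [sq_nonneg V]
      · rw [abs_mul, abs_mul, abs_of_nonneg hlam0]
        have h6 : lam ^ (n - (k + 1)) * ((n - (k + 1) : ℕ) * V + Y)
            ≤ lam ^ (n - (k + 1)) * (n * V + Y) := by gcongr
        gcongr
        exact h3.trans h6
    have h6 : lam ^ (2 * k) ≤ lam ^ (2 * n) := pow_le_pow_right₀ hlam (by omega)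
    -- The exponent on the left is `n + k`, and `k < n`.
    have h7 : lam ^ (2 * k) * (lam * lam ^ (n - (k + 1))) ≤ lam ^ (2 * n) := by
      rw [← pow_succ', ← pow_add]
      exact pow_le_pow_right₀ hlam (by omega)
    calc _ ≤ lam ^ (2 * k) * (V ^ 2 + lam * V * (lam ^ (n - (k + 1)) * (n * V + Y))) := by gcongr
      _ = lam ^ (2 * k) * V ^ 2
          + lam ^ (2 * k) * (lam * lam ^ (n - (k + 1))) * (V * (n * V + Y)) := by ring
      _ ≤ lam ^ (2 * n) * V ^ 2 + lam ^ (2 * n) * (V * (n * V + Y)) := by gcongr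
      _ = _ := by ring
  calc _ ≤ |∑ k ∈ Finset.range n, (-1) ^ k * lam ^ (2 * k) * (primitive u (k + 1) T ^ 2 / 2
            - lam * primitive u (k + 1) T * linResp lam (primitive u (k + 1)) T)|
          + |(-1) ^ n * lam ^ (2 * n)
            * ∫ t in Ioo 0 T, primitive u n t * linResp lam (primitive u n) t| := abs_add_le _ _
    _ ≤ n * (lam ^ (2 * n) * ((n + 1) * V ^ 2 + V * Y)) + lam ^ (2 * n) * (T * U) := by
      refine add_le_add ?_ ?_
      · refine (Finset.abs_sum_le_sum_abs _ _).trans ((Finset.sum_le_sum hbdry).trans ?_)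
        rw [Finset.sum_const, Finset.card_range, nsmul_eq_mul]
      · rw [abs_mul, abs_mul, abs_pow, abs_neg, abs_one, one_pow, one_mul,
          abs_of_nonneg (by positivity : 0 ≤ lam ^ (2 * n))]
        gcongr
    _ = _ := by ring

/-! ### Summation over the modes, and control of the final values. -/

/-- The quadratic form of the second-order expansion, summed over the modes. -/
theorem exists_quadForm_sum {c : ℕ → ℝ} {n : ℕ} (hn : 1 ≤ n) (hc0 : c 0 = 0)
    (hsum : Summable fun j : ℕ+ => (j : ℝ) ^ (4 * n) * |c j|)
    (hvanish : ∀ ℓ : ℕ, 1 ≤ ℓ → ℓ ≤ n - 1 →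
      HasSum (fun j : ℕ+ => (j : ℝ) ^ (2 * (2 * ℓ - 1)) * c j) 0)
    {a : ℝ} (ha : HasSum (fun j : ℕ+ => (j : ℝ) ^ (2 * (2 * n - 1)) * c j) a)
    {T V : ℝ} (hT : 0 ≤ T) {u : ℝ → ℝ} (hu : Continuous u) (hV0 : 0 ≤ V)
    (hV : ∀ k, 1 ≤ k → k ≤ n → |primitive u k T| ≤ V) :
    ∃ S : ℝ, Tendsto (fun J => ∑ j ∈ Finset.range J,
        c j * ∫ t in Ioo 0 T, u t * linResp ((j : ℝ) ^ 2) u t) atTop (𝓝 S) ∧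
      |S + a * (-1) ^ n * ∫ t in Ioo 0 T, primitive u n t ^ 2|
        ≤ (∑' j : ℕ+, (j : ℝ) ^ (4 * n) * |c j|)
          * (T * (∫ t in Ioo 0 T, primitive u n t ^ 2)
            + n * ((n + 1) * V ^ 2 + V * (Real.sqrt T
              * Real.sqrt (∫ t in Ioo 0 T, primitive u n t ^ 2)))) := by
  set B : ℝ := T * (∫ t in Ioo 0 T, primitive u n t ^ 2)
            + n * ((n + 1) * V ^ 2 + V * (Real.sqrt T
              * Real.sqrt (∫ t in Ioo 0 T, primitive u n t ^ 2))) with hB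
  set Q : ℕ → ℝ := fun j => ∫ t in Ioo 0 T, u t * linResp ((j : ℝ) ^ 2) u t with hQ
  set P : ℕ → ℝ := fun j => ∑ k ∈ Finset.range n, (-1) ^ k * ((j : ℝ) ^ 2) ^ (2 * k + 1)
          * (∫ t in Ioo 0 T, primitive u (k + 1) t ^ 2) with hP
  have hbound : ∀ j : ℕ+, ‖c j * (Q j - P j)‖ ≤ (j : ℝ) ^ (4 * n) * |c j| * B := by
    intro j
    have hj : (1 : ℝ) ≤ (j : ℝ) ^ 2 := one_le_pow₀ (by exact_mod_cast j.pos)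
    have h := abs_quadForm_sub_le hj hT hu hV0 hV
    rw [← pow_mul, show 2 * (2 * n) = 4 * n by ring] at h
    rw [norm_mul, Real.norm_eq_abs, Real.norm_eq_abs]
    calc |c j| * |Q j - P j| ≤ |c j| * ((j : ℝ) ^ (4 * n) * B) := by gcongr
      _ = _ := by ring
  have hs1 : Summable fun j : ℕ+ => c j * (Q j - P j) :=
    Summable.of_norm_bounded (hsum.mul_right B) hbound
  have hle : |∑' j : ℕ+, c j * (Q j - P j)| ≤ (∑' j : ℕ+, (j : ℝ) ^ (4 * n) * |c j|) * B := by
    rw [← tsum_mul_right, ← Real.norm_eq_abs]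
    exact tsum_of_norm_bounded (hsum.mul_right B).hasSum hbound
  have hPsum : HasSum (fun j : ℕ+ => c j * P j)
      (-(a * (-1) ^ n * ∫ t in Ioo 0 T, primitive u n t ^ 2)) := by
    -- The `k`-th term carries the moment of index `ℓ = k + 1`. Only `k = n - 1` survives, with
    -- `(-1)^{n-1} a = -a (-1)^n`.
    have h1 : ∀ k ∈ Finset.range n, HasSum (fun j : ℕ+ => c j * ((-1) ^ k
        * ((j : ℝ) ^ 2) ^ (2 * k + 1) * (∫ t in Ioo 0 T, primitive u (k + 1) t ^ 2)))
        (if k = n - 1 then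
          -(a * (-1) ^ n * ∫ t in Ioo 0 T, primitive u n t ^ 2) else 0) := by
      intro k hk
      have hk' := Finset.mem_range.mp hk
      have e : ∀ j : ℕ+, c j * ((-1) ^ k
          * ((j : ℝ) ^ 2) ^ (2 * k + 1) * (∫ t in Ioo 0 T, primitive u (k + 1) t ^ 2))
          = (j : ℝ) ^ (2 * (2 * (k + 1) - 1)) * c j
            * ((-1) ^ k * ∫ t in Ioo 0 T, primitive u (k + 1) t ^ 2) := by
        intro j
        rw [← pow_mul, show 2 * (2 * (k + 1) - 1) = 2 * (2 * k + 1) by omega]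
        ring
      simp_rw [e]
      split_ifs with h
      · have h2 : n = k + 1 := by omega
        subst h2
        have h3 := ha.mul_right ((-1) ^ k * ∫ t in Ioo 0 T, primitive u (k + 1) t ^ 2)
        have h4 : -(a * (-1) ^ (k + 1) * ∫ t in Ioo 0 T, primitive u (k + 1) t ^ 2)
            = a * ((-1) ^ k * ∫ t in Ioo 0 T, primitive u (k + 1) t ^ 2) := by
          rw [pow_succ]
          ring
        rw [h4]
        exact h3
      · have h3 := (hvanish (k + 1) (by omega) (by omega)).mul_right
          ((-1) ^ k * ∫ t in Ioo 0 T, primitive u (k + 1) t ^ 2)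
        rwa [zero_mul] at h3
    have h2 := hasSum_sum h1
    rw [Finset.sum_ite_eq', if_pos (Finset.mem_range.mpr (by omega))] at h2
    simpa only [hP, Finset.mul_sum] using h2
  have hQsum := hs1.hasSum.add hPsum
  have hQsum' : HasSum (fun j : ℕ+ => c j * Q j) ((∑' j : ℕ+, c j * (Q j - P j))
      + -(a * (-1) ^ n * ∫ t in Ioo 0 T, primitive u n t ^ 2)) := by
    have e : (fun j : ℕ+ => c j * (Q j - P j) + c j * P j) = fun j : ℕ+ => c j * Q j := by
      ext j
      ring
    rwa [e] at hQsum
  -- As `c 0 = 0`, the series over the positive integers is also a series over `ℕ`, whose initial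
  -- segments are the truncations in `solution_estimates`.
  refine ⟨_, ((PNat.coe_injective.hasSum_iff
    (f := fun j => c j * Q j) ?_).mp hQsum').tendsto_sum_nat, ?_⟩
  · intro j hj
    have : j = 0 := by
      by_contra h
      exact hj ⟨⟨j, Nat.pos_of_ne_zero h⟩, rfl⟩
    simp [this, hc0]
  · rw [neg_add_cancel_right]
    exact hle

/-- A Vandermonde system is uniformly solvable. -/
theorem exists_bound_of_vandermonde {n : ℕ} {x : Fin n → ℝ} (hx : Function.Injective x) :
    ∃ C : ℝ, 0 < C ∧ ∀ (b : Fin n → ℝ) (B : ℝ), 0 ≤ B →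
      (∀ i, |∑ k : Fin n, x i ^ (k : ℕ) * b k| ≤ B) → ∀ k, |b k| ≤ C * B := by
  have hker : LinearMap.ker (Matrix.mulVecLin (Matrix.vandermonde x)) = ⊥ := by
    rw [LinearMap.ker_eq_bot']
    intro b hb
    exact Matrix.eq_zero_of_mulVec_eq_zero (Matrix.det_vandermonde_ne_zero_iff.mpr hx) hb
  obtain ⟨K, hK, hKa⟩ := LinearMap.exists_antilipschitzWith _ hker
  refine ⟨K, by exact_mod_cast hK, fun b B hB h k => ?_⟩
  have h1 := hKa.le_mul_norm_sub b 0
  simp only [map_zero, add_zero, norm_neg] at h1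
  have h2 : ‖Matrix.mulVecLin (Matrix.vandermonde x) b‖ ≤ B := by
    refine (pi_norm_le_iff_of_nonneg hB).mpr fun i => ?_
    exact h i
  calc |b k| ≤ ‖b‖ := norm_le_pi_norm b k
    _ ≤ K * _ := h1
    _ ≤ _ := by gcongr

/-- The final values of the primitives of the control are controlled by finitely many final
modes of the linear system. -/
theorem exists_primitive_bound {n : ℕ} {J : Finset ℕ} (hJ : J.card = n) :
    ∃ C : ℝ, 0 < C ∧ ∀ (T : ℝ) (u : ℝ → ℝ) (W : ℝ), 0 ≤ T → Continuous u → 0 ≤ W →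
      (∀ j ∈ J, |linResp ((j : ℝ) ^ 2) u T| ≤ W) → ∀ k, 1 ≤ k → k ≤ n →
      |primitive u k T| ≤ C * (Real.sqrt T
        * Real.sqrt (∫ t in Ioo 0 T, primitive u n t ^ 2) + W) := by
  set e := J.equivFinOfCardEq hJ with he
  -- In `linResp_eq_sum_primitive` the numbers `u_1(T), …, u_n(T)` are multiplied by the powers of
  -- `-j²`. Hence `n` modes form a Vandermonde system with these nodes, up to the response to `u_n`.
  set x : Fin n → ℝ := fun i => -((e.symm i : ℕ) : ℝ) ^ 2 with hx
  have hxi : Function.Injective x := by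
    intro i i' h
    simp only [hx, neg_inj] at h
    have h1 := (pow_left_inj₀ (Nat.cast_nonneg _) (Nat.cast_nonneg _) two_ne_zero).mp h
    exact e.symm.injective (Subtype.ext (by exact_mod_cast h1))
  obtain ⟨C, hC, hCb⟩ := exists_bound_of_vandermonde hxi
  set D : ℝ := 1 + ∑ i, |x i| ^ n with hD
  have hD1 : 1 ≤ D := le_add_of_nonneg_right (Finset.sum_nonneg fun i _ => by positivity)
  refine ⟨C * D, by positivity, fun T u W hT hu hW hWJ k hk1 hkn => ?_⟩
  set Y := Real.sqrt T * Real.sqrt (∫ t in Ioo 0 T, primitive u n t ^ 2) with hY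
  have hY0 : 0 ≤ Y := by positivity
  have h := hCb (fun k => primitive u (k + 1) T) (D * (Y + W)) (by positivity) (fun i => ?_)
    ⟨k - 1, by omega⟩
  · simp only [Nat.sub_add_cancel hk1] at h
    rw [mul_assoc]
    exact h
  · have h1 := linResp_eq_sum_primitive (((e.symm i : ℕ) : ℝ) ^ 2) hu n T
    have h2 : ∑ k : Fin n, x i ^ (k : ℕ) * primitive u (k + 1) T
        = linResp (((e.symm i : ℕ) : ℝ) ^ 2) u T
          - x i ^ n * linResp (((e.symm i : ℕ) : ℝ) ^ 2) (primitive u n) T := by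
      rw [h1, Fin.sum_univ_eq_sum_range fun k => x i ^ k * primitive u (k + 1) T]
      ring
    rw [h2]
    have h3 := abs_linResp_le (lam := ((e.symm i : ℕ) : ℝ) ^ 2) (by positivity)
      (⟨hT, le_rfl⟩ : T ∈ Icc 0 T) (continuous_primitive hu n)
    have h4 : |x i| ^ n ≤ D := by
      have := Finset.single_le_sum (f := fun i => |x i| ^ n) (fun i _ => by positivity)
        (Finset.mem_univ i)
      linarith
    calc _ ≤ |linResp (((e.symm i : ℕ) : ℝ) ^ 2) u T|
          + |x i ^ n * linResp (((e.symm i : ℕ) : ℝ) ^ 2) (primitive u n) T| := abs_sub _ _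
      _ ≤ W + D * Y := by
        rw [abs_mul, abs_pow]
        gcongr
        exact hWJ _ (e.symm i).2
      _ ≤ _ := by nlinarith

/-! ### Weak derivatives on an interval and continuous representatives. -/

theorem setIntegral_Ioo_of_tsupport {T : ℝ} {θ : ℝ → ℝ} (h : tsupport θ ⊆ Ioo 0 T)
    (w : ℝ → ℝ) : ∫ t in Ioo 0 T, θ t * w t = ∫ t, θ t * w t := by
  refine setIntegral_eq_integral_of_forall_compl_eq_zero fun t ht => ?_
  rw [image_eq_zero_of_notMem_tsupport fun h' => ht (h h'), zero_mul]

/-- A test function with zero mean is the derivative of a test function. -/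
theorem exists_test_primitive {T : ℝ} (hT : 0 < T) {ψ : ℝ → ℝ} (hψ : ContDiff ℝ ∞ ψ)
    (hc : HasCompactSupport ψ) (hs : tsupport ψ ⊆ Ioo 0 T) (h0 : ∫ t in (0 : ℝ)..T, ψ t = 0) :
    ∃ θ : ℝ → ℝ, ContDiff ℝ ∞ θ ∧ HasCompactSupport θ ∧ tsupport θ ⊆ Ioo 0 T ∧ deriv θ = ψ := by
  obtain ⟨a, b, ha, hb, hab⟩ : ∃ a b : ℝ, 0 < a ∧ b < T ∧ tsupport ψ ⊆ Icc a b := by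
    rcases (tsupport ψ).eq_empty_or_nonempty with h | h
    · exact ⟨T / 2, T / 2, by linarith, by linarith, by rw [h]; exact empty_subset _⟩
    · obtain ⟨a, ha⟩ := hc.isCompact.exists_isLeast h
      obtain ⟨b, hb⟩ := hc.isCompact.exists_isGreatest h
      exact ⟨a, b, (hs ha.1).1, (hs hb.1).2, fun x hx => ⟨ha.2 hx, hb.2 hx⟩⟩
  have hz : ∀ t, t ∉ Icc a b → ψ t = 0 := fun t ht =>
    image_eq_zero_of_notMem_tsupport fun h => ht (hab h)
  set θ : ℝ → ℝ := fun t => ∫ s in (0 : ℝ)..t, ψ s with hθ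
  have hd : ∀ t, HasDerivAt θ (ψ t) t := fun t =>
    (hψ.continuous.integral_hasStrictDerivAt 0 t).hasDerivAt
  have hderiv : deriv θ = ψ := funext fun t => (hd t).deriv
  have hsupp : Function.support θ ⊆ Icc a b := by
    intro t ht
    by_contra hn
    refine ht ?_
    -- To the left of the support of `ψ` the primitive vanishes trivially; to the right it vanishes
    -- because `ψ` has zero mean.
    rcases lt_or_ge t a with h | h
    · refine intervalIntegral.integral_zero_ae (ae_of_all _ fun s hs' => hz s fun h' => ?_)
      have := (uIoc_subset_uIcc hs').2
      rcases le_max_iff.mp this with h1 | h1 <;> linarith [h'.1]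
    · have h2 : b < t := by
        by_contra h3
        exact hn ⟨h, not_lt.mp h3⟩
      have h3 : ∫ s in t..T, ψ s = 0 := by
        refine intervalIntegral.integral_zero_ae (ae_of_all _ fun s hs' => hz s fun h' => ?_)
        have := (uIoc_subset_uIcc hs').1
        rcases min_le_iff.mp this with h1 | h1 <;> linarith [h'.2]
      have h4 := intervalIntegral.integral_add_adjacent_intervals
        (hψ.continuous.intervalIntegrable (μ := volume) 0 t)
        (hψ.continuous.intervalIntegrable (μ := volume) t T)
      rw [h3, add_zero, h0] at h4
      exact h4
  have htsupp : tsupport θ ⊆ Icc a b := closure_minimal hsupp isClosed_Icc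
  refine ⟨θ, ?_, HasCompactSupport.of_support_subset_isCompact isCompact_Icc hsupp,
    htsupp.trans fun t ht => ⟨ha.trans_le ht.1, ht.2.trans_lt hb⟩, hderiv⟩
  rw [contDiff_infty_iff_deriv, hderiv]
  exact ⟨fun t => (hd t).differentiableAt, hψ⟩

theorem exists_test_integral_one {T : ℝ} (hT : 0 < T) :
    ∃ θ : ℝ → ℝ, ContDiff ℝ ∞ θ ∧ HasCompactSupport θ ∧ tsupport θ ⊆ Ioo 0 T ∧
      ∫ t in (0 : ℝ)..T, θ t = 1 := by
  let f : ContDiffBump (T / 2) := ⟨T / 8, T / 4, by linarith, by linarith⟩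
  have hs : tsupport (f.normed volume) ⊆ Ioo 0 T := by
    rw [f.tsupport_normed_eq]
    intro t ht
    rw [Metric.mem_closedBall, Real.dist_eq, abs_le] at ht
    have h1 : f.rOut = T / 4 := rfl
    rw [h1] at ht
    constructor <;> linarith [ht.1, ht.2]
  refine ⟨f.normed volume, f.contDiff_normed, f.hasCompactSupport_normed, hs, ?_⟩
  have h := setIntegral_Ioo_of_tsupport hs fun _ => 1
  simp only [mul_one] at h
  rw [intervalIntegral_eq_Ioo hT.le, h, f.integral_normed]

theorem integrableOn_test_mul {T : ℝ} {w θ : ℝ → ℝ} (hw : IntegrableOn w (Ioo 0 T))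
    (hθ : Continuous θ) (hc : HasCompactSupport θ) :
    IntegrableOn (fun t => w t * θ t) (Ioo 0 T) := by
  obtain ⟨C, hC⟩ := hc.exists_bound_of_continuous hθ
  exact Integrable.mul_bdd hw hθ.aestronglyMeasurable (ae_of_all _ hC)

/-- The lemma of du Bois-Reymond. -/
theorem ae_eq_const_of_integral_deriv {T : ℝ} (hT : 0 < T) {w : ℝ → ℝ}
    (hw : IntegrableOn w (Ioo 0 T))
    (h : ∀ θ : ℝ → ℝ, ContDiff ℝ ∞ θ → HasCompactSupport θ → tsupport θ ⊆ Ioo 0 T →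
      ∫ t in Ioo 0 T, w t * deriv θ t = 0) :
    ∃ c : ℝ, ∀ᵐ t ∂(volume : Measure ℝ).restrict (Ioo 0 T), w t = c := by
  obtain ⟨θ₀, hθ, hθc, hθs, hθ1⟩ := exists_test_integral_one hT
  rw [intervalIntegral_eq_Ioo hT.le] at hθ1
  set c := ∫ t in Ioo 0 T, w t * θ₀ t with hc
  refine ⟨c, ?_⟩
  have hloc : LocallyIntegrableOn (fun t => w t - c) (Ioo 0 T) volume :=
    IntegrableOn.locallyIntegrableOn (Integrable.sub hw (integrable_const c))
  have hae := isOpen_Ioo.ae_eq_zero_of_integral_contDiff_smul_eq_zero hloc (fun φ hφ hφc hφs => by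
    set I := ∫ t in Ioo 0 T, φ t with hI
    -- Subtracting `(∫ φ) θ₀` makes the mean zero, so the result is the derivative of a test
    -- function. This determines the constant as `c = ∫ w θ₀`.
    have hψ : ContDiff ℝ ∞ (fun t => φ t - I * θ₀ t) := hφ.sub (contDiff_const.mul hθ)
    have hψs : tsupport (fun t => φ t - I * θ₀ t) ⊆ tsupport φ ∪ tsupport θ₀ := by
      refine closure_minimal (fun t ht => ?_)
        ((isClosed_tsupport φ).union (isClosed_tsupport θ₀))
      by_contra hn
      rw [mem_union, not_or] at hn
      refine ht ?_
      simp only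
      rw [image_eq_zero_of_notMem_tsupport hn.1, image_eq_zero_of_notMem_tsupport hn.2]
      simp
    have hψc : HasCompactSupport (fun t => φ t - I * θ₀ t) :=
      HasCompactSupport.of_support_subset_isCompact (hφc.isCompact.union hθc.isCompact)
        (subset_closure.trans hψs)
    have hi1 : IntegrableOn φ (Ioo 0 T) :=
      (hφ.continuous.integrable_of_hasCompactSupport hφc).integrableOn
    have hi2 : IntegrableOn θ₀ (Ioo 0 T) :=
      (hθ.continuous.integrable_of_hasCompactSupport hθc).integrableOn
    have hψ0 : ∫ t in (0 : ℝ)..T, (φ t - I * θ₀ t) = 0 := by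
      rw [intervalIntegral_eq_Ioo hT.le, integral_sub hi1 (hi2.const_mul I), integral_const_mul,
        hθ1, ← hI]
      ring
    obtain ⟨θ, h1, h2, h3, h4⟩ := exists_test_primitive hT hψ hψc
      (hψs.trans (union_subset hφs hθs)) hψ0
    have h5 := h θ h1 h2 h3
    rw [h4] at h5
    have e : ∀ t, w t * (φ t - I * θ₀ t) = w t * φ t - I * (w t * θ₀ t) := fun t => by ring
    simp_rw [e] at h5
    have hi3 := integrableOn_test_mul hw hφ.continuous hφc
    have hi4 := integrableOn_test_mul hw hθ.continuous hθc
    rw [integral_sub hi3 (hi4.const_mul I), integral_const_mul] at h5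
    have h6 := setIntegral_Ioo_of_tsupport hφs fun t => w t - c
    simp only [smul_eq_mul]
    rw [← h6]
    have e' : ∀ t, φ t * (w t - c) = w t * φ t - c * φ t := fun t => by ring
    simp_rw [e']
    rw [integral_sub hi3 (hi1.const_mul c), integral_const_mul, ← hI]
    rw [← hc] at h5
    linarith)
  rw [ae_restrict_iff' measurableSet_Ioo]
  filter_upwards [hae] with t ht htT
  exact sub_eq_zero.mp (ht htT)

/-- An integrable function with an integrable weak derivative is a primitive of it. -/
theorem IsWeakDeriv.ae_eq_primitive {T : ℝ} (hT : 0 < T) {w g : ℝ → ℝ}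
    (hw : IntegrableOn w (Ioo 0 T)) (hg : IntegrableOn g (Ioo 0 T))
    (h : IsWeakDeriv T 1 w g) :
    ∃ c : ℝ, ∀ᵐ t ∂(volume : Measure ℝ).restrict (Ioo 0 T),
      w t = c + ∫ s in (0 : ℝ)..t, g s := by
  have hg' := (intervalIntegrable_iff_Ioo hT.le).mpr hg
  have hac := hg'.absolutelyContinuousOnInterval_intervalIntegral (c := 0) (by simp)
  have hGc : ContinuousOn (fun t => ∫ s in (0 : ℝ)..t, g s) (Icc 0 T) := by
    simpa only [uIcc_of_le hT.le] using hac.continuousOn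
  have hGi : IntegrableOn (fun t => ∫ s in (0 : ℝ)..t, g s) (Ioo 0 T) :=
    (memLp_two_of_continuousOn hGc).integrable (by norm_num)
  -- The function `w - ∫₀ᵗ g` has zero weak derivative.
  obtain ⟨c, hc⟩ := ae_eq_const_of_integral_deriv hT (Integrable.sub hw hGi)
    (fun θ hθ hθc hθs => by
      have hz : ∀ t, t ∉ Ioo 0 T → θ t = 0 := fun t ht =>
        image_eq_zero_of_notMem_tsupport fun h' => ht (hθs h')
      have hdc : Continuous (deriv θ) := hθ.continuous_deriv (by simp)
      have hdcs : HasCompactSupport (deriv θ) := hθc.deriv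
      have hprim : ∀ t, ∫ s in (0 : ℝ)..t, deriv θ s = θ t := by
        intro t
        rw [intervalIntegral.integral_deriv_eq_sub (fun s _ => hθ.differentiable (by simp) s)
          (hdc.intervalIntegrable _ _), hz 0 (by simp), sub_zero]
      have h1 := integral_primitive_mul hg' (hdc.intervalIntegrable (μ := volume) 0 T)
      simp_rw [hprim] at h1
      have hi1 := integrableOn_test_mul hg hθ.continuous hθc
      have hi2 := integrableOn_test_mul hGi hdc hdcs
      have hi3 := integrableOn_test_mul hw hdc hdcs
      rw [hz T (by simp), mul_zero, intervalIntegral_eq_Ioo hT.le, integral_add hi1 hi2] at h1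
      have h2 := h θ hθ hθc hθs
      rw [iteratedDeriv_one, pow_one] at h2
      simp only [Pi.sub_apply, sub_mul]
      rw [integral_sub hi3 hi2, h2]
      linarith)
  refine ⟨c, ?_⟩
  filter_upwards [hc] with t ht
  simp only [Pi.sub_apply] at ht
  linarith

theorem ae_eq_of_isWeakDeriv_zero {T : ℝ} {w g : ℝ → ℝ} (hw : IntegrableOn w (Ioo 0 T))
    (hg : IntegrableOn g (Ioo 0 T)) (h : IsWeakDeriv T 0 w g) :
    ∀ᵐ t ∂(volume : Measure ℝ).restrict (Ioo 0 T), w t = g t := by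
  have hloc : LocallyIntegrableOn (fun t => w t - g t) (Ioo 0 T) volume :=
    IntegrableOn.locallyIntegrableOn (Integrable.sub hw hg)
  have hae := isOpen_Ioo.ae_eq_zero_of_integral_contDiff_smul_eq_zero hloc (fun φ hφ hφc hφs => by
    have h1 := h φ hφ hφc hφs
    rw [iteratedDeriv_zero, pow_zero, one_mul] at h1
    have h2 := setIntegral_Ioo_of_tsupport hφs fun t => w t - g t
    simp only [smul_eq_mul]
    rw [← h2]
    have e : ∀ t, φ t * (w t - g t) = w t * φ t - g t * φ t := fun t => by ring
    simp_rw [e]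
    rw [integral_sub (integrableOn_test_mul hw hφ.continuous hφc)
      (integrableOn_test_mul hg hφ.continuous hφc), h1, sub_self])
  rw [ae_restrict_iff' measurableSet_Ioo]
  filter_upwards [hae] with t ht htT
  exact sub_eq_zero.mp (ht htT)

/-- The definition relates each derivative to `u` only. Testing the one of order `k` with `θ'`
relates consecutive derivatives to each other. -/
theorem IsWeakDeriv.succ {T : ℝ} {k : ℕ} {u g g' : ℝ → ℝ} (h : IsWeakDeriv T k u g)
    (h' : IsWeakDeriv T (k + 1) u g') : IsWeakDeriv T 1 g g' := by
  intro θ hθ hθc hθs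
  have h1 := h (deriv θ) (contDiff_infty_iff_deriv.mp hθ).2 hθc.deriv
    ((tsupport_deriv_subset).trans hθs)
  have h2 := h' θ hθ hθc hθs
  rw [iteratedDeriv_succ', h1, pow_succ] at h2
  rw [iteratedDeriv_one, pow_one]
  have h4 : (-1 : ℝ) ^ k * ∫ t in Ioo 0 T, g t * deriv θ t
      = (-1) ^ k * (-1 * ∫ t in Ioo 0 T, g' t * θ t) := by rw [h2]; ring
  exact mul_left_cancel₀ (by simp) h4

/-- A function with square integrable weak derivatives up to order `m + 1` has continuous
derivatives up to order `m`. -/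
theorem exists_continuous_chain {T : ℝ} (hT : 0 < T) (m : ℕ) : ∀ g : ℕ → ℝ → ℝ,
    (∀ k ≤ m + 1, MemLp (g k) 2 (volume.restrict (Ioo 0 T))) →
    (∀ k ≤ m, IsWeakDeriv T 1 (g k) (g (k + 1))) →
    ∃ f : ℕ → ℝ → ℝ, (∀ k ≤ m, Continuous (f k) ∧
        ∀ᵐ t ∂(volume : Measure ℝ).restrict (Ioo 0 T), f k t = g k t) ∧
      ∀ k < m, ∀ t, HasDerivAt (f k) (f (k + 1) t) t := by
  have hint : ∀ f : ℝ → ℝ, MemLp f 2 (volume.restrict (Ioo 0 T)) → IntegrableOn f (Ioo 0 T) :=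
    fun f hf => hf.integrable (by norm_num)
  induction m with
  | zero =>
    intro g hg hw
    obtain ⟨c, hc⟩ := (hw 0 le_rfl).ae_eq_primitive hT (hint _ (hg 0 (by omega)))
      (hint _ (hg 1 (by omega)))
    -- Extension by zero makes the primitive continuous on the whole line, not only on the interval.
    set G : ℝ → ℝ := (Ioo 0 T).indicator (g 1) with hG
    have hGi : Integrable G := (hint _ (hg 1 (by omega))).integrable_indicator measurableSet_Ioo
    refine ⟨fun _ t => c + ∫ s in (0 : ℝ)..t, G s, fun k hk => ⟨?_, ?_⟩, fun k hk => by omega⟩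
    · exact continuous_const.add (intervalIntegral.continuous_primitive
        (fun a b => hGi.intervalIntegrable) 0)
    · obtain rfl : k = 0 := by omega
      filter_upwards [hc, ae_restrict_mem measurableSet_Ioo] with t ht htT
      rw [ht, intervalIntegral_eq_Ioo htT.1.le, intervalIntegral_eq_Ioo htT.1.le]
      congr 1
      refine setIntegral_congr_fun measurableSet_Ioo fun s hs => ?_
      have hsT : s ∈ Ioo 0 T := ⟨hs.1, hs.2.trans htT.2⟩
      rw [hG, indicator_of_mem hsT]
  | succ m ih =>
    intro g hg hw
    -- The induction hypothesis applies to the chain without its first term, which is then recovered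
    -- as a primitive of the next one.
    obtain ⟨f, hf, hfd⟩ := ih (fun k => g (k + 1)) (fun k hk => hg (k + 1) (by omega))
      (fun k hk => hw (k + 1) (by omega))
    obtain ⟨c, hc⟩ := (hw 0 (by omega)).ae_eq_primitive hT (hint _ (hg 0 (by omega)))
      (hint _ (hg 1 (by omega)))
    have hd : ∀ t, HasDerivAt (fun t => c + ∫ s in (0 : ℝ)..t, f 0 s) (f 0 t) t := fun t =>
      ((hf 0 (by omega)).1.integral_hasStrictDerivAt 0 t).hasDerivAt.const_add c
    refine ⟨fun k => Nat.casesOn k (fun t => c + ∫ s in (0 : ℝ)..t, f 0 s) f, ?_, ?_⟩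
    · intro k hk
      cases k with
      | zero =>
        refine ⟨continuous_iff_continuousAt.mpr fun t => (hd t).continuousAt, ?_⟩
        filter_upwards [hc, ae_restrict_mem measurableSet_Ioo] with t ht htT
        change c + _ = _
        rw [ht, intervalIntegral_eq_Ioo htT.1.le, intervalIntegral_eq_Ioo htT.1.le]
        congr 1
        refine integral_congr_ae ?_
        exact ae_restrict_of_ae_restrict_of_subset (Ioo_subset_Ioo_right htT.2.le)
          (hf 0 (by omega)).2
      | succ k => exact hf k (by omega)
    · intro k hk t
      cases k with
      | zero => exact hd t
      | succ k => exact hfd k (by omega) t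

/-! ### Log-convexity of Sobolev norms and interpolation. -/

/-- Log-convexity says that the ratios `β (k+1) / β k` increase up to the factor `K`; `b` such steps
compare the ratio at `a` with the one at `a + b`. The products avoid division by terms that may
vanish. -/
theorem mul_le_of_log_convex_shift {β : ℕ → ℝ} {K : ℝ} {N : ℕ} (h0 : ∀ k, 0 ≤ β k)
    (hK : 0 ≤ K)
    (h : ∀ k, k + 2 ≤ N → β (k + 1) ^ 2 ≤ K * (β k * β (k + 2))) (a b : ℕ) (hab : a + b + 1 ≤ N) :
    β (a + 1) * β (a + b) ≤ K ^ b * (β a * β (a + b + 1)) := by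
  induction b with
  | zero => simp [mul_comm]
  | succ b ih =>
    have ih' := ih (by omega)
    have h1 := h (a + b) (by omega)
    rcases (h0 (a + b + 1)).eq_or_lt with h2 | h2
    · have h3 : β (a + (b + 1)) = 0 := h2.symm
      rw [h3, mul_zero]
      have := h0 a
      have := h0 (a + (b + 1) + 1)
      positivity
    · refine le_of_mul_le_mul_right ?_ h2
      calc β (a + 1) * β (a + b + 1) * β (a + b + 1) = β (a + 1) * β (a + b + 1) ^ 2 := by ring
        _ ≤ β (a + 1) * (K * (β (a + b) * β (a + b + 2))) :=
          mul_le_mul_of_nonneg_left h1 (h0 _)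
        _ = K * β (a + b + 2) * (β (a + 1) * β (a + b)) := by ring
        _ ≤ K * β (a + b + 2) * (K ^ b * (β a * β (a + b + 1))) :=
          mul_le_mul_of_nonneg_left ih' (mul_nonneg hK (h0 _))
        _ = K ^ (b + 1) * (β a * β (a + (b + 1) + 1)) * β (a + b + 1) := by
          rw [show a + (b + 1) + 1 = a + b + 2 by ring]
          ring

/-- A log-convex sequence is super-multiplicative, with constants. -/
theorem mul_le_of_log_convex {β : ℕ → ℝ} {K : ℝ} {N : ℕ} (h0 : ∀ k, 0 ≤ β k)
    (hK : 0 ≤ K) (hmono : ∀ i j, i ≤ j → j ≤ N → β i ≤ β j)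
    (h : ∀ k, k + 2 ≤ N → β (k + 1) ^ 2 ≤ K * (β k * β (k + 2))) (a b : ℕ) (hab : a + b ≤ N) :
    β a * β b ≤ K ^ (a * b) * (β 0 * β (a + b)) := by
  induction a with
  | zero => simp
  | succ a ih =>
    have ih' := ih (by omega)
    have h1 := mul_le_of_log_convex_shift h0 hK h a b (by omega)
    have e : a + 1 + b = a + b + 1 := by ring
    rw [e]
    rcases (h0 (a + b)).eq_or_lt with h2 | h2
    · have h3 : β b = 0 := le_antisymm (h2 ▸ hmono b (a + b) (by omega) (by omega)) (h0 b)
      rw [h3, mul_zero]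
      have := h0 0
      have := h0 (a + b + 1)
      positivity
    · refine le_of_mul_le_mul_right ?_ h2
      calc β (a + 1) * β b * β (a + b) = β b * (β (a + 1) * β (a + b)) := by ring
        _ ≤ β b * (K ^ b * (β a * β (a + b + 1))) := mul_le_mul_of_nonneg_left h1 (h0 _)
        _ = K ^ b * β (a + b + 1) * (β a * β b) := by ring
        _ ≤ K ^ b * β (a + b + 1) * (K ^ (a * b) * (β 0 * β (a + b))) :=
          mul_le_mul_of_nonneg_left ih' (mul_nonneg (pow_nonneg hK _) (h0 _))
        _ = _ := by ring

/-- The sup norm on an interval in terms of the `L²` norms of a function and its derivative. -/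
theorem sq_le_of_hasDerivAt {T : ℝ} (hT : 0 < T) {f f' : ℝ → ℝ} (hf' : Continuous f')
    (hd : ∀ t, HasDerivAt f (f' t) t) {t : ℝ} (ht : t ∈ Icc 0 T) :
    f t ^ 2 ≤ T⁻¹ * (∫ s in Ioo 0 T, f s ^ 2)
      + 2 * (Real.sqrt (∫ s in Ioo 0 T, f s ^ 2) * Real.sqrt (∫ s in Ioo 0 T, f' s ^ 2)) := by
  have hf : Continuous f := continuous_iff_continuousAt.mpr fun t => (hd t).continuousAt
  have m1 := memLp_two_of_continuousOn (T := T) hf.continuousOn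
  have m2 := memLp_two_of_continuousOn (T := T) hf'.continuousOn
  set D := Real.sqrt (∫ s in Ioo 0 T, f s ^ 2) * Real.sqrt (∫ s in Ioo 0 T, f' s ^ 2) with hD
  have hfd : ∫ s in Ioo 0 T, |f s * f' s| ≤ D := by
    have h := abs_integral_mul_le_sqrt m1.abs m2.abs
    simp only [Pi.abs_apply, sq_abs] at h
    simp_rw [abs_mul]
    exact (le_abs_self _).trans h
  have hint : IntegrableOn (fun s => |f s * f' s|) (Ioo 0 T) := (m1.integrable_mul m2).abs
  -- From `f(t)² - f(s)² = 2 ∫ f f'`; the inequality is then averaged over `s`.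
  have hpt : ∀ s ∈ Ioo 0 T, f t ^ 2 ≤ f s ^ 2 + 2 * D := by
    intro s hs
    have h1 := intervalIntegral.integral_eq_sub_of_hasDerivAt (a := s) (b := t)
      (f := fun t => f t ^ 2) (f' := fun t => 2 * (f t * f' t)) (fun x _ => by
        refine ((hd x).pow 2).congr_deriv ?_
        simp only [Nat.cast_ofNat, Nat.add_one_sub_one, pow_one]
        ring)
      (Continuous.intervalIntegrable (by fun_prop) _ _)
    rw [intervalIntegral.integral_const_mul] at h1
    have h2 : |∫ x in s..t, f x * f' x| ≤ D := by
      refine le_trans ?_ hfd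
      rw [← Real.norm_eq_abs]
      refine (intervalIntegral.norm_integral_le_integral_norm_uIoc).trans ?_
      rw [integral_Ioc_eq_integral_Ioo.symm]
      have hsub : uIoc s t ⊆ Ioc 0 T := fun x hx =>
        ⟨(le_min hs.1.le ht.1).trans_lt hx.1, hx.2.trans (max_le hs.2.le ht.2)⟩
      refine setIntegral_mono_set ?_ (ae_of_all _ fun x => abs_nonneg _) hsub.eventuallyLE
      rwa [integrableOn_Ioc_iff_integrableOn_Ioo]
    have := (abs_le.mp h2).2
    linarith
  have h3 : ∫ _ in Ioo 0 T, f t ^ 2 ≤ ∫ s in Ioo 0 T, (f s ^ 2 + 2 * D) :=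
    setIntegral_mono_on (integrable_const _) (m1.integrable_sq.add (integrable_const _))
      measurableSet_Ioo hpt
  rw [integral_add m1.integrable_sq (integrable_const _), integral_const, integral_const] at h3
  simp only [measureReal_restrict_apply_univ, Real.volume_real_Ioo_of_le hT.le, sub_zero,
    smul_eq_mul] at h3
  have h4 : T⁻¹ * (T * f t ^ 2) ≤ T⁻¹ * ((∫ s in Ioo 0 T, f s ^ 2) + T * (2 * D)) := by gcongr
  rw [inv_mul_cancel_left₀ hT.ne', mul_add, inv_mul_cancel_left₀ hT.ne'] at h4
  exact h4

/-- The norm of the first `k` derivatives in a chain of derivatives. -/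
noncomputable def chainNorm (T : ℝ) (w : ℕ → ℝ → ℝ) (k : ℕ) : ℝ :=
  Real.sqrt (∑ i ∈ Finset.range (k + 1), ∫ t in Ioo 0 T, w i t ^ 2)

theorem integral_sq_nonneg (T : ℝ) (f : ℝ → ℝ) : 0 ≤ ∫ t in Ioo 0 T, f t ^ 2 :=
  integral_nonneg fun _ => sq_nonneg _

theorem chainNorm_nonneg (T : ℝ) (w : ℕ → ℝ → ℝ) (k : ℕ) : 0 ≤ chainNorm T w k :=
  Real.sqrt_nonneg _

theorem chainNorm_sq (T : ℝ) (w : ℕ → ℝ → ℝ) (k : ℕ) :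
    chainNorm T w k ^ 2 = ∑ i ∈ Finset.range (k + 1), ∫ t in Ioo 0 T, w i t ^ 2 :=
  Real.sq_sqrt (Finset.sum_nonneg fun i _ => integral_sq_nonneg T (w i))

theorem chainNorm_mono (T : ℝ) (w : ℕ → ℝ → ℝ) {i j : ℕ} (h : i ≤ j) :
    chainNorm T w i ≤ chainNorm T w j :=
  Real.sqrt_le_sqrt (Finset.sum_le_sum_of_subset_of_nonneg
    (Finset.range_subset_range.mpr (by omega)) fun i _ _ => integral_sq_nonneg T (w i))

theorem sqrt_integral_le_chainNorm (T : ℝ) (w : ℕ → ℝ → ℝ) (k : ℕ) :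
    Real.sqrt (∫ t in Ioo 0 T, w k t ^ 2) ≤ chainNorm T w k :=
  Real.sqrt_le_sqrt (Finset.single_le_sum (f := fun i => ∫ t in Ioo 0 T, w i t ^ 2)
    (fun i _ => integral_sq_nonneg T (w i)) (Finset.mem_range.mpr (by omega)))

/-- The cumulative norms absorb the inhomogeneous term with `T⁻¹`, since they increase with the
order. -/
theorem sq_le_chainNorm {T : ℝ} (hT : 0 < T) {w : ℕ → ℝ → ℝ} {k : ℕ}
    (hc : Continuous (w (k + 1))) (hd : ∀ t, HasDerivAt (w k) (w (k + 1) t) t) {t : ℝ}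
    (ht : t ∈ Icc 0 T) :
    w k t ^ 2 ≤ (T⁻¹ + 2) * (chainNorm T w k * chainNorm T w (k + 1)) := by
  have h1 := sq_le_of_hasDerivAt hT hc hd ht
  have h2 := sqrt_integral_le_chainNorm T w k
  have h3 := sqrt_integral_le_chainNorm T w (k + 1)
  have h4 := chainNorm_mono T w (Nat.le_succ k)
  have h5 : ∫ s in Ioo 0 T, w k s ^ 2 ≤ chainNorm T w k * chainNorm T w (k + 1) := by
    calc ∫ s in Ioo 0 T, w k s ^ 2 = Real.sqrt (∫ s in Ioo 0 T, w k s ^ 2)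
          * Real.sqrt (∫ s in Ioo 0 T, w k s ^ 2) :=
          (Real.mul_self_sqrt (integral_sq_nonneg T (w k))).symm
      _ ≤ _ := mul_le_mul h2 (h2.trans h4) (Real.sqrt_nonneg _) (chainNorm_nonneg T w k)
  have h6 : Real.sqrt (∫ s in Ioo 0 T, w k s ^ 2) * Real.sqrt (∫ s in Ioo 0 T, w (k + 1) s ^ 2)
      ≤ chainNorm T w k * chainNorm T w (k + 1) :=
    mul_le_mul h2 h3 (Real.sqrt_nonneg _) (chainNorm_nonneg T w k)
  have h7 : 0 < T⁻¹ := inv_pos.mpr hT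
  nlinarith

/-- Arithmetic–geometric mean inequality. The weight `1/8` is chosen for `chainNorm_log_convex`,
where the two endpoints together then use only a quarter of `y²`. -/
theorem abs_mul_le_of_sq_le {A x y z P Q : ℝ} (hA : 0 ≤ A) (hx : 0 ≤ x) (hy : 0 ≤ y) (hz : 0 ≤ z)
    (hP : P ^ 2 ≤ A * (x * y)) (hQ : Q ^ 2 ≤ A * (y * z)) :
    |P * Q| ≤ y ^ 2 / 8 + 2 * A ^ 2 * (x * z) := by
  refine abs_le_of_sq_le_sq ?_ (by positivity)
  calc (P * Q) ^ 2 = P ^ 2 * Q ^ 2 := by ring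
    _ ≤ (A * (x * y)) * (A * (y * z)) := by gcongr
    _ ≤ _ := by nlinarith [sq_nonneg (y ^ 2 / 8 - 2 * A ^ 2 * (x * z))]

/-- Log-convexity of the norms of a chain of derivatives on an interval. -/
theorem chainNorm_log_convex {T : ℝ} (hT : 0 < T) {w : ℕ → ℝ → ℝ} {k : ℕ}
    (hc : ∀ i ≤ k + 2, Continuous (w i)) (hd : ∀ i < k + 2, ∀ t, HasDerivAt (w i) (w (i + 1) t) t) :
    chainNorm T w (k + 1) ^ 2
      ≤ (6 * (T⁻¹ + 2) ^ 2 + 3) * (chainNorm T w k * chainNorm T w (k + 2)) := by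
  set A := T⁻¹ + 2 with hA
  have hA0 : 0 ≤ A := by positivity
  set x := chainNorm T w k with hx
  set y := chainNorm T w (k + 1) with hy
  set z := chainNorm T w (k + 2) with hz
  have hx0 : 0 ≤ x := chainNorm_nonneg T w k
  have hy0 : 0 ≤ y := chainNorm_nonneg T w _
  have hz0 : 0 ≤ z := chainNorm_nonneg T w _
  have hxz : x ≤ z := chainNorm_mono T w (by omega)
  have hbd : ∀ t ∈ Icc 0 T, |w k t * w (k + 1) t| ≤ y ^ 2 / 8 + 2 * A ^ 2 * (x * z) :=
    fun t ht => abs_mul_le_of_sq_le hA0 hx0 hy0 hz0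
      (sq_le_chainNorm hT (hc _ (by omega)) (hd k (by omega)) ht)
      (sq_le_chainNorm hT (hc _ (by omega)) (hd (k + 1) (by omega)) ht)
  have c0 := hc k (by omega)
  have c1 := hc (k + 1) (by omega)
  have c2 := hc (k + 2) le_rfl
  -- `∫ w_{k+1}²` is integrated by parts. No boundary condition is available, so the values of `w_k
  -- w_{k+1}` at both ends are estimated by `hbd` and partly absorbed in `y²`.
  have h1 := intervalIntegral.integral_eq_sub_of_hasDerivAt (a := 0) (b := T)
    (f := fun t => w k t * w (k + 1) t)
    (f' := fun t => w (k + 1) t ^ 2 + w k t * w (k + 2) t) (fun t _ => by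
      refine ((hd k (by omega) t).mul (hd (k + 1) (by omega) t)).congr_deriv ?_
      rw [sq]) (Continuous.intervalIntegrable (by fun_prop) _ _)
  rw [intervalIntegral.integral_add (Continuous.intervalIntegrable (by fun_prop) _ _)
    (Continuous.intervalIntegrable (by fun_prop) _ _), intervalIntegral_eq_Ioo hT.le,
    intervalIntegral_eq_Ioo hT.le] at h1
  have h2 : |∫ t in Ioo 0 T, w k t * w (k + 2) t| ≤ x * z := by
    refine (abs_integral_mul_le_sqrt (memLp_two_of_continuousOn c0.continuousOn)
      (memLp_two_of_continuousOn c2.continuousOn)).trans ?_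
    exact mul_le_mul (sqrt_integral_le_chainNorm T w k) (sqrt_integral_le_chainNorm T w (k + 2))
      (Real.sqrt_nonneg _) hx0
  have h3 : y ^ 2 = x ^ 2 + ∫ t in Ioo 0 T, w (k + 1) t ^ 2 := by
    rw [hy, hx, chainNorm_sq, chainNorm_sq, Finset.sum_range_succ]
  have h4 := (abs_le.mp (hbd T ⟨hT.le, le_rfl⟩)).2
  have h5 := (abs_le.mp (hbd 0 ⟨le_rfl, hT.le⟩)).1
  have h6 := (abs_le.mp h2).1
  have h7 : x ^ 2 ≤ x * z := by nlinarith
  have h8 : 0 ≤ x * z := mul_nonneg hx0 hz0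
  nlinarith

theorem integral_sq_primitive_le {T : ℝ} (hT : 0 ≤ T) (hT1 : T ≤ 1) {f : ℝ → ℝ}
    (hf : Continuous f) :
    ∫ t in Ioo 0 T, (∫ s in (0 : ℝ)..t, f s) ^ 2 ≤ ∫ t in Ioo 0 T, f t ^ 2 := by
  have hI0 := integral_sq_nonneg T f
  have h1 : ∫ t in Ioo 0 T, (∫ s in (0 : ℝ)..t, f s) ^ 2
      ≤ ∫ _ in Ioo 0 T, T * ∫ s in Ioo 0 T, f s ^ 2 :=
    setIntegral_mono_on (memLp_two_of_continuousOn (intervalIntegral.continuous_primitive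
      (fun a b => hf.intervalIntegrable a b) 0).continuousOn).integrable_sq (integrable_const _)
      measurableSet_Ioo fun t ht => sq_integral_Icc_le (Ioo_subset_Icc_self ht)
        (memLp_two_of_continuousOn hf.continuousOn)
  rw [integral_const] at h1
  simp only [measureReal_restrict_apply_univ, Real.volume_real_Ioo_of_le hT, sub_zero,
    smul_eq_mul] at h1
  refine h1.trans ?_
  rw [← mul_assoc]
  exact mul_le_of_le_one_left hI0 (by nlinarith)

/-- Interpolation inequalities between the `n`-th primitive of a control and its Sobolev norm. -/
theorem exists_interpolation {n : ℕ} {T : ℝ} (hT : 0 < T) (hT1 : T ≤ 1) :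
    ∃ C : ℝ, 0 < C ∧ ∀ (u : ℝ → ℝ) (η : ℝ), MemSobolev (2 * n + 2) T u →
      sobolevNorm (2 * n + 2) T u ≤ η →
      ∃ (v : ℝ → ℝ) (M : ℝ), Continuous v ∧
        (∀ᵐ t ∂(volume : Measure ℝ).restrict (Ioo 0 T), v t = u t) ∧
        0 ≤ M ∧ (∀ t ∈ Icc 0 T, |v t| ≤ M) ∧ M ≤ C * η ∧
        M * Real.sqrt (∫ t in Ioo 0 T, v t ^ 2)
          ≤ C * η * Real.sqrt (∫ t in Ioo 0 T, primitive v n t ^ 2) ∧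
        M * (∫ t in Ioo 0 T, v t ^ 2) ≤ C * η * ∫ t in Ioo 0 T, primitive v n t ^ 2 := by
  set A : ℝ := T⁻¹ + 2 with hA
  set K : ℝ := 6 * A ^ 2 + 3 with hK
  have hA0 : 0 < A := by positivity
  have hK1 : 1 ≤ K := by nlinarith [sq_nonneg A]
  -- The chain starts at `u_n`, has `u` at index `n` and ends with `u^{(2n+1)}`, the last continuous
  -- derivative that `H^{2n+2}` provides. The cubic term needs `n + n + (n + 1) = N`: two `L²` norms
  -- of `u` and one sup norm, which costs one further derivative.
  set N : ℕ := 3 * n + 1 with hN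
  -- One factor for each use of `mul_le_of_log_convex`, with indices `(n, n)`, `(2n, n+1)` and `(n,
  -- n+1)`.
  set E : ℝ := K ^ (n * n) * K ^ (2 * n * (n + 1)) * K ^ (n * (n + 1)) with hE
  have hpow : ∀ m, 1 ≤ K ^ m := fun m => one_le_pow₀ hK1
  have hE1 : 1 ≤ E := one_le_mul_of_one_le_of_one_le
    (one_le_mul_of_one_le_of_one_le (hpow _) (hpow _)) (hpow _)
  refine ⟨Real.sqrt A * E * Real.sqrt (N + 1), by positivity, fun u η hu hη => ?_⟩
  have hη0 : 0 ≤ η := (Real.sqrt_nonneg _).trans hη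
  -- continuous representatives of the derivatives
  have hspec : ∀ k ≤ 2 * n + 2, MemLp (weakDeriv T k u) 2 (volume.restrict (Ioo 0 T)) ∧
      IsWeakDeriv T k u (weakDeriv T k u) := by
    intro k hk
    have h := hu.2 k hk
    have e : weakDeriv T k u = h.choose := by
      unfold weakDeriv
      rw [dif_pos h]
    rw [e]
    exact h.choose_spec
  obtain ⟨f, hf, hfd⟩ := exists_continuous_chain hT (2 * n + 1) (fun k => weakDeriv T k u)
    (fun k hk => (hspec k (by omega)).1)
    (fun k hk => (hspec k (by omega)).2.succ (hspec (k + 1) (by omega)).2)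
  have hfη : ∀ k ≤ 2 * n + 1, ∫ t in Ioo 0 T, f k t ^ 2 ≤ η ^ 2 := by
    intro k hk
    have h1 : ∫ t in Ioo 0 T, f k t ^ 2 = ∫ t in Ioo 0 T, |weakDeriv T k u t| ^ 2 := by
      refine integral_congr_ae ?_
      filter_upwards [(hf k hk).2] with t ht
      rw [ht, sq_abs]
    rw [h1]
    have h2 := (Real.sqrt_le_left hη0).mp hη
    refine le_trans ?_ h2
    exact Finset.single_le_sum (f := fun k => ∫ t in Ioo 0 T, |weakDeriv T k u t| ^ 2)
      (fun i _ => integral_nonneg fun t => by positivity) (Finset.mem_range.mpr (by omega))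
  have hvc : Continuous (f 0) := (hf 0 (by omega)).1
  -- the chain of derivatives of the `n`-th primitive
  set w : ℕ → ℝ → ℝ := fun i => if i ≤ n then primitive (f 0) (n - i) else f (i - n) with hw
  have hw1 : ∀ i, i ≤ n → w i = primitive (f 0) (n - i) := fun i hi => if_pos hi
  have hw2 : ∀ i, n ≤ i → w i = f (i - n) := by
    intro i hi
    rcases hi.eq_or_lt with h | h
    · rw [hw1 i h.ge, ← h, Nat.sub_self]
      rfl
    · exact if_neg (by omega)
  have hwc : ∀ i ≤ N, Continuous (w i) := by
    intro i hi
    rcases le_total i n with h | h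
    · rw [hw1 i h]
      exact continuous_primitive hvc _
    · rw [hw2 i h]
      exact (hf _ (by omega)).1
  have hwd : ∀ i < N, ∀ t, HasDerivAt (w i) (w (i + 1) t) t := by
    intro i hi t
    rcases lt_or_ge i n with h | h
    · rw [hw1 i h.le, hw1 (i + 1) h, show n - i = (n - (i + 1)) + 1 by omega]
      exact hasDerivAt_primitive hvc _ t
    · rw [hw2 i h, hw2 (i + 1) (by omega), show i + 1 - n = (i - n) + 1 by omega]
      exact hfd _ (by omega) t
  have hprimη : ∀ k, ∫ t in Ioo 0 T, primitive (f 0) k t ^ 2 ≤ η ^ 2 := by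
    intro k
    induction k with
    | zero => exact hfη 0 (by omega)
    | succ k ih =>
      refine le_trans ?_ ih
      have hck := continuous_primitive hvc k
      exact integral_sq_primitive_le hT.le hT1 hck
  have hwη : ∀ i ≤ N, ∫ t in Ioo 0 T, w i t ^ 2 ≤ η ^ 2 := by
    intro i hi
    rcases le_total i n with h | h
    · rw [hw1 i h]
      exact hprimη _
    · rw [hw2 i h]
      exact hfη _ (by omega)
  set β : ℕ → ℝ := chainNorm T w with hβ
  have hβ0 : ∀ k, 0 ≤ β k := chainNorm_nonneg T w
  have hβN : β N ≤ Real.sqrt (N + 1) * η := by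
    refine Real.sqrt_le_iff.mpr ⟨by positivity, ?_⟩
    rw [mul_pow, Real.sq_sqrt (by positivity)]
    refine (Finset.sum_le_sum fun i hi =>
      hwη i (by have := Finset.mem_range.mp hi; omega)).trans ?_
    rw [Finset.sum_const, Finset.card_range, nsmul_eq_mul]
    push_cast
    exact le_rfl
  have hlc : ∀ k, k + 2 ≤ N → β (k + 1) ^ 2 ≤ K * (β k * β (k + 2)) := fun k hk =>
    chainNorm_log_convex hT (fun i hi => hwc i (by omega)) (fun i hi => hwd i (by omega))
  have hmul := fun a b (hab : a + b ≤ N) => mul_le_of_log_convex hβ0 (by linarith : 0 ≤ K)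
    (fun i j hij _ => chainNorm_mono T w hij) hlc a b hab
  have hmono : ∀ i j, i ≤ j → β i ≤ β j := fun i j hij => chainNorm_mono T w hij
  have hβ00 : β 0 ^ 2 = ∫ t in Ioo 0 T, primitive (f 0) n t ^ 2 := by
    rw [hβ, chainNorm_sq, zero_add, Finset.sum_range_one, hw1 0 (by omega), Nat.sub_zero]
  have hβ0' : β 0 = Real.sqrt (∫ t in Ioo 0 T, primitive (f 0) n t ^ 2) := by
    rw [← hβ00, Real.sqrt_sq (hβ0 0)]
  have hvn : Real.sqrt (∫ t in Ioo 0 T, f 0 t ^ 2) ≤ β n := by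
    have h := sqrt_integral_le_chainNorm T w n
    rwa [hw2 n le_rfl, Nat.sub_self] at h
  have hvn2 : ∫ t in Ioo 0 T, f 0 t ^ 2 ≤ β n * β n := by
    rw [← Real.mul_self_sqrt (integral_sq_nonneg T (f 0))]
    exact mul_le_mul hvn hvn (Real.sqrt_nonneg _) (hβ0 n)
  have hsA := Real.sqrt_nonneg A
  refine ⟨f 0, Real.sqrt A * β (n + 1), hvc, ?_, by have := hβ0 (n + 1); positivity,
    ?_, ?_, ?_, ?_⟩
  · have h1 := ae_eq_of_isWeakDeriv_zero (hu.1.integrable (by norm_num))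
      ((hspec 0 (by omega)).1.integrable (by norm_num)) (hspec 0 (by omega)).2
    filter_upwards [h1, (hf 0 (by omega)).2] with t h2 h3
    rw [h3, h2]
  · intro t ht
    have h1 := sq_le_chainNorm hT (hwc (n + 1) (by omega)) (hwd n (by omega)) ht
    rw [hw2 n le_rfl, Nat.sub_self] at h1
    have h2 : f 0 t ^ 2 ≤ (Real.sqrt A * β (n + 1)) ^ 2 := by
      rw [mul_pow, Real.sq_sqrt hA0.le, sq (β (n + 1))]
      refine h1.trans ?_
      exact mul_le_mul_of_nonneg_left
        (mul_le_mul_of_nonneg_right (hmono _ _ (by omega)) (hβ0 _)) hA0.le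
    exact abs_le_of_sq_le_sq h2 (by have := hβ0 (n + 1); positivity)
  · calc Real.sqrt A * β (n + 1) ≤ Real.sqrt A * (E * β N) := by
          refine mul_le_mul_of_nonneg_left ?_ hsA
          exact (hmono _ _ (by omega)).trans (le_mul_of_one_le_left (hβ0 N) hE1)
      _ ≤ Real.sqrt A * (E * (Real.sqrt (N + 1) * η)) := by gcongr
      _ = _ := by ring
  · have h1 : β (n + 1) * β n ≤ E * (β 0 * β N) := by
      have h2 := hmul n (n + 1) (by omega)
      have h3 : K ^ (n * (n + 1)) ≤ E := le_mul_of_one_le_left (by positivity)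
        (one_le_mul_of_one_le_of_one_le (hpow _) (hpow _))
      have h4 : β 0 * β (n + (n + 1)) ≤ β 0 * β N :=
        mul_le_mul_of_nonneg_left (hmono _ _ (by omega)) (hβ0 0)
      rw [mul_comm]
      exact h2.trans (mul_le_mul h3 h4 (mul_nonneg (hβ0 _) (hβ0 _)) (by linarith))
    rw [← hβ0']
    calc Real.sqrt A * β (n + 1) * Real.sqrt (∫ t in Ioo 0 T, f 0 t ^ 2)
        ≤ Real.sqrt A * β (n + 1) * β n :=
          mul_le_mul_of_nonneg_left hvn (mul_nonneg hsA (hβ0 _))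
      _ = Real.sqrt A * (β (n + 1) * β n) := by ring
      _ ≤ Real.sqrt A * (E * (β 0 * β N)) := by gcongr
      _ ≤ Real.sqrt A * (E * (β 0 * (Real.sqrt (N + 1) * η))) := by
          have := hβ0 0
          gcongr
      _ = _ := by ring
  -- First `β_n² ≲ β_0 β_{2n}`, then `β_{2n} β_{n+1} ≲ β_0 β_N`.
  · have h1 : β (n + 1) * (β n * β n) ≤ E * (β 0 * β 0 * β N) := by
      have h2 := hmul n n (by omega)
      have h3 := hmul (n + n) (n + 1) (by omega)
      have h4 : K ^ (n * n) * K ^ (2 * n * (n + 1)) ≤ E :=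
        le_mul_of_one_le_right (by positivity) (hpow _)
      have e1 : n + n + (n + 1) = N := by omega
      have e2 : (n + n) * (n + 1) = 2 * n * (n + 1) := by ring
      rw [e1, e2] at h3
      calc β (n + 1) * (β n * β n) ≤ β (n + 1) * (K ^ (n * n) * (β 0 * β (n + n))) :=
            mul_le_mul_of_nonneg_left h2 (hβ0 _)
        _ = K ^ (n * n) * β 0 * (β (n + n) * β (n + 1)) := by ring
        _ ≤ K ^ (n * n) * β 0 * (K ^ (2 * n * (n + 1)) * (β 0 * β N)) :=
            mul_le_mul_of_nonneg_left h3 (mul_nonneg (by positivity) (hβ0 0))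
        _ = K ^ (n * n) * K ^ (2 * n * (n + 1)) * (β 0 * β 0 * β N) := by ring
        _ ≤ _ := mul_le_mul_of_nonneg_right h4
            (mul_nonneg (mul_nonneg (hβ0 _) (hβ0 _)) (hβ0 _))
    rw [← hβ00]
    calc Real.sqrt A * β (n + 1) * (∫ t in Ioo 0 T, f 0 t ^ 2)
        ≤ Real.sqrt A * β (n + 1) * (β n * β n) :=
          mul_le_mul_of_nonneg_left hvn2 (mul_nonneg hsA (hβ0 _))
      _ = Real.sqrt A * (β (n + 1) * (β n * β n)) := by ring
      _ ≤ Real.sqrt A * (E * (β 0 * β 0 * β N)) := by gcongr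
      _ ≤ Real.sqrt A * (E * (β 0 * β 0 * (Real.sqrt (N + 1) * η))) := by
          have := hβ0 0
          gcongr
      _ = _ := by ring

/-! ### Independence of the representative, quadratic drift and conclusion. -/

theorem integral_congr_of_ae_Ioo {T t : ℝ} (ht : t ∈ Icc 0 T) {f g : ℝ → ℝ}
    (h : ∀ᵐ s ∂(volume : Measure ℝ).restrict (Ioo 0 T), f s = g s) :
    ∫ s in (0 : ℝ)..t, f s = ∫ s in (0 : ℝ)..t, g s := by
  rw [intervalIntegral_eq_Ioo ht.1, intervalIntegral_eq_Ioo ht.1]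
  exact integral_congr_ae (ae_restrict_of_ae_restrict_of_subset (Ioo_subset_Ioo_right ht.2) h)

/-- The equation sees the control only up to null sets, so the continuous representative given by
`exists_interpolation` may replace it. -/
theorem IsSolution.congr_control {Γ : H1N → HNeg1N} {T : ℝ} {u v : ℝ → ℝ} {z₀ : L2} {z : ℝ → L2}
    (hz : IsSolution Γ T u z₀ z)
    (h : ∀ᵐ t ∂(volume : Measure ℝ).restrict (Ioo 0 T), v t = u t) : IsSolution Γ T v z₀ z := by
  obtain ⟨h1, h2, ζ, h3, h4, h5⟩ := hz
  refine ⟨h1, h2, ζ, h3, h4, fun t ht w => ?_⟩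
  rw [h5 t ht w]
  congr 1
  refine integral_congr_of_ae_Ioo ht ?_
  filter_upwards [h] with s hs
  rw [hs]

theorem primitive_congr {T : ℝ} {u v : ℝ → ℝ}
    (h : ∀ᵐ t ∂(volume : Measure ℝ).restrict (Ioo 0 T), v t = u t) (k : ℕ) :
    ∀ t ∈ Icc 0 T, primitive v (k + 1) t = primitive u (k + 1) t := by
  induction k with
  | zero => exact fun t ht => integral_congr_of_ae_Ioo ht h
  | succ k ih =>
    intro t ht
    refine integral_congr_of_ae_Ioo ht ?_
    filter_upwards [ae_restrict_mem measurableSet_Ioo] with s hs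
    exact ih s (Ioo_subset_Icc_self hs)

theorem primitiveNormSq_congr {T : ℝ} {u v : ℝ → ℝ}
    (h : ∀ᵐ t ∂(volume : Measure ℝ).restrict (Ioo 0 T), v t = u t) {n : ℕ} (hn : 1 ≤ n) :
    primitiveNormSq n T u = ∫ t in Ioo 0 T, primitive v n t ^ 2 := by
  obtain ⟨k, rfl⟩ : ∃ k, n = k + 1 := ⟨n - 1, by omega⟩
  refine setIntegral_congr_fun measurableSet_Ioo fun t ht => ?_
  simp only [primitive_congr h k t (Ioo_subset_Icc_self ht), sq_abs]

/-- The arithmetic of the final error estimate. -/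
theorem error_bound {A B Cp T U V W κ d n : ℝ} (hA : 0 ≤ A) (hCp : 0 ≤ Cp) (hn : 0 ≤ n)
    (hT : 0 ≤ T) (hU : 0 ≤ U) (hd : 0 ≤ d) (hd1 : d ≤ 1) (hW : 0 ≤ W)
    (hWκ : W ≤ κ * (d + Real.sqrt U))
    (hV : V = Cp * (Real.sqrt T * Real.sqrt U + W))
    (hB : B = A * (1 + n * (2 * (n + 1) * Cp ^ 2 + 2 * Cp))) :
    A * (T * U + n * ((n + 1) * V ^ 2 + V * (Real.sqrt T * Real.sqrt U)))
      ≤ B * (T + 2 * κ ^ 2) * (d + U) := by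
  set s := Real.sqrt T * Real.sqrt U with hs
  have hs0 : 0 ≤ s := by positivity
  have hs2 : s ^ 2 = T * U := by rw [hs, mul_pow, Real.sq_sqrt hT, Real.sq_sqrt hU]
  have hW2 : W ^ 2 ≤ 2 * κ ^ 2 * (d + U) := by
    calc W ^ 2 ≤ (κ * (d + Real.sqrt U)) ^ 2 := by gcongr
      _ = κ ^ 2 * (d + Real.sqrt U) ^ 2 := by ring
      -- Here `d ≤ 1` gives `d² ≤ d`: the error must be linear in `|δ|`.
      _ ≤ κ ^ 2 * (2 * (d + U)) := by
        gcongr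
        nlinarith [Real.sq_sqrt hU, sq_nonneg (d - Real.sqrt U)]
      _ = _ := by ring
  have hsW : s ^ 2 + W ^ 2 ≤ (T + 2 * κ ^ 2) * (d + U) := by
    have : 0 ≤ T * d := mul_nonneg hT hd
    nlinarith
  have hV2 : V ^ 2 ≤ 2 * Cp ^ 2 * (s ^ 2 + W ^ 2) := by
    rw [hV, mul_pow]
    nlinarith [mul_nonneg (sq_nonneg Cp) (sq_nonneg (s - W))]
  have hVs : V * s ≤ 2 * Cp * (s ^ 2 + W ^ 2) := by
    rw [hV]
    nlinarith [mul_nonneg hCp (sq_nonneg (s - W)), mul_nonneg hCp (sq_nonneg W),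
      mul_nonneg hCp (sq_nonneg s)]
  have hq : 0 ≤ s ^ 2 + W ^ 2 := by positivity
  calc A * (T * U + n * ((n + 1) * V ^ 2 + V * s))
      ≤ A * ((s ^ 2 + W ^ 2) + n * ((n + 1) * (2 * Cp ^ 2 * (s ^ 2 + W ^ 2))
        + 2 * Cp * (s ^ 2 + W ^ 2))) := by
        gcongr
        rw [hs2]
        linarith [sq_nonneg W]
    _ = B * (s ^ 2 + W ^ 2) := by rw [hB]; ring
    _ ≤ B * ((T + 2 * κ ^ 2) * (d + U)) := by
        have : 0 ≤ B := by rw [hB]; positivity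
        gcongr
    _ = _ := by ring

set_option maxHeartbeats 800000 in
/-- The quadratic drift of the zero mode along the iterated primitive `u_n`. -/
theorem exists_quadratic_drift {n : ℕ} (hn : 1 ≤ n) {Γ : H1N → HNeg1N} (hΓ : IsAdmissible Γ)
    (hlost : Γ 0 (phiH 0) = 0) (hdir : ∃ J : Finset ℕ, J.card = n ∧ ∀ j ∈ J, Γ 0 (phiH j) ≠ 0)
    (hsum : Summable fun j : ℕ+ => (j : ℝ) ^ (4 * n) * |quadCoef Γ j|)
    (hvanish : ∀ ℓ : ℕ, 1 ≤ ℓ → ℓ ≤ n - 1 →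
      HasSum (fun j : ℕ+ => (j : ℝ) ^ (2 * (2 * ℓ - 1)) * quadCoef Γ j) 0) {a : ℝ}
    (ha : HasSum (fun j : ℕ+ => (j : ℝ) ^ (2 * (2 * n - 1)) * quadCoef Γ j) a)
    {ε : ℝ} (hε : 0 < ε) :
    ∃ Tstar : ℝ, 0 < Tstar ∧ ∀ T ∈ Ioo 0 Tstar, ∃ η : ℝ, 0 < η ∧
      ∀ δ ∈ Icc (-1 : ℝ) 1, ∀ u : ℝ → ℝ,
        MemSobolev (2 * n + 2) T u → sobolevNorm (2 * n + 2) T u ≤ η →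
        ∀ z : ℝ → L2, IsSolution Γ T u (δ • phi 0) z →
          (∀ j : ℕ, 1 ≤ j → coef (z T) j = 0) →
          |coef (z T) 0 - δ + a * (-1) ^ n * primitiveNormSq n T u|
            ≤ ε * (|δ| + primitiveNormSq n T u) := by
  obtain ⟨J, hJ, hJ0⟩ := hdir
  obtain ⟨K, hK, hsol⟩ := solution_estimates hΓ hlost
  obtain ⟨Cp, hCp, hprim⟩ := exists_primitive_bound hJ
  set A : ℝ := ∑' j : ℕ+, (j : ℝ) ^ (4 * n) * |quadCoef Γ j| with hA
  have hA0 : 0 ≤ A := tsum_nonneg fun j => by positivity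
  set B : ℝ := A * (1 + n * (2 * (n + 1) * Cp ^ 2 + 2 * Cp)) with hB
  have hB0 : 0 ≤ B := by positivity
  set D : ℝ := 1 + ∑ j ∈ J, |Γ 0 (phiH j)|⁻¹ with hD
  have hD0 : 0 < D := by positivity
  have hDj : ∀ j ∈ J, |Γ 0 (phiH j)|⁻¹ ≤ D := by
    intro j hj
    have := Finset.single_le_sum (f := fun j => |Γ 0 (phiH j)|⁻¹) (fun i _ => by positivity) hj
    linarith
  -- `B` does not depend on `T`, so the error `B T` is made small by the choice of `Tstar`. The
  -- interpolation constant `G` depends on `T`, which is why `η` is chosen after `T`.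
  refine ⟨min 1 (ε / (4 * (B + 1))), by positivity, fun T hT => ?_⟩
  have hT0 : 0 < T := hT.1
  have hT1 : T ≤ 1 := hT.2.le.trans (min_le_left _ _)
  have hBT : B * T ≤ ε / 4 := by
    have h1 : T ≤ ε / (4 * (B + 1)) := hT.2.le.trans (min_le_right _ _)
    rw [le_div_iff₀ (by positivity)] at h1
    linarith
  obtain ⟨G, hG, hint⟩ := exists_interpolation (n := n) hT0 hT1
  -- `ρ` bounds both `K G η` and `D K G η`; with `ρ² ≤ ρ`, the part of the error governed by `η` is
  -- at most `(1 + 2 B) ρ ≤ ε / 4`.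
  set ρ : ℝ := min 1 (ε / (8 * (B + 1))) with hρ
  have hρ0 : 0 < ρ := by positivity
  have hρ1 : ρ ≤ 1 := min_le_left _ _
  have hρε : 8 * (B + 1) * ρ ≤ ε := by
    have h1 : ρ ≤ ε / (8 * (B + 1)) := min_le_right _ _
    rw [le_div_iff₀ (by positivity)] at h1
    linarith
  set η : ℝ := ρ / (1 + K * G + D * K * G) with hη
  have hη0 : 0 < η := by positivity
  have hKG : K * (G * η) ≤ ρ := by
    rw [hη, ← mul_assoc, mul_div_assoc', div_le_iff₀ (by positivity)]
    have : 0 ≤ ρ * (1 + D * K * G) := by positivity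
    linarith
  have hκρ : D * K * G * η ≤ ρ := by
    rw [hη, mul_div_assoc', div_le_iff₀ (by positivity)]
    have : 0 ≤ ρ * (1 + K * G) := by positivity
    linarith
  refine ⟨η, hη0, fun δ hδ u hu huη z hz hzT => ?_⟩
  obtain ⟨v, M, hv, hvu, hM0, hvM, hM1, hM2, hM3⟩ := hint u η hu huη
  rw [primitiveNormSq_congr hvu hn]
  set U : ℝ := ∫ t in Ioo 0 T, primitive v n t ^ 2 with hU
  set N : ℝ := ∫ t in Ioo 0 T, v t ^ 2 with hN
  have hU0 : 0 ≤ U := integral_sq_nonneg _ _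
  have hN0 : 0 ≤ N := integral_sq_nonneg _ _
  have hKM : K * M ≤ 1 := by
    calc K * M ≤ K * (G * η) := by gcongr
      _ ≤ 1 := hKG.trans hρ1
  obtain ⟨hlin, hquad⟩ := hsol T M hT0.le hT1 hM0 hKM v hv hvM δ hδ z (hz.congr_control hvu)
  have hd1 : |δ| ≤ 1 := abs_le.mpr hδ
  set W : ℝ := D * (K * M * (|δ| + Real.sqrt N)) with hW
  have hW0 : 0 ≤ W := by positivity
  -- As the mode `j` of `z(T)` vanishes, the linear mode is at most the linearisation error divided
  -- by `|⟨μ, φ_j⟩|`.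
  have hWj : ∀ j ∈ J, |linResp ((j : ℝ) ^ 2) v T| ≤ W := by
    intro j hj
    have hj1 : 1 ≤ j := by
      by_contra h
      have : j = 0 := by omega
      exact hJ0 j hj (this ▸ hlost)
    have h1 := hlin j hj1
    rw [hzT j hj1, zero_sub, abs_neg, abs_mul] at h1
    have h2 : 0 < |Γ 0 (phiH j)| := abs_pos.mpr (hJ0 j hj)
    calc |linResp ((j : ℝ) ^ 2) v T|
        = |Γ 0 (phiH j)|⁻¹ * (|Γ 0 (phiH j)| * |linResp ((j : ℝ) ^ 2) v T|) := by
          field_simp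
      _ ≤ D * (K * M * (|δ| + Real.sqrt N)) :=
          mul_le_mul (hDj j hj) h1 (by positivity) hD0.le
  have hWκ : W ≤ D * K * G * η * (|δ| + Real.sqrt U) := by
    calc W = D * K * (M * |δ| + M * Real.sqrt N) := by rw [hW]; ring
      _ ≤ D * K * (G * η * |δ| + G * η * Real.sqrt U) := by gcongr
      _ = _ := by ring
  set V : ℝ := Cp * (Real.sqrt T * Real.sqrt U + W) with hV
  have hV0 : 0 ≤ V := by positivity
  have hVk := hprim T v W hT0.le hv hW0 hWj
  obtain ⟨S, hS, hSU⟩ := exists_quadForm_sum hn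
    (by rw [quadCoef, hlost, zero_mul] : quadCoef Γ 0 = 0) hsum hvanish ha hT0.le hv hV0 hVk
  have h1 := hquad S hS
  have h2 := error_bound hA0 hCp.le (Nat.cast_nonneg n) hT0.le hU0 (abs_nonneg δ) hd1 hW0 hWκ
    hV hB
  have h3 : K * M * (|δ| + N) ≤ K * (G * η) * (|δ| + U) := by
    calc K * M * (|δ| + N) = K * (M * |δ| + M * N) := by ring
      _ ≤ K * (G * η * |δ| + G * η * U) := by gcongr
      _ = _ := by ring
  have h4 : 0 ≤ |δ| + U := by positivity
  have h5 : K * (G * η) + B * (T + 2 * (D * K * G * η) ^ 2) ≤ ε := by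
    have h6 : (D * K * G * η) ^ 2 ≤ ρ := by
      have h8 : 0 ≤ D * K * G * η := by positivity
      calc (D * K * G * η) ^ 2 ≤ ρ ^ 2 := pow_le_pow_left₀ h8 hκρ 2
        _ ≤ ρ := pow_le_of_le_one hρ0.le hρ1 two_ne_zero
    have h7 : B * (D * K * G * η) ^ 2 ≤ B * ρ := mul_le_mul_of_nonneg_left h6 hB0
    linarith
  calc |coef (z T) 0 - δ + a * (-1) ^ n * U|
      = |(coef (z T) 0 - δ - S) + (S + a * (-1) ^ n * U)| := by ring_nf
    _ ≤ |coef (z T) 0 - δ - S| + |S + a * (-1) ^ n * U| := abs_add_le _ _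
    _ ≤ K * (G * η) * (|δ| + U) + B * (T + 2 * (D * K * G * η) ^ 2) * (|δ| + U) :=
        add_le_add (h1.trans h3) (hSU.trans h2)
    _ = (K * (G * η) + B * (T + 2 * (D * K * G * η) ^ 2)) * (|δ| + U) := by ring
    _ ≤ _ := by gcongr

/-- A quadratic drift prevents small-time local null controllability. -/
theorem not_isSTLNC_of_drift {m n : ℕ} {Γ : H1N → HNeg1N} {a : ℝ} (ha0 : a ≠ 0)
    (h : ∀ ε : ℝ, 0 < ε → ∃ Tstar : ℝ, 0 < Tstar ∧ ∀ T ∈ Ioo 0 Tstar, ∃ η : ℝ, 0 < η ∧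
      ∀ δ ∈ Icc (-1 : ℝ) 1, ∀ u : ℝ → ℝ,
        MemSobolev m T u → sobolevNorm m T u ≤ η →
        ∀ z : ℝ → L2, IsSolution Γ T u (δ • phi 0) z →
          (∀ j : ℕ, 1 ≤ j → coef (z T) j = 0) →
          |coef (z T) 0 - δ + a * (-1) ^ n * primitiveNormSq n T u|
            ≤ ε * (|δ| + primitiveNormSq n T u)) : ¬ IsSTLNC m Γ := by
  intro hc
  set b : ℝ := a * (-1) ^ n with hb
  have hb0 : 0 < |b| := abs_pos.mpr (mul_ne_zero ha0 (by simp))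
  -- With this `ε`, less than both `1` and `|b|`, the drift estimate is incompatible with `|-δ + b
  -- U| = |δ| + |b| U` when `δ ≠ 0`.
  obtain ⟨Tstar, hTs, hT⟩ := h (min 1 |b| / 2) (by positivity)
  obtain ⟨η, hη, hmain⟩ := hT (Tstar / 2) ⟨by positivity, by linarith⟩
  obtain ⟨d, hd, hctrl⟩ := hc (Tstar / 2) (by positivity) η hη
  set r : ℝ := min 1 (d / (‖phi 0‖ + 1)) with hr
  have hr0 : 0 < r := by positivity
  have hr1 : r ≤ 1 := min_le_left _ _
  -- The sign of `δ` is opposite to that of the drift coefficient, so that `-δ` and `b U` add up.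
  obtain ⟨δ, hδ, hδb⟩ : ∃ δ : ℝ, |δ| = r ∧ δ * b ≤ 0 := by
    rcases le_total 0 b with h0 | h0
    · exact ⟨-r, by rw [abs_neg, abs_of_pos hr0], by nlinarith⟩
    · exact ⟨r, abs_of_pos hr0, by nlinarith⟩
  have hδ1 : δ ∈ Icc (-1 : ℝ) 1 := abs_le.mp (hδ.le.trans hr1)
  obtain ⟨u, hu, huη, z, hz, hzT⟩ := hctrl (δ • phi 0) (by
    rw [norm_smul, Real.norm_eq_abs, hδ]
    have h1 : r ≤ d / (‖phi 0‖ + 1) := min_le_right _ _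
    rw [le_div_iff₀ (by positivity)] at h1
    linarith)
  have h2 := hmain δ hδ1 u hu huη z hz (fun j _ => by rw [hzT, coef_zero])
  rw [hzT, coef_zero, zero_sub] at h2
  set U := primitiveNormSq n (Tstar / 2) u with hU
  have hU0 : 0 ≤ U := integral_nonneg fun t => by positivity
  have h3 : |-δ + b * U| = |δ| + |b| * U := by
    rcases le_total 0 b with h0 | h0
    · have h4 : δ ≤ 0 := by
        by_contra h5
        rcases h0.eq_or_lt with h6 | h6
        · rw [← h6, abs_zero] at hb0
          exact lt_irrefl _ hb0
        · nlinarith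
      rw [abs_of_nonneg h0, abs_of_nonpos h4, abs_of_nonneg]
      nlinarith
    · have h4 : 0 ≤ δ := by
        by_contra h5
        rcases h0.eq_or_lt with h6 | h6
        · rw [h6, abs_zero] at hb0
          exact lt_irrefl _ hb0
        · nlinarith
      rw [abs_of_nonpos h0, abs_of_nonneg h4, abs_of_nonpos]
      · ring
      · nlinarith
  rw [h3, hδ] at h2
  have h5 : min 1 |b| ≤ 1 := min_le_left _ _
  have h6 : min 1 |b| ≤ |b| := min_le_right _ _
  nlinarith

end NeumannHeat

theorem mainTheorem4 (n : ℕ) (hn : 1 ≤ n)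
    (Γ : NeumannHeat.H1N → NeumannHeat.HNeg1N) (hΓ : NeumannHeat.IsAdmissible Γ)
    (hlost : Γ 0 (NeumannHeat.phiH 0) = 0)
    (hdir : ∃ J : Finset ℕ, J.card = n ∧ ∀ j ∈ J, Γ 0 (NeumannHeat.phiH j) ≠ 0)
    (hsum : Summable fun j : ℕ+ => (j : ℝ) ^ (4 * n) * |NeumannHeat.quadCoef Γ j|)
    (hvanish : ∀ ℓ : ℕ, 1 ≤ ℓ → ℓ ≤ n - 1 →
      HasSum (fun j : ℕ+ => (j : ℝ) ^ (2 * (2 * ℓ - 1)) * NeumannHeat.quadCoef Γ j) 0)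
    (a : ℝ)
    (ha : HasSum (fun j : ℕ+ => (j : ℝ) ^ (2 * (2 * n - 1)) * NeumannHeat.quadCoef Γ j) a)
    (ha0 : a ≠ 0) :
    ¬ NeumannHeat.IsSTLNC (2 * n + 2) Γ ∧
    ∀ ε : ℝ, 0 < ε → ∃ Tstar : ℝ, 0 < Tstar ∧ ∀ T ∈ Set.Ioo 0 Tstar, ∃ η : ℝ, 0 < η ∧
      ∀ δ ∈ Set.Icc (-1 : ℝ) 1, ∀ u : ℝ → ℝ,
        NeumannHeat.MemSobolev (2 * n + 2) T u → NeumannHeat.sobolevNorm (2 * n + 2) T u ≤ η →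
        ∀ z : ℝ → NeumannHeat.L2, NeumannHeat.IsSolution Γ T u (δ • NeumannHeat.phi 0) z →
          (∀ j : ℕ, 1 ≤ j → NeumannHeat.coef (z T) j = 0) →
          |NeumannHeat.coef (z T) 0 - δ + a * (-1) ^ n * NeumannHeat.primitiveNormSq n T u|
            ≤ ε * (|δ| + NeumannHeat.primitiveNormSq n T u) := by
  have h := fun (ε : ℝ) (hε : 0 < ε) =>
    NeumannHeat.exists_quadratic_drift hn hΓ hlost hdir hsum hvanish ha hε
  exact ⟨NeumannHeat.not_isSTLNC_of_drift ha0 h, h⟩
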